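/- Let $\mathbf k$ be an algebraically closed field and $s>2$ an integer. An $s$-homogeneous algebra is a graded algebra $\Lambda=\mathbf k\langle x_1,\dots,x_m\rangle/I$ ($m\ge 0$, $\deg x_i=1$) with $I$ generated by homogeneous polynomials of degree $s$. Its $s$-homogeneous dual is $\Lambda^!=\mathbf k\langle x_1^*,\dots,x_m^*\rangle/I^!$, where $I^!$ is generated by those $f\in\mathbf k\langle x_1^*,\dots,x_m^*\rangle_s\cong\mathbf k\langle x_1,\dots,x_m\rangle_s^*$ with $f(I_s)=0$. For a graded algebra $\Gamma$ of this kind let $\mathcal F(\Gamma)=(\Gamma^{(s)},\Gamma^{(s,1)},\phi_\Gamma)$, where $\Gamma^{(s)}=\bigoplus_i\Gamma_{si}$ is the $s$-Veronese ring, $\Gamma^{(s,1)}=\bigoplus_i\Gamma_{si+1}$ is the Veronese bimodule over it (the summands with index $i$ having degree $i$), and $\phi_\Gamma:(\Gamma^{(s,1)})^{\otimes_{\Gamma^{(s)}}s}\to\Gamma^{(s)}[1]$ is induced by multiplication. Let $A^0=\mathbf k\langle x,y\rangle/(x,y)^2$, and let $D$ be the graded $A^0$-bimodule with generators $f_1,f_2$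 of degree $0$ and relations $yf_1=f_1y=xf_2=f_2x=0$, $f_1x=xf_1$, $f_2y=yf_2$, $f_1x=f_2y$. For an automorphism $\theta$ of $A^0$ let ${}_\theta D$ be $D$ with the left action changed to $a\cdot d=\theta(a)d$. Let $\lambda_1,\lambda_2\in\mathbf k^*$ and let $\nu$ be the automorphism of $A^0$ with $\nu(x)=\lambda_1x$, $\nu(y)=\lambda_2y$. Then an $s$-homogeneous algebra $\Lambda$ such that $\mathcal F(\Lambda^!)\cong(A^0,{}_{\nu^{-1}}D,\varphi)$ for some homomorphism of graded bimodules $\varphi:({}_{\nu^{-1}}D)^{\otimes_{A^0}s}\to A^0[1]$ exists if and only if one of the following conditions holds: (1) $\lambda_1^k\lambda_2^{s+1-k}=1$ for some $2\le k\le s-1$; (2) $\lambda_1\lambda_2^s=\lambda_1^s\lambda_2=1$; (3) $\lambda_1=1$ and $\lambda_2^s=1$, or $\lambda_1^s=1$ and $\lambda_2=1$. Moreover, let $V$ be the space with basis $y_1,y_2$ and let $\nu$ also denote the automorphism $y_i\mapsto\lambda_iy_i$ of $V$. An element $w\in V^{\otimes(s+1)}$ is a $\nu$-twisted potential if it is fixed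 by $v_1\otimes\dots\otimes v_{s+1}\mapsto\nu(v_{s+1})\otimes v_1\otimes\dots\otimes v_s$, and $\mathbf D(w)$ denotes the quotient of $T_{\mathbf k}V=\mathbf k\langle y_1,y_2\rangle$ by the ideal generated by the elements $(f\otimes 1^{\otimes s})(w)$, $f\in V^*$. In each case below $w$ is a $\nu$-twisted potential of degree $s+1$ and $\Lambda=\mathbf D(w)$ is an $s$-homogeneous algebra with $\mathcal F(\Lambda^!)\cong(A^0,{}_{\nu^{-1}}D,\varphi)$ for some $\varphi$: (a) if $\lambda_1^k\lambda_2^{s+1-k}=1$ with $2\le k\le s-1$, then $w=\sum_{i=0}^{k-1}\lambda_1^iy_1^iy_2^{s+1-k}y_1^{k-i}+\lambda_1^k\sum_{i=0}^{s-k}\lambda_2^iy_2^iy_1^ky_2^{s+1-k-i}$; (b) if $\lambda_1\lambda_2^s=\lambda_1^s\lambda_2=1$ and $\lambda_1^k\lambda_2^{s+1-k}\ne1$ for all $2\le k\le s-1$, then $w=\sum_{i=0}^{s}\lambda_1^iy_1^iy_2y_1^{s-i}+\sum_{i=0}^{s}\lambda_2^iy_2^iy_1y_2^{s-i}$; (c)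 if $\lambda_1=1$ and $\lambda_2^s=1$, then $w=y_1^{s+1}+\sum_{i=0}^{s}\lambda_2^iy_2^iy_1y_2^{s-i}$; if $\lambda_1^s=1$ and $\lambda_2=1$, then $w=y_2^{s+1}+\sum_{i=0}^{s}\lambda_1^iy_1^iy_2y_1^{s-i}$. -/

import Mathlib

open scoped TensorProduct

universe u

noncomputable section

namespace HomTriples

/-! ### The free algebra, its homogeneous quotients and homogeneous duals -/

/-- `k⟨x_1, …, x_m⟩`. -/
abbrev Free (k : Type u) [Field k] (m : ℕ) : Type u := FreeAlgebra k (Fin m)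

/-- The component of degree `n` of `k⟨x_1, …, x_m⟩`, all variables having degree one. -/
def deg (k : Type u) [Field k] (m n : ℕ) : Submodule k (Free k m) :=
  (Submodule.span k (Set.range (FreeAlgebra.ι k : Fin m → Free k m))) ^ n

/-- The coefficient of a polynomial at the monomial `x_{v 0} x_{v 1} ⋯`. -/
def coeff {k : Type u} [Field k] {m : ℕ} (v : List (Fin m)) : Free k m →ₗ[k] k :=
  (FreeAlgebra.basisFreeMonoid k (Fin m)).coord (FreeMonoid.ofList v)

/-- The pairing in degree `s` that identifies `k⟨x_1^*, …, x_m^*⟩_s` with the dual space of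
`k⟨x_1, …, x_m⟩_s`: monomials in the dual variables are the basis dual to the monomials. -/
def pairing {k : Type u} [Field k] {m : ℕ} (s : ℕ) (f p : Free k m) : k :=
  ∑ v : Fin s → Fin m, coeff (List.ofFn v) f * coeff (List.ofFn v) p

/-- `k⟨x_1, …, x_m⟩ / I` is an `s`-homogeneous algebra: the ideal `I` is generated by
homogeneous polynomials of degree `s`. -/
def IsHomogeneousIdeal {k : Type u} [Field k] {m : ℕ} (s : ℕ)
    (I : TwoSidedIdeal (Free k m)) : Prop :=
  ∃ S : Set (Free k m), S ⊆ (deg k m s : Set (Free k m)) ∧ I = TwoSidedIdeal.span S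

/-- The ideal `I^!` that defines the `s`-homogeneous dual algebra: it is generated by the
`f` in `k⟨x_1^*, …, x_m^*⟩_s` that vanish on `I_s`. -/
def dualIdeal {k : Type u} [Field k] {m : ℕ} (s : ℕ)
    (I : TwoSidedIdeal (Free k m)) : TwoSidedIdeal (Free k m) :=
  TwoSidedIdeal.span
    {f | f ∈ deg k m s ∧ ∀ p : Free k m, p ∈ I → p ∈ deg k m s → pairing s f p = 0}

/-- The algebra `k⟨x_1, …, x_m⟩ / I`. -/
abbrev QuotAlg {k : Type u} [Field k] {m : ℕ} (I : TwoSidedIdeal (Free k m)) : Type u :=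
  I.ringCon.Quotient

/-- The canonical projection `k⟨x_1, …, x_m⟩ → k⟨x_1, …, x_m⟩ / I`. -/
def proj {k : Type u} [Field k] {m : ℕ} (I : TwoSidedIdeal (Free k m)) :
    Free k m →ₐ[k] QuotAlg I :=
  I.ringCon.mkₐ k

/-- The component of degree `n` of `k⟨x_1, …, x_m⟩ / I`. -/
def gr {k : Type u} [Field k] {m : ℕ} (I : TwoSidedIdeal (Free k m)) (n : ℕ) :
    Submodule k (QuotAlg I) :=
  (deg k m n).map (proj I).toLinearMap

theorem gr_mul {k : Type u} [Field k] {m : ℕ} (I : TwoSidedIdeal (Free k m)) (i j : ℕ) :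
    gr I i * gr I j = gr I (i + j) := by
  unfold gr deg
  rw [pow_add, Submodule.map_mul]

theorem one_mem_gr {k : Type u} [Field k] {m : ℕ} (I : TwoSidedIdeal (Free k m)) :
    (1 : QuotAlg I) ∈ gr I 0 := by
  refine ⟨1, ?_, map_one (proj I)⟩
  simp [deg, Submodule.one_le.mp le_rfl]

/-! ### Veronese rings and Veronese bimodules -/

/-- The subspace `⨁_i Γ_{r i + t}` of `Γ = k⟨x_1, …, x_m⟩ / I`. -/
def veroneseSpace {k : Type u} [Field k] {m : ℕ} (I : TwoSidedIdeal (Free k m)) (r t : ℕ) :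
    Submodule k (QuotAlg I) :=
  ⨆ i : ℕ, gr I (r * i + t)

theorem gr_le_veroneseSpace {k : Type u} [Field k] {m : ℕ} (I : TwoSidedIdeal (Free k m))
    (r t i : ℕ) : gr I (r * i + t) ≤ veroneseSpace I r t :=
  le_iSup (fun i : ℕ => gr I (r * i + t)) i

theorem veroneseSpace_mul {k : Type u} [Field k] {m : ℕ} (I : TwoSidedIdeal (Free k m))
    (r t t' : ℕ) : veroneseSpace I r t * veroneseSpace I r t' ≤ veroneseSpace I r (t + t') := by
  unfold veroneseSpace
  rw [Submodule.iSup_mul]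
  refine iSup_le fun i => ?_
  rw [Submodule.mul_iSup]
  refine iSup_le fun j => ?_
  rw [gr_mul, show r * i + t + (r * j + t') = r * (i + j) + (t + t') by ring]
  exact gr_le_veroneseSpace I r (t + t') (i + j)

theorem veroneseSpace_self {k : Type u} [Field k] {m : ℕ} (I : TwoSidedIdeal (Free k m))
    (r : ℕ) : veroneseSpace I r r ≤ veroneseSpace I r 0 := by
  refine iSup_le fun i => ?_
  rw [show r * i + r = r * (i + 1) + 0 by ring]
  exact gr_le_veroneseSpace I r 0 (i + 1)

theorem prod_mem_veroneseSpace {k : Type u} [Field k] {m : ℕ} (I : TwoSidedIdeal (Free k m))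
    (r : ℕ) (l : List (QuotAlg I)) (hl : ∀ a ∈ l, a ∈ veroneseSpace I r 1) :
    l.prod ∈ veroneseSpace I r l.length := by
  induction l with
  | nil => exact gr_le_veroneseSpace I r 0 0 (by simpa using one_mem_gr I)
  | cons a l ih =>
    rw [List.prod_cons, List.length_cons, add_comm]
    exact veroneseSpace_mul I r 1 l.length (Submodule.mul_mem_mul
      (hl a (by simp)) (ih fun b hb => hl b (by simp [hb])))

theorem prod_mem_gr {k : Type u} [Field k] {m : ℕ} (I : TwoSidedIdeal (Free k m))
    (n : ℕ) (v : Fin n → QuotAlg I) (d : Fin n → ℕ) (hv : ∀ i, v i ∈ gr I (d i)) :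
    (List.ofFn v).prod ∈ gr I (∑ i, d i) := by
  induction n with
  | zero => simpa using one_mem_gr I
  | succ n ih =>
    rw [List.ofFn_succ, List.prod_cons, Fin.sum_univ_succ, ← gr_mul]
    exact Submodule.mul_mem_mul (hv 0) (ih _ _ fun i => hv i.succ)

/-- The Veronese ring `Γ^{(r)} = ⨁_i Γ_{r i}` of `Γ = k⟨x_1, …, x_m⟩ / I`. -/
def veroneseRing {k : Type u} [Field k] {m : ℕ} (I : TwoSidedIdeal (Free k m)) (r : ℕ) :
    Subalgebra k (QuotAlg I) :=
  (veroneseSpace I r 0).toSubalgebra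
    (gr_le_veroneseSpace I r 0 0 (by simpa using one_mem_gr I))
    (fun _ _ ha hb => veroneseSpace_mul I r 0 0 (Submodule.mul_mem_mul ha hb))

/-! ### Bimodules and triples -/

/-- The structure of an `A`-bimodule on the vector space `M` (with `k` acting centrally). -/
structure Bimod (k : Type u) [Field k] (A : Type u) [Ring A] [Algebra k A]
    (M : Type u) [AddCommGroup M] [Module k M] where
  /-- `left a x = a x`. -/
  left : A →ₗ[k] M →ₗ[k] M
  /-- `right x a = x a`. -/
  right : M →ₗ[k] A →ₗ[k] M
  one_left : ∀ x, left 1 x = x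
  mul_left : ∀ a b x, left (a * b) x = left a (left b x)
  right_one : ∀ x, right x 1 = x
  right_mul : ∀ x a b, right x (a * b) = right (right x a) b
  left_right : ∀ a x b, left a (right x b) = right (left a x) b

/-- The bimodule `_θ M`: the right structure is that of `M`, and `a · x = θ(a) x`. -/
def Bimod.twist {k : Type u} [Field k] {A : Type u} [Ring A] [Algebra k A]
    {M : Type u} [AddCommGroup M] [Module k M] (B : Bimod k A M) (θ : A ≃ₐ[k] A) :
    Bimod k A M where
  left := B.left ∘ₗ θ.toLinearMap
  right := B.right
  one_left x := by simp [B.one_left]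
  mul_left a b x := by simp [B.mul_left]
  right_one := B.right_one
  right_mul := B.right_mul
  left_right a x b := by simp [B.left_right]

/-- A multilinear map `φ : M × ⋯ × M → A` (`s` factors) that is `A`-balanced, is `A`-linear on
the left and on the right and adds one to the degrees. By the universal property of the tensor
product this is the same as a homomorphism `M ⊗_A ⋯ ⊗_A M → A[1]` of graded `A`-bimodules. -/
structure IsTripleMap {k : Type u} [Field k] {s : ℕ} {A : Type u} [Ring A] [Algebra k A]
    {M : Type u} [AddCommGroup M] [Module k M] (grA : ℕ → Submodule k A)
    (grM : ℕ → Submodule k M) (B : Bimod k A M)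
    (φ : MultilinearMap k (fun _ : Fin s => M) A) : Prop where
  balanced : ∀ (x : Fin s → M) (a : A) (i j : Fin s), (j : ℕ) = (i : ℕ) + 1 →
    φ (Function.update x i (B.right (x i) a)) = φ (Function.update x j (B.left a (x j)))
  map_left : ∀ (x : Fin s → M) (a : A) (i : Fin s), (i : ℕ) = 0 →
    φ (Function.update x i (B.left a (x i))) = a * φ x
  map_right : ∀ (x : Fin s → M) (a : A) (i : Fin s), (i : ℕ) + 1 = s →
    φ (Function.update x i (B.right (x i) a)) = φ x * a
  map_degree : ∀ (x : Fin s → M) (d : Fin s → ℕ), (∀ i, x i ∈ grM (d i)) →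
    φ x ∈ grA (∑ i, d i + 1)

/-- A triple `(A, M, φ)` of a graded algebra, a graded `A`-bimodule and a homomorphism
`φ : M ⊗_A ⋯ ⊗_A M → A[1]` of graded bimodules (`s` factors). -/
structure Triple (k : Type u) [Field k] (s : ℕ) where
  A : Type u
  [ringA : Ring A]
  [algebraA : Algebra k A]
  grA : ℕ → Submodule k A
  M : Type u
  [groupM : AddCommGroup M]
  [moduleM : Module k M]
  grM : ℕ → Submodule k M
  bimod : Bimod k A M
  φ : MultilinearMap k (fun _ : Fin s => M) A
  isTripleMap : IsTripleMap grA grM bimod φ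

attribute [instance] Triple.ringA Triple.algebraA Triple.groupM Triple.moduleM

/-- An isomorphism of triples. -/
structure Triple.Iso {k : Type u} [Field k] {s : ℕ} (T T' : Triple k s) where
  f : T.A ≃ₐ[k] T'.A
  g : T.M ≃ₗ[k] T'.M
  map_grA : ∀ n, (T.grA n).map f.toLinearMap = T'.grA n
  map_grM : ∀ n, (T.grM n).map g.toLinearMap = T'.grM n
  map_left : ∀ a x, g (T.bimod.left a x) = T'.bimod.left (f a) (g x)
  map_right : ∀ x a, g (T.bimod.right x a) = T'.bimod.right (g x) (f a)
  map_φ : ∀ x : Fin s → T.M, f (T.φ x) = T'.φ (fun i => g (x i))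

/-! ### The triple of a homogeneous algebra -/

/-- The Veronese bimodule `Γ^{(r,1)} = ⨁_i Γ_{r i + 1}` over `Γ^{(r)}`, with the bimodule
structure given by the multiplication of `Γ`. -/
def veroneseBimod {k : Type u} [Field k] {m : ℕ} (I : TwoSidedIdeal (Free k m)) (r : ℕ) :
    Bimod k (veroneseRing I r) (veroneseSpace I r 1) where
  left := LinearMap.mk₂ k
    (fun a x => ⟨(a : QuotAlg I) * x, by
      simpa using veroneseSpace_mul I r 0 1 (Submodule.mul_mem_mul a.2 x.2)⟩)
    (fun a b x => Subtype.ext (add_mul _ _ _))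
    (fun c a x => Subtype.ext (smul_mul_assoc _ _ _))
    (fun a x y => Subtype.ext (mul_add _ _ _))
    (fun c a x => Subtype.ext (mul_smul_comm _ _ _))
  right := LinearMap.mk₂ k
    (fun x a => ⟨(x : QuotAlg I) * a, by
      simpa using veroneseSpace_mul I r 1 0 (Submodule.mul_mem_mul x.2 a.2)⟩)
    (fun a b x => Subtype.ext (add_mul _ _ _))
    (fun c a x => Subtype.ext (smul_mul_assoc _ _ _))
    (fun a x y => Subtype.ext (mul_add _ _ _))
    (fun c a x => Subtype.ext (mul_smul_comm _ _ _))
  one_left x := Subtype.ext (one_mul _)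
  mul_left a b x := Subtype.ext (mul_assoc _ _ _)
  right_one x := Subtype.ext (mul_one _)
  right_mul x a b := Subtype.ext (mul_assoc _ _ _).symm
  left_right a x b := Subtype.ext (mul_assoc _ _ _).symm

/-- The map `(x_1, …, x_s) ↦ x_1 ⋯ x_s` from `Γ^{(s,1)} × ⋯ × Γ^{(s,1)}` to `Γ^{(s)}`. -/
def veroneseMap {k : Type u} [Field k] {m : ℕ} (I : TwoSidedIdeal (Free k m)) (s : ℕ) :
    MultilinearMap k (fun _ : Fin s => veroneseSpace I s 1) (veroneseRing I s) :=
  ((MultilinearMap.mkPiAlgebraFin k s (QuotAlg I)).compLinearMap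
    (fun _ => (veroneseSpace I s 1).subtype)).codRestrict
      (Subalgebra.toSubmodule (veroneseRing I s)) (fun x => by
        apply veroneseSpace_self
        have h := prod_mem_veroneseSpace I s (List.ofFn fun i => (x i : QuotAlg I)) (by
          intro a ha
          obtain ⟨i, rfl⟩ := (List.mem_ofFn' _ _).mp ha
          exact (x i).2)
        rw [List.length_ofFn] at h
        simpa using h)

theorem veroneseMap_coe {k : Type u} [Field k] {m : ℕ} (I : TwoSidedIdeal (Free k m)) (s : ℕ)
    (x : Fin s → veroneseSpace I s 1) :
    (veroneseMap I s x : QuotAlg I) = (List.ofFn fun i => (x i : QuotAlg I)).prod := by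
  change MultilinearMap.mkPiAlgebraFin k s (QuotAlg I) (fun i => (x i : QuotAlg I)) = _
  simp

theorem prod_update_left {R : Type u} [Monoid R] {n : ℕ} (v : Fin n → R) (a : R) (i : Fin n)
    (hi : (i : ℕ) = 0) :
    (List.ofFn (Function.update v i (a * v i))).prod = a * (List.ofFn v).prod := by
  cases n with
  | zero => exact i.elim0
  | succ n =>
    obtain rfl : i = 0 := Fin.ext hi
    simp [List.ofFn_succ, mul_assoc]

theorem prod_update_right {R : Type u} [Monoid R] {n : ℕ} (v : Fin n → R) (a : R) (i : Fin n)
    (hi : (i : ℕ) + 1 = n) :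
    (List.ofFn (Function.update v i (v i * a))).prod = (List.ofFn v).prod * a := by
  induction n with
  | zero => exact i.elim0
  | succ n ih =>
    induction i using Fin.cases with
    | zero =>
      obtain rfl : n = 0 := by simpa using hi.symm
      simp
    | succ i =>
      have h := ih (fun j => v j.succ) i (by simpa using hi)
      have h2 : (fun j : Fin n => Function.update v i.succ (v i.succ * a) j.succ)
          = Function.update (fun j => v j.succ) i (v i.succ * a) := by
        funext j
        by_cases hj : j = i
        · subst hj; simp
        · simp [Function.update_of_ne, hj]
      rw [List.ofFn_succ, List.prod_cons, h2, h, List.ofFn_succ, List.prod_cons, mul_assoc,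
        Function.update_of_ne (Fin.succ_ne_zero i).symm]

theorem prod_update_balanced {R : Type u} [Monoid R] {n : ℕ} (v : Fin n → R) (a : R)
    (i j : Fin n) (hij : (j : ℕ) = (i : ℕ) + 1) :
    (List.ofFn (Function.update v i (v i * a))).prod
      = (List.ofFn (Function.update v j (a * v j))).prod := by
  induction n with
  | zero => exact i.elim0
  | succ n ih =>
    have key : ∀ (l : Fin n) (c : R), (fun t : Fin n => Function.update v l.succ c t.succ)
        = Function.update (fun t => v t.succ) l c := by
      intro l c
      funext t
      by_cases ht : t = l
      · subst ht; simp
      · simp [Function.update_of_ne, ht]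
    induction j using Fin.cases with
    | zero => simp at hij
    | succ j =>
      rw [List.ofFn_succ, List.ofFn_succ, List.prod_cons, List.prod_cons, key,
        Function.update_of_ne (Fin.succ_ne_zero j).symm]
      induction i using Fin.cases with
      | zero =>
        rw [prod_update_left (fun t => v t.succ) a j (by simpa using hij)]
        simp [mul_assoc]
      | succ i =>
        rw [key, Function.update_of_ne (Fin.succ_ne_zero i).symm,
          ih (fun t => v t.succ) i j (by simpa using hij)]

theorem coe_update {k : Type u} [Field k] {m : ℕ} (I : TwoSidedIdeal (Free k m)) (s : ℕ)
    (x : Fin s → veroneseSpace I s 1) (i : Fin s) (c : veroneseSpace I s 1) :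
    (fun t => (Function.update x i c t : QuotAlg I))
      = Function.update (fun t => (x t : QuotAlg I)) i (c : QuotAlg I) := by
  funext t
  by_cases ht : t = i
  · subst ht; simp
  · simp [Function.update_of_ne, ht]

/-- The triple `F(Γ) = (Γ^{(s)}, Γ^{(s,1)}, φ_Γ)` of `Γ = k⟨x_1, …, x_m⟩ / I`. -/
def tripleOf {k : Type u} [Field k] {m : ℕ} (s : ℕ) (I : TwoSidedIdeal (Free k m)) :
    Triple k s where
  A := veroneseRing I s
  grA i := (gr I (s * i)).comap (veroneseRing I s).val.toLinearMap
  M := veroneseSpace I s 1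
  grM i := (gr I (s * i + 1)).comap (veroneseSpace I s 1).subtype
  bimod := veroneseBimod I s
  φ := veroneseMap I s
  isTripleMap := by
    refine ⟨fun x a i j hij => Subtype.ext ?_, fun x a i hi => Subtype.ext ?_,
      fun x a i hi => Subtype.ext ?_, fun x d hd => ?_⟩
    · rw [veroneseMap_coe, veroneseMap_coe, coe_update, coe_update]
      exact prod_update_balanced (fun t => (x t : QuotAlg I)) (a : QuotAlg I) i j hij
    · rw [veroneseMap_coe, coe_update, MulMemClass.coe_mul, veroneseMap_coe]
      exact prod_update_left (fun t => (x t : QuotAlg I)) (a : QuotAlg I) i hi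
    · rw [veroneseMap_coe, coe_update, MulMemClass.coe_mul, veroneseMap_coe]
      exact prod_update_right (fun t => (x t : QuotAlg I)) (a : QuotAlg I) i hi
    · change (veroneseMap I s x : QuotAlg I) ∈ gr I (s * (∑ i, d i + 1))
      rw [veroneseMap_coe]
      have h := prod_mem_gr I s (fun t => (x t : QuotAlg I)) (fun t => s * d t + 1) hd
      rwa [Finset.sum_add_distrib, ← Finset.mul_sum, Finset.sum_const, Finset.card_univ,
        Fintype.card_fin, smul_eq_mul, mul_one, ← Nat.mul_succ] at h

/-! ### The algebra `A^0` and the bimodule `D` -/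

/-- The ideal `(x, y)^2` of `k⟨x, y⟩`. -/
def idealA0 (k : Type u) [Field k] : TwoSidedIdeal (Free k 2) :=
  TwoSidedIdeal.span (deg k 2 2 : Set (Free k 2))

/-- `A^0 = k⟨x, y⟩ / (x, y)^2`. -/
abbrev A0 (k : Type u) [Field k] : Type u := QuotAlg (idealA0 k)

/-- The generator `x` of `A^0`. -/
def A0.x (k : Type u) [Field k] : A0 k := proj (idealA0 k) (FreeAlgebra.ι k 0)

/-- The generator `y` of `A^0`. -/
def A0.y (k : Type u) [Field k] : A0 k := proj (idealA0 k) (FreeAlgebra.ι k 1)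

/-- The enveloping algebra of `A^0`: a left module over `A0 ⊗ A0ᵐᵒᵖ` is an `A^0`-bimodule,
with `a x b = (a ⊗ b) • x`. -/
abbrev EnvA0 (k : Type u) [Field k] : Type u := A0 k ⊗[k] (A0 k)ᵐᵒᵖ

/-- The element `a f_i` of the free bimodule with basis `f_1, f_2` (here `i = 0, 1`). -/
def leftGen {k : Type u} [Field k] (a : A0 k) (i : Fin 2) : Fin 2 → EnvA0 k :=
  Pi.single i (a ⊗ₜ[k] (1 : (A0 k)ᵐᵒᵖ))

/-- The element `f_i a` of the free bimodule with basis `f_1, f_2` (here `i = 0, 1`). -/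
def rightGen {k : Type u} [Field k] (i : Fin 2) (a : A0 k) : Fin 2 → EnvA0 k :=
  Pi.single i ((1 : A0 k) ⊗ₜ[k] MulOpposite.op a)

/-- The relations `y f_1, f_1 y, x f_2, f_2 x, f_1 x - x f_1, f_2 y - y f_2, f_1 x - f_2 y`. -/
def relD (k : Type u) [Field k] : Submodule (EnvA0 k) (Fin 2 → EnvA0 k) :=
  Submodule.span (EnvA0 k)
    {leftGen (A0.y k) 0, rightGen 0 (A0.y k), leftGen (A0.x k) 1, rightGen 1 (A0.x k),
      rightGen 0 (A0.x k) - leftGen (A0.x k) 0, rightGen 1 (A0.y k) - leftGen (A0.y k) 1,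
      rightGen 0 (A0.x k) - rightGen 1 (A0.y k)}

/-- The underlying space of the bimodule `D`. -/
abbrev D (k : Type u) [Field k] : Type u := (Fin 2 → EnvA0 k) ⧸ relD k

/-- The component `D_n`, spanned by the `a f_i b` with `deg a + deg b = n`. -/
def grD (k : Type u) [Field k] (n : ℕ) : Submodule k (D k) :=
  Submodule.span k {z | ∃ (p q : ℕ) (a b : A0 k) (i : Fin 2), p + q = n ∧
    a ∈ gr (idealA0 k) p ∧ b ∈ gr (idealA0 k) q ∧
    z = (relD k).mkQ (Pi.single i (a ⊗ₜ[k] MulOpposite.op b))}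

/-- The bimodule structure of `D`: `a z = (a ⊗ 1) • z` and `z a = (1 ⊗ a) • z`. -/
def bimodD (k : Type u) [Field k] : Bimod k (A0 k) (D k) where
  left := LinearMap.mk₂ k (fun a z => (a ⊗ₜ[k] (1 : (A0 k)ᵐᵒᵖ) : EnvA0 k) • z)
    (fun a b z => by rw [TensorProduct.add_tmul, add_smul])
    (fun c a z => smul_assoc c (a ⊗ₜ[k] (1 : (A0 k)ᵐᵒᵖ) : EnvA0 k) z)
    (fun a z z' => smul_add _ _ _)
    (fun c a z => smul_comm _ _ _)
  right := LinearMap.mk₂ k (fun z a => ((1 : A0 k) ⊗ₜ[k] MulOpposite.op a : EnvA0 k) • z)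
    (fun z z' a => smul_add _ _ _)
    (fun c z a => smul_comm _ _ _)
    (fun z a b => by rw [MulOpposite.op_add, TensorProduct.tmul_add, add_smul])
    (fun c z a => by rw [MulOpposite.op_smul, TensorProduct.tmul_smul, smul_assoc])
  one_left z := one_smul (EnvA0 k) z
  mul_left a b z := by
    have h := mul_smul (a ⊗ₜ[k] (1 : (A0 k)ᵐᵒᵖ) : EnvA0 k) (b ⊗ₜ[k] (1 : (A0 k)ᵐᵒᵖ)) z
    rwa [Algebra.TensorProduct.tmul_mul_tmul, mul_one] at h
  right_one z := one_smul (EnvA0 k) z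
  right_mul z a b := by
    have h := mul_smul ((1 : A0 k) ⊗ₜ[k] MulOpposite.op b : EnvA0 k)
      ((1 : A0 k) ⊗ₜ[k] MulOpposite.op a) z
    rwa [Algebra.TensorProduct.tmul_mul_tmul, mul_one, ← MulOpposite.op_mul] at h
  left_right a z b := by
    have h := mul_smul (a ⊗ₜ[k] (1 : (A0 k)ᵐᵒᵖ) : EnvA0 k)
      ((1 : A0 k) ⊗ₜ[k] MulOpposite.op b) z
    have h' := mul_smul ((1 : A0 k) ⊗ₜ[k] MulOpposite.op b : EnvA0 k)
      (a ⊗ₜ[k] (1 : (A0 k)ᵐᵒᵖ)) z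
    rw [Algebra.TensorProduct.tmul_mul_tmul, mul_one, one_mul] at h h'
    exact h.symm.trans h'

/-- The triple `(A^0, _{ν⁻¹}D, φ)`. -/
def tripleD {k : Type u} [Field k] {s : ℕ} (ν : A0 k ≃ₐ[k] A0 k)
    (φ : MultilinearMap k (fun _ : Fin s => D k) (A0 k))
    (hφ : IsTripleMap (gr (idealA0 k)) (grD k) ((bimodD k).twist ν.symm) φ) : Triple k s where
  A := A0 k
  grA := gr (idealA0 k)
  M := D k
  grM := grD k
  bimod := (bimodD k).twist ν.symm
  φ := φ
  isTripleMap := hφ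

/-- `Λ = k⟨x_1, …, x_m⟩ / I` is an `s`-homogeneous algebra and `F(Λ^!) = (A^0, _{ν⁻¹}D, φ)`
for some `φ`, equality of triples being understood up to isomorphism. -/
def Realizes {k : Type u} [Field k] {m : ℕ} (s : ℕ) (ν : A0 k ≃ₐ[k] A0 k)
    (I : TwoSidedIdeal (Free k m)) : Prop :=
  IsHomogeneousIdeal s I ∧
    ∃ (φ : MultilinearMap k (fun _ : Fin s => D k) (A0 k))
      (hφ : IsTripleMap (gr (idealA0 k)) (grD k) ((bimodD k).twist ν.symm) φ),
      Nonempty ((tripleOf s (dualIdeal s I)).Iso (tripleD ν φ hφ))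

/-! ### Twisted potentials -/

/-- The linear form `∑ v_i y_i` in `k⟨y_1, …, y_n⟩`. -/
def linForm {k : Type u} [Field k] {n : ℕ} (v : Fin n → k) : Free k n :=
  ∑ i, v i • FreeAlgebra.ι k i

/-- The monomial `y_{l 0} y_{l 1} ⋯`. -/
def mono {k : Type u} [Field k] {n : ℕ} (l : List (Fin n)) : Free k n :=
  (l.map (FreeAlgebra.ι k)).prod

/-- The map `φ_σ : v_1 ⊗ ⋯ ⊗ v_N ↦ σ(v_N) ⊗ v_1 ⊗ ⋯ ⊗ v_{N-1}`, for all `N ≥ 1` at once, on the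
tensor algebra `k⟨y_1, …, y_n⟩` of `V = k^n` with basis `y_1, …, y_n`. -/
def rotate {k : Type u} [Field k] {n : ℕ} (σ : (Fin n → k) ≃ₗ[k] (Fin n → k)) :
    Free k n →ₗ[k] Free k n :=
  (FreeAlgebra.basisFreeMonoid k (Fin n)).constr k fun l =>
    match l.toList.getLast? with
    | none => 1
    | some i => linForm (σ (Pi.single i 1)) * mono l.toList.dropLast

/-- `w ∈ V^{⊗ N}` is a `σ`-twisted potential of degree `N`. -/
def IsTwistedPotential {k : Type u} [Field k] {n : ℕ} (σ : (Fin n → k) ≃ₗ[k] (Fin n → k))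
    (N : ℕ) (w : Free k n) : Prop :=
  w ∈ deg k n N ∧ rotate σ w = w

/-- The map `f ⊗ 1 ⊗ ⋯ ⊗ 1 : V^{⊗ N} → V^{⊗ (N-1)}` (for all `N ≥ 1` at once), where
`f ∈ V^*` has the value `f i` on `y_i`. -/
def contract {k : Type u} [Field k] {n : ℕ} (f : Fin n → k) : Free k n →ₗ[k] Free k n :=
  (FreeAlgebra.basisFreeMonoid k (Fin n)).constr k fun l =>
    match l.toList with
    | [] => 0
    | i :: t => f i • mono t

/-- The ideal that defines the algebra `D(w)` of a twisted potential `w`. -/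
def potentialIdeal {k : Type u} [Field k] {n : ℕ} (w : Free k n) : TwoSidedIdeal (Free k n) :=
  TwoSidedIdeal.span (Set.range fun f : Fin n → k => contract f w)

/-- The automorphism `y_1 ↦ l₁ y_1`, `y_2 ↦ l₂ y_2` of `k^2`. -/
def diagAut {k : Type u} [Field k] (l₁ l₂ : kˣ) : (Fin 2 → k) ≃ₗ[k] (Fin 2 → k) :=
  LinearEquiv.piCongrRight fun i => LinearEquiv.smulOfUnit (![l₁, l₂] i)

/-- The variable `y_1` of `k⟨y_1, y_2⟩`. -/
def y₁ (k : Type u) [Field k] : Free k 2 := FreeAlgebra.ι k 0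

/-- The variable `y_2` of `k⟨y_1, y_2⟩`. -/
def y₂ (k : Type u) [Field k] : Free k 2 := FreeAlgebra.ι k 1

/-- `∑_{i=0}^{j-1} l₁^i y_1^i y_2^{s+1-j} y_1^{j-i}
  + l₁^j ∑_{i=0}^{s-j} l₂^i y_2^i y_1^j y_2^{s+1-j-i}`. -/
def potentialMixed {k : Type u} [Field k] (s j : ℕ) (l₁ l₂ : kˣ) : Free k 2 :=
  ∑ i ∈ Finset.range j,
      (l₁ : k) ^ i • (y₁ k ^ i * y₂ k ^ (s + 1 - j) * y₁ k ^ (j - i))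
    + (l₁ : k) ^ j • ∑ i ∈ Finset.range (s + 1 - j),
      (l₂ : k) ^ i • (y₂ k ^ i * y₁ k ^ j * y₂ k ^ (s + 1 - j - i))

/-- `∑_{i=0}^{s} l^i u^i v u^{s-i}`. -/
def cyclicSum {k : Type u} [Field k] (s : ℕ) (l : kˣ) (u v : Free k 2) : Free k 2 :=
  ∑ i ∈ Finset.range (s + 1), (l : k) ^ i • (u ^ i * v * u ^ (s - i))

end HomTriples

end

open HomTriples

noncomputable section

namespace HomTriples

/-! ### Monomials and linear functionals on the free algebra -/

/-! Write Γ for the dual algebra Λ^!. The map φ only has to exist, and it can be carried along any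
isomorphism of the remaining data (`exists_iso_of_coord`), so the condition concerns only the graded
algebra Γ^{(s)} and the graded bimodule Γ^{(s,1)}. In coordinates it says that Γ_1, Γ_s, Γ_{s+1}
have bases e_i, X_j, Z with e_i X_j = δ_ij Z and X_j e_i = δ_ij λ_i⁻¹ Z (`Frame`, `Frame.coord`,
`Coord.frame`); everything in degree at least s + 2 then vanishes by itself.

Necessity. For a word l of length s in the e_i, let c(jl) be its coefficient at X_j, so that e_j l =
c(jl) Z. Associativity gives c(jl) = λ_j c(lj), and a full turn shows that c(W) ≠ 0 forces λ_1^a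
λ_2^b = 1, where a and b count the letters of W (`pow_mul_pow_eq_one_of_rotate`). If (1) fails,
every W with c(W) ≠ 0 contains one of the letters at most once. The remaining input is
`Frame.exists_ne_replicate`: the words l with c(jl) ≠ 0 are never just one power p^s. Otherwise, all
relations having degree s, Γ would map to a polynomial ring with e_p ↦ T and e_q ↦ 0, although
e_p^{s+1} is a multiple of Z = e_q X_q. These facts leave only (2) and (3)
(`Frame.eq_one_and_pow_eq_one`, `conditions_of_frame`).

Sufficiency. For a twisted potential w, the relations of the dual of D(w) are the elements of degree
s killed by the functionals "coefficient of jl in w" (`dualIdeal_potentialIdeal`). Reading off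
coefficients of w gives a functional on Γ, because w is twisted cyclic, and this functional shows Z
≠ 0 and computes all structure constants. What is left is that Γ_{s+1} is no larger than a line.
This is linear algebra with the identities e_i [mt] = [im] e_t (`IsRigid`, `frame_of_isRigid`), and
for each potential a few well-chosen words suffice (`frame_of_potentialMixed`,
`frame_of_two_cyclicSums`, `frame_of_powers`). -/

theorem mono_append {k : Type u} [Field k] {m : ℕ} (l l' : List (Fin m)) :
    (mono (l ++ l') : Free k m) = mono l * mono l' := by
  simp [mono]

theorem mono_cons {k : Type u} [Field k] {m : ℕ} (i : Fin m) (l : List (Fin m)) :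
    (mono (i :: l) : Free k m) = FreeAlgebra.ι k i * mono l := by
  simp [mono]

theorem mono_nil {k : Type u} [Field k] {m : ℕ} : (mono [] : Free k m) = 1 := by
  simp [mono]

theorem mono_singleton {k : Type u} [Field k] {m : ℕ} (i : Fin m) :
    (mono [i] : Free k m) = FreeAlgebra.ι k i := by
  simp [mono]

theorem basisFreeMonoid_ofList {k : Type u} [Field k] {m : ℕ} (l : List (Fin m)) :
    FreeAlgebra.basisFreeMonoid k (Fin m) (FreeMonoid.ofList l) = mono l := by
  simp [FreeAlgebra.basisFreeMonoid, mono, FreeAlgebra.equivMonoidAlgebraFreeMonoid,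
    FreeMonoid.lift_apply]

/-- The linear functional on `k⟨x_1, …, x_m⟩` with prescribed values on the monomials. -/
def ev {k : Type u} [Field k] {m : ℕ} (c : List (Fin m) → k) : Free k m →ₗ[k] k :=
  (FreeAlgebra.basisFreeMonoid k (Fin m)).constr k fun l => c l.toList

theorem ev_mono {k : Type u} [Field k] {m : ℕ} (c : List (Fin m) → k) (l : List (Fin m)) :
    ev c (mono l) = c l := by
  rw [← basisFreeMonoid_ofList, ev, Module.Basis.constr_basis]
  simp

theorem coeff_mono {k : Type u} [Field k] {m : ℕ} (l l' : List (Fin m)) :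
    coeff l (mono l' : Free k m) = if l' = l then 1 else 0 := by
  rw [← basisFreeMonoid_ofList, coeff, Module.Basis.coord_apply, Module.Basis.repr_self]
  split_ifs with h
  · rw [h, Finsupp.single_eq_same]
  · exact Finsupp.single_eq_of_ne fun h' => h (FreeMonoid.ofList.injective h'.symm)

theorem contract_mono {k : Type u} [Field k] {m : ℕ} (f : Fin m → k) (i : Fin m)
    (l : List (Fin m)) : contract f (mono (i :: l)) = f i • mono l := by
  rw [← basisFreeMonoid_ofList, contract, Module.Basis.constr_basis]
  simp

theorem rotate_mono {k : Type u} [Field k] {m : ℕ} (σ : (Fin m → k) ≃ₗ[k] (Fin m → k))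
    (l : List (Fin m)) (i : Fin m) :
    rotate σ (mono (l ++ [i])) = linForm (σ (Pi.single i 1)) * mono l := by
  rw [← basisFreeMonoid_ofList, rotate, Module.Basis.constr_basis]
  simp

theorem span_range_pow {k : Type u} [Field k] {A : Type*} [Ring A] [Algebra k A] {ι : Type*}
    (e : ι → A) (n : ℕ) :
    Submodule.span k (Set.range e) ^ n =
      Submodule.span k {a | ∃ l : List ι, l.length = n ∧ (l.map e).prod = a} := by
  induction n with
  | zero =>
    rw [pow_zero, Submodule.one_eq_span]
    congr 1
    ext a
    simp [eq_comm]
  | succ n ih =>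
    rw [pow_succ', ih, Submodule.span_mul_span]
    congr 1
    ext a
    constructor
    · rintro ⟨_, ⟨i, rfl⟩, _, ⟨l, rfl, rfl⟩, rfl⟩
      exact ⟨i :: l, by simp, by simp⟩
    · rintro ⟨_ | ⟨i, l⟩, hl, rfl⟩
      · simp at hl
      · exact ⟨_, ⟨i, rfl⟩, _, ⟨l, by simpa using hl, rfl⟩, by simp⟩

theorem deg_eq_span (k : Type u) [Field k] (m n : ℕ) :
    deg k m n = Submodule.span k {a | ∃ l : List (Fin m), l.length = n ∧ mono l = a} :=
  span_range_pow _ n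

theorem mono_mem_deg {k : Type u} [Field k] {m : ℕ} (l : List (Fin m)) :
    (mono l : Free k m) ∈ deg k m l.length := by
  rw [deg_eq_span]
  exact Submodule.subset_span ⟨l, rfl, rfl⟩

theorem mono_mem_deg_of_length {k : Type u} [Field k] {m n : ℕ} {l : List (Fin m)}
    (h : l.length = n) : (mono l : Free k m) ∈ deg k m n :=
  h ▸ mono_mem_deg l

theorem eq_of_mem_deg {k : Type u} [Field k] {m n : ℕ} {V : Type*} [AddCommGroup V] [Module k V]
    {f g : Free k m →ₗ[k] V} (h : ∀ l : List (Fin m), l.length = n → f (mono l) = g (mono l))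
    {p : Free k m} (hp : p ∈ deg k m n) : f p = g p := by
  rw [deg_eq_span] at hp
  refine LinearMap.eqOn_span (f := f) (g := g) ?_ hp
  rintro _ ⟨l, hl, rfl⟩
  exact h l hl

theorem linearMap_ext_mono {k : Type u} [Field k] {m : ℕ} {V : Type*} [AddCommGroup V]
    [Module k V] {f g : Free k m →ₗ[k] V} (h : ∀ l, f (mono l) = g (mono l)) : f = g := by
  refine (FreeAlgebra.basisFreeMonoid k (Fin m)).ext fun l => ?_
  have := h l.toList
  rwa [← basisFreeMonoid_ofList, FreeMonoid.ofList_toList] at this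

theorem coeff_eq_zero_of_mem_deg {k : Type u} [Field k] {m n : ℕ} {p : Free k m}
    (hp : p ∈ deg k m n) {l : List (Fin m)} (hl : l.length ≠ n) : coeff l p = 0 := by
  refine eq_of_mem_deg (g := 0) (fun l' hl' => ?_) hp
  rw [coeff_mono, if_neg (by rintro rfl; exact hl hl')]
  rfl

/-- A linear functional that vanishes on all multiples of the generators by monomials vanishes on
the ideal. -/
theorem eq_zero_of_mem_span {k : Type u} [Field k] {m : ℕ} {S : Set (Free k m)}
    (f : Free k m →ₗ[k] k) (h : ∀ a ∈ S, ∀ p q, f (mono p * a * mono q) = 0)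
    {x : Free k m} (hx : x ∈ TwoSidedIdeal.span S) : f x = 0 := by
  have h1 : ∀ a ∈ S, ∀ p, ∀ v, f (mono p * a * v) = 0 := by
    intro a ha p v
    have : f ∘ₗ LinearMap.mulLeft k (mono p * a) = 0 :=
      linearMap_ext_mono fun q => h a ha p q
    exact LinearMap.congr_fun this v
  have h2 : ∀ a ∈ S, ∀ u v, f (u * a * v) = 0 := by
    intro a ha u v
    have : f ∘ₗ LinearMap.mulRight k (a * v) = 0 :=
      linearMap_ext_mono fun p => by simpa [mul_assoc] using h1 a ha p v
    simpa [mul_assoc] using LinearMap.congr_fun this u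
  rw [TwoSidedIdeal.mem_span_iff_mem_addSubgroup_closure] at hx
  refine AddSubgroup.closure_induction (p := fun x _ => f x = 0) ?_ (map_zero f) ?_ ?_ hx
  · rintro _ ⟨_, ⟨u, -, a, ha, rfl⟩, v, -, rfl⟩
    exact h2 a ha u v
  · intro a b _ _ ha hb
    rw [map_add, ha, hb, add_zero]
  · intro a _ ha
    rw [map_neg, ha, neg_zero]

/-! ### Quotients of the free algebra -/

theorem proj_eq_zero_iff {k : Type u} [Field k] {m : ℕ} (I : TwoSidedIdeal (Free k m))
    (p : Free k m) : proj I p = 0 ↔ p ∈ I := by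
  rw [TwoSidedIdeal.mem_iff, ← RingCon.eq]
  rfl

theorem proj_surjective {k : Type u} [Field k] {m : ℕ} (I : TwoSidedIdeal (Free k m)) :
    Function.Surjective (proj I) := fun x => Quotient.inductionOn' x fun p => ⟨p, rfl⟩

/-- The quotient is generated in degree one; this is also why one vanishing component kills all
later ones. -/
theorem gr_eq_pow {k : Type u} [Field k] {m : ℕ} (I : TwoSidedIdeal (Free k m)) (n : ℕ) :
    gr I n = gr I 1 ^ n := by
  unfold gr deg
  rw [Submodule.map_pow, pow_one]

theorem gr_zero {k : Type u} [Field k] {m : ℕ} (I : TwoSidedIdeal (Free k m)) :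
    gr I 0 = Submodule.span k {1} := by
  rw [gr_eq_pow, pow_zero, Submodule.one_eq_span]

theorem gr_one {k : Type u} [Field k] {m : ℕ} (I : TwoSidedIdeal (Free k m)) :
    gr I 1 = Submodule.span k (Set.range fun i => proj I (FreeAlgebra.ι k i)) := by
  unfold gr deg
  rw [pow_one, Submodule.map_span, ← Set.range_comp]
  rfl

theorem proj_mem_gr {k : Type u} [Field k] {m n : ℕ} (I : TwoSidedIdeal (Free k m))
    {p : Free k m} (hp : p ∈ deg k m n) : proj I p ∈ gr I n :=
  Submodule.mem_map_of_mem hp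

theorem gr_eq_bot_of_le {k : Type u} [Field k] {m : ℕ} {I : TwoSidedIdeal (Free k m)} {n : ℕ}
    (h : gr I n = ⊥) {n' : ℕ} (hn : n ≤ n') : gr I n' = ⊥ := by
  obtain ⟨d, rfl⟩ := Nat.exists_eq_add_of_le hn
  rw [← gr_mul, h, Submodule.bot_mul]

/-- A linear functional that vanishes on the ideal factors through the quotient. -/
theorem exists_functional {k : Type u} [Field k] {m : ℕ} (I : TwoSidedIdeal (Free k m))
    (f : Free k m →ₗ[k] k) (h : ∀ x ∈ I, f x = 0) :
    ∃ g : QuotAlg I →ₗ[k] k, ∀ x, g (proj I x) = f x := by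
  have hs : Function.Surjective (proj I).toLinearMap := proj_surjective I
  have hk : LinearMap.ker (proj I).toLinearMap ≤ LinearMap.ker f := fun x hx =>
    h x ((proj_eq_zero_iff I x).1 hx)
  refine ⟨Submodule.liftQ _ f hk ∘ₗ
    ((proj I).toLinearMap.quotKerEquivOfSurjective hs).symm.toLinearMap, fun x => ?_⟩
  have : ((proj I).toLinearMap.quotKerEquivOfSurjective hs).symm (proj I x)
      = Submodule.Quotient.mk x := by
    rw [LinearEquiv.symm_apply_eq]
    rfl
  simp [this]

/-! ### Coordinates on graded bimodules of the type of `A^0` and `D` -/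

/-- The grading of `A^0` in coordinates. -/
def coordGrA (k : Type u) [Field k] : ℕ → Submodule k (k × (Fin 2 → k))
  | 0 => Submodule.prod ⊤ ⊥
  | 1 => Submodule.prod ⊥ ⊤
  | _ + 2 => ⊥

/-- The grading of `D` in coordinates. -/
def coordGrM (k : Type u) [Field k] : ℕ → Submodule k ((Fin 2 → k) × k)
  | 0 => Submodule.prod ⊤ ⊥
  | 1 => Submodule.prod ⊥ ⊤
  | _ + 2 => ⊥

/-- A coordinate description of a graded algebra and a graded bimodule over it, which says that
the pair is isomorphic to `A^0` and the twist of `D` by the inverse of `diag (lam 0, lam 1)`. -/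
structure Coord {k : Type u} [Field k] (lam : Fin 2 → kˣ) {A : Type u} [Ring A] [Algebra k A]
    {M : Type u} [AddCommGroup M] [Module k M] (grA : ℕ → Submodule k A)
    (grM : ℕ → Submodule k M) (B : Bimod k A M) where
  pA : (k × (Fin 2 → k)) ≃ₗ[k] A
  pM : ((Fin 2 → k) × k) ≃ₗ[k] M
  one : pA (1, 0) = 1
  mul : ∀ u v, pA u * pA v = pA (u.1 * v.1, u.1 • v.2 + v.1 • u.2)
  left : ∀ u m, B.left (pA u) (pM m) =
    pM (u.1 • m.1, u.1 * m.2 + ∑ i, ((lam i)⁻¹ : kˣ) * u.2 i * m.1 i)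
  right : ∀ m u, B.right (pM m) (pA u) = pM (u.1 • m.1, u.1 * m.2 + ∑ i, u.2 i * m.1 i)
  map_grA : ∀ n, (coordGrA k n).map pA.toLinearMap = grA n
  map_grM : ∀ n, (coordGrM k n).map pM.toLinearMap = grM n

/-- The algebra isomorphism given by two coordinate descriptions. -/
def Coord.algEquiv {k : Type u} [Field k] {lam : Fin 2 → kˣ} {A : Type u} [Ring A] [Algebra k A]
    {M : Type u} [AddCommGroup M] [Module k M] {grA : ℕ → Submodule k A}
    {grM : ℕ → Submodule k M} {B : Bimod k A M} {A' : Type u} [Ring A'] [Algebra k A']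
    {M' : Type u} [AddCommGroup M'] [Module k M'] {grA' : ℕ → Submodule k A'}
    {grM' : ℕ → Submodule k M'} {B' : Bimod k A' M'}
    (C : Coord lam grA grM B) (C' : Coord lam grA' grM' B') : A ≃ₐ[k] A' :=
  AlgEquiv.ofLinearEquiv (C.pA.symm ≪≫ₗ C'.pA)
    (by simp [← C.one, C'.one])
    (fun a b => by
      obtain ⟨u, rfl⟩ := C.pA.surjective a
      obtain ⟨v, rfl⟩ := C.pA.surjective b
      simp [C.mul, C'.mul])

theorem Coord.algEquiv_pA {k : Type u} [Field k] {lam : Fin 2 → kˣ} {A : Type u} [Ring A]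
    [Algebra k A]
    {M : Type u} [AddCommGroup M] [Module k M] {grA : ℕ → Submodule k A}
    {grM : ℕ → Submodule k M} {B : Bimod k A M} {A' : Type u} [Ring A'] [Algebra k A']
    {M' : Type u} [AddCommGroup M'] [Module k M'] {grA' : ℕ → Submodule k A'}
    {grM' : ℕ → Submodule k M'} {B' : Bimod k A' M'}
    (C : Coord lam grA grM B) (C' : Coord lam grA' grM' B') (u : k × (Fin 2 → k)) :
    C.algEquiv C' (C.pA u) = C'.pA u := by
  simp [Coord.algEquiv]

/-- Transport of the multilinear map of a triple along isomorphisms. -/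
theorem IsTripleMap.transport {k : Type u} [Field k] {s : ℕ} {A : Type u} [Ring A] [Algebra k A]
    {M : Type u} [AddCommGroup M] [Module k M] {grA : ℕ → Submodule k A}
    {grM : ℕ → Submodule k M} {B : Bimod k A M} {φ : MultilinearMap k (fun _ : Fin s => M) A}
    (hφ : IsTripleMap grA grM B φ) {A' : Type u} [Ring A'] [Algebra k A']
    {M' : Type u} [AddCommGroup M'] [Module k M'] {grA' : ℕ → Submodule k A'}
    {grM' : ℕ → Submodule k M'} {B' : Bimod k A' M'} (f : A ≃ₐ[k] A') (g : M ≃ₗ[k] M')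
    (hl : ∀ a x, g (B.left a x) = B'.left (f a) (g x))
    (hr : ∀ x a, g (B.right x a) = B'.right (g x) (f a))
    (hA : ∀ n, (grA n).map f.toLinearMap = grA' n)
    (hM : ∀ n, (grM n).map g.toLinearMap = grM' n) :
    IsTripleMap grA' grM' B'
      (f.toLinearMap.compMultilinearMap (φ.compLinearMap fun _ => g.symm.toLinearMap)) := by
  have hl' : ∀ a x, g.symm (B'.left a x) = B.left (f.symm a) (g.symm x) := fun a x => by
    rw [LinearEquiv.symm_apply_eq, hl, AlgEquiv.apply_symm_apply, LinearEquiv.apply_symm_apply]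
  have hr' : ∀ x a, g.symm (B'.right x a) = B.right (g.symm x) (f.symm a) := fun x a => by
    rw [LinearEquiv.symm_apply_eq, hr, AlgEquiv.apply_symm_apply, LinearEquiv.apply_symm_apply]
  have hupd : ∀ (x : Fin s → M') (i : Fin s) (d : M'),
      (fun j => g.symm (Function.update x i d j)) =
        Function.update (fun j => g.symm (x j)) i (g.symm d) := by
    intro x i d
    funext j
    by_cases h : j = i
    · subst h; simp
    · simp [Function.update_of_ne h]
  have happ : ∀ x : Fin s → M', (f.toLinearMap.compMultilinearMap
      (φ.compLinearMap fun _ => g.symm.toLinearMap)) x = f (φ fun i => g.symm (x i)) :=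
    fun _ => rfl
  refine ⟨fun x a i j hij => ?_, fun x a i hi => ?_, fun x a i hi => ?_, fun x d hd => ?_⟩
  · rw [happ, happ, hupd, hupd, hl', hr',
      hφ.balanced (fun j => g.symm (x j)) (f.symm a) i j hij]
  · rw [happ, happ, hupd, hl', hφ.map_left (fun j => g.symm (x j)) (f.symm a) i hi, map_mul,
      AlgEquiv.apply_symm_apply]
  · rw [happ, happ, hupd, hr', hφ.map_right (fun j => g.symm (x j)) (f.symm a) i hi, map_mul,
      AlgEquiv.apply_symm_apply]
  · rw [happ, ← hA]
    refine Submodule.mem_map_of_mem (f := f.toLinearMap) (hφ.map_degree _ d fun i => ?_)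
    have := hd i
    rw [← hM] at this
    obtain ⟨y, hy, hy'⟩ := this
    rw [← hy']
    simpa using hy

/-- Two triples with coordinates differ only in the multilinear map, which can be transported. -/
theorem exists_iso_of_coord {k : Type u} [Field k] {s : ℕ} {lam : Fin 2 → kˣ} (T : Triple k s)
    (C : Coord lam T.grA T.grM T.bimod) (ν : A0 k ≃ₐ[k] A0 k)
    (C' : Coord lam (gr (idealA0 k)) (grD k) ((bimodD k).twist ν.symm)) :
    ∃ (φ : MultilinearMap k (fun _ : Fin s => D k) (A0 k))
      (hφ : IsTripleMap (gr (idealA0 k)) (grD k) ((bimodD k).twist ν.symm) φ),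
      Nonempty (T.Iso (tripleD ν φ hφ)) := by
  set f := C.algEquiv C' with hf
  set g : T.M ≃ₗ[k] D k := C.pM.symm ≪≫ₗ C'.pM with hg
  have hgp : ∀ m, g (C.pM m) = C'.pM m := by simp [hg]
  have hl : ∀ a x, g (T.bimod.left a x) = ((bimodD k).twist ν.symm).left (f a) (g x) := by
    intro a x
    obtain ⟨u, rfl⟩ := C.pA.surjective a
    obtain ⟨v, rfl⟩ := C.pM.surjective x
    rw [C.left, hgp, hgp, hf, Coord.algEquiv_pA, C'.left]
  have hr : ∀ x a, g (T.bimod.right x a) = ((bimodD k).twist ν.symm).right (g x) (f a) := by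
    intro x a
    obtain ⟨u, rfl⟩ := C.pA.surjective a
    obtain ⟨v, rfl⟩ := C.pM.surjective x
    rw [C.right, hgp, hgp, hf, Coord.algEquiv_pA, C'.right]
  have hA : ∀ n, (T.grA n).map f.toLinearMap = gr (idealA0 k) n := by
    intro n
    rw [← C.map_grA, ← C'.map_grA, ← Submodule.map_comp]
    congr 1
    exact LinearMap.ext fun u => Coord.algEquiv_pA C C' u
  have hM : ∀ n, (T.grM n).map g.toLinearMap = grD k n := by
    intro n
    rw [← C.map_grM, ← C'.map_grM, ← Submodule.map_comp]
    congr 1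
    exact LinearMap.ext fun u => hgp u
  refine ⟨f.toLinearMap.compMultilinearMap (T.φ.compLinearMap fun _ => g.symm.toLinearMap),
    T.isTripleMap.transport f g hl hr hA hM, ⟨⟨f, g, hA, hM, hl, hr, fun x => ?_⟩⟩⟩
  change f (T.φ x) = f (T.φ fun i => g.symm (g (x i)))
  congr 2
  funext i
  exact (g.symm_apply_apply _).symm

/-- Coordinates can be transported along an isomorphism of triples. -/
def Triple.Iso.coord {k : Type u} [Field k] {s : ℕ} {lam : Fin 2 → kˣ} {T T' : Triple k s}
    (e : T.Iso T') (C : Coord lam T'.grA T'.grM T'.bimod) :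
    Coord lam T.grA T.grM T.bimod where
  pA := C.pA ≪≫ₗ e.f.symm.toLinearEquiv
  pM := C.pM ≪≫ₗ e.g.symm
  one := by simp [C.one]
  mul u v := by simp [← map_mul, C.mul]
  left u m := by
    apply e.g.injective
    rw [e.map_left]
    simp [C.left]
  right m u := by
    apply e.g.injective
    rw [e.map_right]
    simp [C.right]
  map_grA n := by
    rw [← Submodule.map_injective_of_injective (f := e.f.toLinearMap) e.f.injective |>.eq_iff,
      e.map_grA, ← C.map_grA, ← Submodule.map_comp]
    congr 1
    exact LinearMap.ext fun u => by simp
  map_grM n := by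
    rw [← Submodule.map_injective_of_injective (f := e.g.toLinearMap) e.g.injective |>.eq_iff,
      e.map_grM, ← C.map_grM, ← Submodule.map_comp]
    congr 1
    exact LinearMap.ext fun u => by simp

/-! ### Coordinates on `A^0` -/

/-- The generators `x`, `y` of `A^0`. -/
def A0.gen (k : Type u) [Field k] (i : Fin 2) : A0 k := proj (idealA0 k) (FreeAlgebra.ι k i)

theorem A0.gr_two (k : Type u) [Field k] : gr (idealA0 k) 2 = ⊥ := by
  rw [eq_bot_iff]
  rintro _ ⟨p, hp, rfl⟩
  exact (proj_eq_zero_iff _ _).2 (TwoSidedIdeal.subset_span hp)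

theorem A0.gr_one (k : Type u) [Field k] :
    gr (idealA0 k) 1 = Submodule.span k (Set.range (A0.gen k)) :=
  HomTriples.gr_one _

theorem A0.gen_mul_gen (k : Type u) [Field k] (i j : Fin 2) : A0.gen k i * A0.gen k j = 0 := by
  rw [← Submodule.mem_bot k, ← A0.gr_two, ← gr_mul (idealA0 k) 1 1, A0.gr_one]
  exact Submodule.mul_mem_mul (Submodule.subset_span ⟨i, rfl⟩) (Submodule.subset_span ⟨j, rfl⟩)

/-- The linear map `(a, v) ↦ a + v 0 x + v 1 y`. -/
def A0.param (k : Type u) [Field k] : (k × (Fin 2 → k)) →ₗ[k] A0 k :=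
  LinearMap.coprod (LinearMap.toSpanSingleton k (A0 k) 1) (Fintype.linearCombination k (A0.gen k))

theorem A0.param_apply (k : Type u) [Field k] (u : k × (Fin 2 → k)) :
    A0.param k u = u.1 • 1 + (u.2 0 • A0.gen k 0 + u.2 1 • A0.gen k 1) := by
  simp [A0.param, Fintype.linearCombination_apply]

theorem A0.param_mul (k : Type u) [Field k] (u v : k × (Fin 2 → k)) :
    A0.param k u * A0.param k v = A0.param k (u.1 * v.1, u.1 • v.2 + v.1 • u.2) := by
  simp only [A0.param_apply, add_mul, mul_add, smul_mul_assoc, mul_smul_comm, A0.gen_mul_gen,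
    one_mul, mul_one, smul_zero, Pi.add_apply, Pi.smul_apply, smul_eq_mul]
  module

/-- The trivial square-zero extension of `k` by `k²` is a model of A^0 in which 1, x, y are visibly
independent. Products of two generators vanish there, so the map from the free algebra kills
`idealA0`. -/
theorem A0.param_injective (k : Type u) [Field k] : Function.Injective (A0.param k) := by
  rw [injective_iff_map_eq_zero]
  intro u hu
  let Ψ : Free k 2 →ₐ[k] TrivSqZeroExt k (Fin 2 → k) :=
    FreeAlgebra.lift k fun i => TrivSqZeroExt.inr (Pi.single i 1)
  have h1 : ∀ i j, Ψ (FreeAlgebra.ι k i) * Ψ (FreeAlgebra.ι k j) = 0 := by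
    intro i j
    simp [Ψ]
  have h2 : idealA0 k ≤ TwoSidedIdeal.ker Ψ := by
    rw [idealA0, TwoSidedIdeal.span_le]
    intro p hp
    rw [SetLike.mem_coe, TwoSidedIdeal.mem_ker]
    refine eq_of_mem_deg (f := Ψ.toLinearMap) (g := 0) ?_ hp
    intro l hl
    obtain ⟨i, j, rfl⟩ := List.length_eq_two.1 hl
    simpa [mono] using h1 i j
  have h3 : A0.param k u = proj (idealA0 k) (algebraMap k _ u.1 +
      (u.2 0 • FreeAlgebra.ι k 0 + u.2 1 • FreeAlgebra.ι k 1)) := by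
    rw [A0.param_apply, map_add, map_add, map_smul, map_smul, AlgHom.commutes,
      Algebra.algebraMap_eq_smul_one]
    rfl
  rw [h3, proj_eq_zero_iff] at hu
  have h4 := (TwoSidedIdeal.mem_ker _).1 (h2 hu)
  have h5 : Ψ (algebraMap k _ u.1 +
      (u.2 0 • FreeAlgebra.ι k 0 + u.2 1 • FreeAlgebra.ι k 1)) =
      TrivSqZeroExt.inl u.1 + TrivSqZeroExt.inr u.2 := by
    simp only [map_add, map_smul, AlgHom.commutes, Ψ, FreeAlgebra.lift_ι_apply]
    ext i
    · simp [TrivSqZeroExt.algebraMap_eq_inl]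
    · fin_cases i <;> simp [TrivSqZeroExt.algebraMap_eq_inl]
  rw [h5] at h4
  refine Prod.ext ?_ ?_
  · simpa using congrArg TrivSqZeroExt.fst h4
  · simpa using congrArg TrivSqZeroExt.snd h4

theorem A0.param_one (k : Type u) [Field k] : A0.param k (1, 0) = 1 := by
  simp [A0.param_apply]

theorem A0.param_single (k : Type u) [Field k] (i : Fin 2) :
    A0.param k (0, Pi.single i 1) = A0.gen k i := by
  fin_cases i <;> simp [A0.param_apply]

theorem A0.param_surjective (k : Type u) [Field k] : Function.Surjective (A0.param k) := by
  intro a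
  obtain ⟨p, rfl⟩ := proj_surjective _ a
  refine FreeAlgebra.induction k (Fin 2)
    (motive := fun p => ∃ u, A0.param k u = proj (idealA0 k) p) ?_ ?_ ?_ ?_ p
  · intro r
    refine ⟨(r, 0), ?_⟩
    simp [A0.param_apply, Algebra.algebraMap_eq_smul_one]
  · intro i
    exact ⟨_, A0.param_single k i⟩
  · rintro a b ⟨u, hu⟩ ⟨v, hv⟩
    rw [map_mul, ← hu, ← hv, A0.param_mul]
    exact ⟨_, rfl⟩
  · rintro a b ⟨u, hu⟩ ⟨v, hv⟩
    rw [map_add, ← hu, ← hv, ← map_add]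
    exact ⟨_, rfl⟩

theorem A0.map_param (k : Type u) [Field k] (n : ℕ) :
    (coordGrA k n).map (A0.param k) = gr (idealA0 k) n := by
  match n with
  | 0 =>
    rw [gr_zero]
    apply le_antisymm
    · rintro _ ⟨u, ⟨-, hu⟩, rfl⟩
      have hu : u.2 = 0 := hu
      rw [A0.param_apply, hu]
      simpa using Submodule.smul_mem _ u.1 (Submodule.mem_span_singleton_self (1 : A0 k))
    · rw [Submodule.span_singleton_le_iff_mem]
      exact ⟨(1, 0), ⟨trivial, rfl⟩, A0.param_one k⟩
  | 1 =>
    rw [A0.gr_one]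
    apply le_antisymm
    · rintro _ ⟨u, ⟨hu, -⟩, rfl⟩
      have hu : u.1 = 0 := hu
      rw [A0.param_apply, hu, zero_smul, zero_add]
      exact add_mem (Submodule.smul_mem _ _ (Submodule.subset_span ⟨0, rfl⟩))
        (Submodule.smul_mem _ _ (Submodule.subset_span ⟨1, rfl⟩))
    · rw [Submodule.span_le]
      rintro _ ⟨i, rfl⟩
      exact ⟨(0, Pi.single i 1), ⟨rfl, trivial⟩, A0.param_single k i⟩
  | n + 2 =>
    rw [gr_eq_bot_of_le (A0.gr_two k) (by omega)]
    exact Submodule.map_bot _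

/-- Coordinates on `A^0`. -/
def A0.paramEquiv (k : Type u) [Field k] : (k × (Fin 2 → k)) ≃ₗ[k] A0 k :=
  LinearEquiv.ofBijective (A0.param k) ⟨A0.param_injective k, A0.param_surjective k⟩

/-! ### Coordinates on `D` -/

/-- The generators `f_1`, `f_2` of `D`. -/
def D.gen (k : Type u) [Field k] (i : Fin 2) : D k := (relD k).mkQ (Pi.single i 1)

/-- The element `f_1 x = x f_1 = f_2 y = y f_2` of `D`. -/
def D.top (k : Type u) [Field k] : D k := (relD k).mkQ (rightGen 0 (A0.x k))

theorem bimodD_left_mkQ (k : Type u) [Field k] (a : A0 k) (F : Fin 2 → EnvA0 k) :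
    (bimodD k).left a ((relD k).mkQ F) =
      (relD k).mkQ ((a ⊗ₜ[k] (1 : (A0 k)ᵐᵒᵖ) : EnvA0 k) • F) :=
  ((relD k).mkQ.map_smul _ F).symm

theorem bimodD_right_mkQ (k : Type u) [Field k] (a : A0 k) (F : Fin 2 → EnvA0 k) :
    (bimodD k).right ((relD k).mkQ F) a =
      (relD k).mkQ (((1 : A0 k) ⊗ₜ[k] MulOpposite.op a : EnvA0 k) • F) :=
  ((relD k).mkQ.map_smul _ F).symm

theorem smul_single_one {R : Type*} [Ring R] (c : R) (i : Fin 2) :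
    c • (Pi.single i 1 : Fin 2 → R) = Pi.single i c := by
  rw [← Pi.single_smul, smul_eq_mul, mul_one]

theorem bimodD_left_gen (k : Type u) [Field k] (a : A0 k) (i : Fin 2) :
    (bimodD k).left a (D.gen k i) = (relD k).mkQ (leftGen a i) := by
  rw [D.gen, bimodD_left_mkQ, smul_single_one, leftGen]

theorem bimodD_right_gen (k : Type u) [Field k] (a : A0 k) (i : Fin 2) :
    (bimodD k).right (D.gen k i) a = (relD k).mkQ (rightGen i a) := by
  rw [D.gen, bimodD_right_mkQ, smul_single_one, rightGen]

theorem D.right_gen_gen (k : Type u) [Field k] (i j : Fin 2) :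
    (bimodD k).right (D.gen k i) (A0.gen k j) = if i = j then D.top k else 0 := by
  rw [bimodD_right_gen]
  fin_cases i <;> fin_cases j
  · rfl
  · exact (Submodule.Quotient.mk_eq_zero _).2 (Submodule.subset_span (by simp [A0.gen, A0.y]))
  · exact (Submodule.Quotient.mk_eq_zero _).2 (Submodule.subset_span (by simp [A0.gen, A0.x]))
  · exact ((Submodule.Quotient.eq _).2 (Submodule.subset_span (by simp [A0.gen, A0.y]))).symm

theorem D.left_gen_gen (k : Type u) [Field k] (i j : Fin 2) :
    (bimodD k).left (A0.gen k j) (D.gen k i) = if i = j then D.top k else 0 := by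
  by_cases h : i = j
  · subst h
    have h := D.right_gen_gen k i i
    rw [if_pos rfl] at h ⊢
    rw [← h, bimodD_right_gen, bimodD_left_gen]
    fin_cases i
    · exact ((Submodule.Quotient.eq _).2 (Submodule.subset_span (by simp [A0.gen, A0.x]))).symm
    · exact ((Submodule.Quotient.eq _).2 (Submodule.subset_span (by simp [A0.gen, A0.y]))).symm
  · rw [if_neg h, bimodD_left_gen]
    fin_cases i <;> fin_cases j
    · simp at h
    · exact (Submodule.Quotient.mk_eq_zero _).2 (Submodule.subset_span (by simp [A0.gen, A0.y]))
    · exact (Submodule.Quotient.mk_eq_zero _).2 (Submodule.subset_span (by simp [A0.gen, A0.x]))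
    · simp at h

theorem D.right_top_gen (k : Type u) [Field k] (j : Fin 2) :
    (bimodD k).right (D.top k) (A0.gen k j) = 0 := by
  have h := D.right_gen_gen k 0 0
  rw [if_pos rfl] at h
  rw [← h, ← (bimodD k).right_mul, A0.gen_mul_gen, map_zero]

theorem D.left_gen_top (k : Type u) [Field k] (j : Fin 2) :
    (bimodD k).left (A0.gen k j) (D.top k) = 0 := by
  have h := D.left_gen_gen k 0 0
  rw [if_pos rfl] at h
  rw [← h, ← (bimodD k).mul_left, A0.gen_mul_gen, map_zero, LinearMap.zero_apply]

/-- The linear map `(v, b) ↦ v 0 f_1 + v 1 f_2 + b f_1 x`. -/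
def D.param (k : Type u) [Field k] : ((Fin 2 → k) × k) →ₗ[k] D k :=
  LinearMap.coprod (Fintype.linearCombination k (D.gen k))
    (LinearMap.toSpanSingleton k (D k) (D.top k))

theorem D.param_apply (k : Type u) [Field k] (m : (Fin 2 → k) × k) :
    D.param k m = m.1 0 • D.gen k 0 + m.1 1 • D.gen k 1 + m.2 • D.top k := by
  simp [D.param, Fintype.linearCombination_apply]

theorem D.left_param (k : Type u) [Field k] (u : k × (Fin 2 → k)) (m : (Fin 2 → k) × k) :
    (bimodD k).left (A0.param k u) (D.param k m) =
      D.param k (u.1 • m.1, u.1 * m.2 + ∑ i, u.2 i * m.1 i) := by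
  simp only [A0.param_apply, D.param_apply, map_add, map_smul, LinearMap.add_apply,
    LinearMap.smul_apply, (bimodD k).one_left, D.left_gen_gen, D.left_gen_top, Fin.sum_univ_two,
    Pi.smul_apply, smul_eq_mul]
  simp only [Fin.isValue, ↓reduceIte, zero_ne_one, one_ne_zero, smul_zero]
  module

theorem D.right_param (k : Type u) [Field k] (u : k × (Fin 2 → k)) (m : (Fin 2 → k) × k) :
    (bimodD k).right (D.param k m) (A0.param k u) =
      D.param k (u.1 • m.1, u.1 * m.2 + ∑ i, u.2 i * m.1 i) := by
  simp only [A0.param_apply, D.param_apply, map_add, map_smul, LinearMap.add_apply,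
    LinearMap.smul_apply, (bimodD k).right_one, D.right_gen_gen, D.right_top_gen,
    Fin.sum_univ_two, Pi.smul_apply, smul_eq_mul]
  simp only [Fin.isValue, ↓reduceIte, zero_ne_one, one_ne_zero, smul_zero]
  module

theorem D.param_single (k : Type u) [Field k] (i : Fin 2) :
    D.param k (Pi.single i 1, 0) = D.gen k i := by
  fin_cases i <;> simp [D.param_apply]

theorem mkQ_single_tmul (k : Type u) [Field k] (i : Fin 2) (a b : A0 k) :
    (relD k).mkQ (Pi.single i (a ⊗ₜ[k] MulOpposite.op b)) =
      (bimodD k).left a ((bimodD k).right (D.gen k i) b) := by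
  rw [bimodD_right_gen, bimodD_left_mkQ, rightGen]
  congr 1
  funext j
  change _ = (a ⊗ₜ[k] (1 : (A0 k)ᵐᵒᵖ)) *
    (Pi.single i ((1 : A0 k) ⊗ₜ[k] MulOpposite.op b) : Fin 2 → EnvA0 k) j
  by_cases h : j = i
  · subst h
    rw [Pi.single_eq_same, Pi.single_eq_same, Algebra.TensorProduct.tmul_mul_tmul, mul_one,
      one_mul]
  · rw [Pi.single_eq_of_ne h, Pi.single_eq_of_ne h, mul_zero]

theorem D.param_surjective (k : Type u) [Field k] : Function.Surjective (D.param k) := by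
  rw [← LinearMap.range_eq_top, eq_top_iff]
  have hsingle : ∀ (i : Fin 2) (c : EnvA0 k),
      (relD k).mkQ (Pi.single i c) ∈ LinearMap.range (D.param k) := by
    intro i c
    induction c using TensorProduct.induction_on with
    | zero => rw [Pi.single_zero, map_zero]; exact zero_mem _
    | tmul a b =>
      obtain ⟨u, rfl⟩ := A0.param_surjective k a
      obtain ⟨v, hv⟩ := A0.param_surjective k b.unop
      have : b = MulOpposite.op (A0.param k v) := by rw [hv, MulOpposite.op_unop]
      rw [this, mkQ_single_tmul, ← D.param_single, D.right_param, D.left_param]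
      exact ⟨_, rfl⟩
    | add c d hc hd => rw [Pi.single_add, map_add]; exact add_mem hc hd
  rintro x -
  obtain ⟨F, rfl⟩ := (relD k).mkQ_surjective x
  have : F = Pi.single 0 (F 0) + Pi.single 1 (F 1) := by
    funext i; fin_cases i <;> simp
  rw [this, map_add]
  exact add_mem (hsingle _ _) (hsingle _ _)

/-- The coordinate functional `a ↦ a_0` on `A^0`. -/
def A0.counit (k : Type u) [Field k] : A0 k →ₗ[k] k :=
  LinearMap.fst k k (Fin 2 → k) ∘ₗ (A0.paramEquiv k).symm.toLinearMap

/-- The coordinate functionals on `A^0` of degree one. -/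
def A0.dual (k : Type u) [Field k] (i : Fin 2) : A0 k →ₗ[k] k :=
  LinearMap.proj i ∘ₗ LinearMap.snd k k (Fin 2 → k) ∘ₗ (A0.paramEquiv k).symm.toLinearMap

theorem A0.counit_param (k : Type u) [Field k] (u : k × (Fin 2 → k)) :
    A0.counit k (A0.param k u) = u.1 := by
  have : (A0.paramEquiv k).symm (A0.param k u) = u := (A0.paramEquiv k).symm_apply_apply u
  simp [A0.counit, this]

theorem A0.dual_param (k : Type u) [Field k] (i : Fin 2) (u : k × (Fin 2 → k)) :
    A0.dual k i (A0.param k u) = u.2 i := by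
  have : (A0.paramEquiv k).symm (A0.param k u) = u := (A0.paramEquiv k).symm_apply_apply u
  simp [A0.dual, this]

theorem A0.counit_mul (k : Type u) [Field k] (a b : A0 k) :
    A0.counit k (a * b) = A0.counit k a * A0.counit k b := by
  obtain ⟨u, rfl⟩ := A0.param_surjective k a
  obtain ⟨v, rfl⟩ := A0.param_surjective k b
  simp only [A0.param_mul, A0.counit_param]

theorem A0.dual_mul (k : Type u) [Field k] (i : Fin 2) (a b : A0 k) :
    A0.dual k i (a * b) =
      A0.counit k a * A0.dual k i b + A0.counit k b * A0.dual k i a := by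
  obtain ⟨u, rfl⟩ := A0.param_surjective k a
  obtain ⟨v, rfl⟩ := A0.param_surjective k b
  simp only [A0.param_mul, A0.counit_param, A0.dual_param, Pi.add_apply, Pi.smul_apply,
    smul_eq_mul]

theorem A0.counit_gen (k : Type u) [Field k] (i : Fin 2) : A0.counit k (A0.gen k i) = 0 := by
  rw [← A0.param_single, A0.counit_param]

theorem A0.dual_gen (k : Type u) [Field k] (i j : Fin 2) :
    A0.dual k i (A0.gen k j) = if i = j then 1 else 0 := by
  rw [← A0.param_single, A0.dual_param]
  exact Pi.single_apply j 1 i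

theorem A0.counit_one (k : Type u) [Field k] : A0.counit k 1 = 1 := by
  rw [← A0.param_one, A0.counit_param]

theorem A0.dual_one (k : Type u) [Field k] (i : Fin 2) : A0.dual k i 1 = 0 := by
  rw [← A0.param_one, A0.dual_param]; rfl

/-- The functional `a ⊗ b ↦ f(a) g(b)` on the enveloping algebra. -/
def envFunctional {k : Type u} [Field k] (f g : A0 k →ₗ[k] k) : EnvA0 k →ₗ[k] k :=
  LinearMap.mul' k k ∘ₗ TensorProduct.map f (g ∘ₗ (MulOpposite.opLinearEquiv k).symm.toLinearMap)

theorem envFunctional_tmul {k : Type u} [Field k] (f g : A0 k →ₗ[k] k) (a : A0 k)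
    (b : (A0 k)ᵐᵒᵖ) : envFunctional f g (a ⊗ₜ[k] b) = f a * g b.unop := by
  simp [envFunctional]

/-- The coefficient of `f_i` of an element of the free bimodule. -/
def genFunctional (k : Type u) [Field k] (i : Fin 2) : (Fin 2 → EnvA0 k) →ₗ[k] k :=
  envFunctional (A0.counit k) (A0.counit k) ∘ₗ LinearMap.proj i

/-- The functional on the free bimodule that induces the coordinate of degree one on `D`. -/
def topFunctional (k : Type u) [Field k] : (Fin 2 → EnvA0 k) →ₗ[k] k :=
  ∑ i, (envFunctional (A0.counit k) (A0.dual k i) + envFunctional (A0.dual k i) (A0.counit k)) ∘ₗ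
    LinearMap.proj i

theorem genFunctional_apply {k : Type u} [Field k] (i : Fin 2) (F : Fin 2 → EnvA0 k) :
    genFunctional k i F = envFunctional (A0.counit k) (A0.counit k) (F i) := rfl

theorem topFunctional_apply {k : Type u} [Field k] (F : Fin 2 → EnvA0 k) :
    topFunctional k F =
      envFunctional (A0.counit k) (A0.dual k 0) (F 0) +
        envFunctional (A0.dual k 0) (A0.counit k) (F 0) +
      (envFunctional (A0.counit k) (A0.dual k 1) (F 1) +
        envFunctional (A0.dual k 1) (A0.counit k) (F 1)) := by
  rw [topFunctional, Fin.sum_univ_two]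
  rfl

/-- The functionals are only `k`-linear, while `relD` is a span over the enveloping algebra. The
induction therefore runs over the stronger claim that they vanish on every multiple `c * F`; for the
seven generators and a pure tensor `c` this is a direct computation. -/
theorem functionals_of_mem_relD (k : Type u) [Field k] {F : Fin 2 → EnvA0 k} (hF : F ∈ relD k) :
    (∀ i, genFunctional k i F = 0) ∧ topFunctional k F = 0 := by
  have key : ∀ c : EnvA0 k, (∀ i, genFunctional k i (fun j => c * F j) = 0) ∧
      topFunctional k (fun j => c * F j) = 0 := by
    refine Submodule.span_induction (p := fun F _ => ∀ c : EnvA0 k,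
      (∀ i, genFunctional k i (fun j => c * F j) = 0) ∧
        topFunctional k (fun j => c * F j) = 0) ?_ ?_ ?_ ?_ hF
    · intro ρ hρ c
      simp only [genFunctional_apply, topFunctional_apply]
      induction c using TensorProduct.induction_on with
      | zero => simp only [zero_mul, map_zero, implies_true, add_zero, and_self]
      | add c d hc hd =>
        refine ⟨fun i => ?_, ?_⟩
        · rw [add_mul, map_add, hc.1, hd.1, add_zero]
        · simp only [add_mul, map_add]
          linear_combination hc.2 + hd.2
      | tmul a b =>
        have hx : A0.x k = A0.gen k 0 := rfl
        have hy : A0.y k = A0.gen k 1 := rfl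
        simp only [Set.mem_insert_iff, Set.mem_singleton_iff, hx, hy] at hρ
        have h01 : (0 : Fin 2) ≠ 1 := by decide
        rcases hρ with rfl | rfl | rfl | rfl | rfl | rfl | rfl <;>
        refine ⟨Fin.forall_fin_two.2 ⟨?_, ?_⟩, ?_⟩ <;>
        simp only [leftGen, rightGen, Pi.sub_apply, Pi.single_eq_same, Pi.single_eq_of_ne h01,
          Pi.single_eq_of_ne h01.symm, mul_sub, mul_zero, map_sub, map_zero,
          Algebra.TensorProduct.tmul_mul_tmul, envFunctional_tmul, mul_one, MulOpposite.unop_mul,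
          MulOpposite.unop_op, A0.counit_mul, A0.dual_mul, A0.counit_gen, A0.dual_gen, h01,
          h01.symm, if_true, if_false] <;>
        ring
    · intro c
      simp only [genFunctional_apply, topFunctional_apply, Pi.zero_apply, mul_zero, map_zero,
        implies_true, add_zero, and_self]
    · intro F G _ _ hF hG c
      have : (fun j => c * (F + G) j) = (fun j => c * F j) + fun j => c * G j :=
        funext fun j => mul_add _ _ _
      simp only [this, map_add, (hF c).1, (hG c).1, (hF c).2, (hG c).2, add_zero,
        implies_true, and_self]
    · intro d F _ hF c
      have : (fun j => c * (d • F) j) = fun j => c * d * F j :=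
        funext fun j => (mul_assoc _ _ _).symm
      rw [this]
      exact hF (c * d)
  have := key 1
  simp only [one_mul] at this
  exact this

/-- The three functionals that vanish on the relations return exactly the three parameters. -/
theorem D.param_injective (k : Type u) [Field k] : Function.Injective (D.param k) := by
  rw [injective_iff_map_eq_zero]
  intro m hm
  have h01 : (0 : Fin 2) ≠ 1 := by decide
  let F : Fin 2 → EnvA0 k :=
    m.1 0 • (Pi.single 0 1 : Fin 2 → EnvA0 k) + m.1 1 • (Pi.single 1 1 : Fin 2 → EnvA0 k) +
      m.2 • rightGen 0 (A0.gen k 0)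
  have hF : D.param k m = Submodule.Quotient.mk F := by
    rw [D.param_apply]; rfl
  rw [hF, Submodule.Quotient.mk_eq_zero] at hm
  obtain ⟨h1, h2⟩ := functionals_of_mem_relD k hm
  have h10 := h1 0
  have h11 := h1 1
  simp only [F, map_add, map_smul, genFunctional_apply, topFunctional_apply, rightGen,
    Pi.single_eq_same, Pi.single_eq_of_ne h01, Pi.single_eq_of_ne h01.symm, map_zero,
    Algebra.TensorProduct.one_def, envFunctional_tmul, MulOpposite.unop_op, MulOpposite.unop_one,
    A0.counit_gen, A0.counit_one, A0.dual_one, A0.dual_gen, if_true, mul_one, mul_zero,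
    smul_eq_mul, add_zero, zero_add] at h10 h11 h2
  refine Prod.ext (funext fun i => ?_) h2
  fin_cases i
  · exact h10
  · exact h11

/-- Coordinates on `D`. -/
def D.paramEquiv (k : Type u) [Field k] : ((Fin 2 → k) × k) ≃ₗ[k] D k :=
  LinearEquiv.ofBijective (D.param k) ⟨D.param_injective k, D.param_surjective k⟩

theorem D.map_param (k : Type u) [Field k] (n : ℕ) :
    (coordGrM k n).map (D.param k) = grD k n := by
  apply le_antisymm
  · have hone : (1 : A0 k) ∈ gr (idealA0 k) 0 := one_mem_gr _
    have hgen : ∀ i, D.gen k i ∈ grD k 0 := fun i => Submodule.subset_span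
      ⟨0, 0, 1, 1, i, rfl, hone, hone, rfl⟩
    have htop : D.top k ∈ grD k 1 := Submodule.subset_span
      ⟨0, 1, 1, A0.gen k 0, 0, rfl, hone, by
        rw [A0.gr_one]; exact Submodule.subset_span ⟨0, rfl⟩, rfl⟩
    rintro _ ⟨m, hm, rfl⟩
    rw [D.param_apply]
    match n with
    | 0 =>
      have hm : m.2 = 0 := hm.2
      rw [hm, zero_smul, add_zero]
      exact add_mem (Submodule.smul_mem _ _ (hgen 0)) (Submodule.smul_mem _ _ (hgen 1))
    | 1 =>
      have hm : m.1 = 0 := hm.1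
      rw [hm, Pi.zero_apply, Pi.zero_apply, zero_smul, zero_smul, zero_add, zero_add]
      exact Submodule.smul_mem _ _ htop
    | n + 2 =>
      have hm : m = 0 := hm
      rw [← D.param_apply, hm, map_zero]
      exact zero_mem _
  · rw [grD, Submodule.span_le]
    rintro _ ⟨p, q, a, b, i, rfl, ha, hb, rfl⟩
    rw [← A0.map_param] at ha hb
    obtain ⟨u, hu, rfl⟩ := ha
    obtain ⟨v, hv, rfl⟩ := hb
    rw [mkQ_single_tmul, ← D.param_single, D.right_param, D.left_param]
    have hzero : ∀ {N : Submodule k ((Fin 2 → k) × k)} {z : (Fin 2 → k) × k}, z = 0 → z ∈ N :=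
      fun h => h ▸ zero_mem _
    refine Submodule.mem_map_of_mem ?_
    match p, q with
    | 0, 0 =>
      have hu : u.2 = 0 := hu.2
      have hv : v.2 = 0 := hv.2
      exact ⟨trivial, by simp [hu, hv]⟩
    | 0, 1 =>
      have hv : v.1 = 0 := hv.1
      exact ⟨by simp [hv], trivial⟩
    | 1, 0 =>
      have hu : u.1 = 0 := hu.1
      exact ⟨by simp [hu], trivial⟩
    | 1, 1 =>
      have hu : u.1 = 0 := hu.1
      have hv : v.1 = 0 := hv.1
      exact hzero (by simp [hu, hv])
    | p + 2, q =>
      have hu : u = 0 := hu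
      subst hu
      exact hzero (by simp)
    | p, q + 2 =>
      have hv : v = 0 := hv
      subst hv
      exact hzero (by simp)

/-- Coordinates on `A^0` and the twist of `D` by the inverse of a diagonal automorphism. -/
def coordD {k : Type u} [Field k] (lam : Fin 2 → kˣ) (ν : A0 k ≃ₐ[k] A0 k)
    (hν : ∀ i, ν (A0.gen k i) = (lam i : k) • A0.gen k i) :
    Coord lam (gr (idealA0 k)) (grD k) ((bimodD k).twist ν.symm) where
  pA := A0.paramEquiv k
  pM := D.paramEquiv k
  one := A0.param_one k
  mul := A0.param_mul k
  left u m := by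
    -- The twisted left action passes through ν⁻¹, which divides the degree-one coordinates by `lam
    -- i`. This is the source of the inverses in `Coord` and `Frame`.
    have h : ν.symm (A0.param k u) = A0.param k (u.1, fun i => ((lam i)⁻¹ : kˣ) * u.2 i) := by
      rw [AlgEquiv.symm_apply_eq, A0.param_apply, A0.param_apply]
      simp only [map_add, map_smul, map_one, hν, smul_smul]
      congr 3 <;> field_simp <;> simp
    change (bimodD k).left (ν.symm (A0.param k u)) (D.param k m) = D.param k _
    rw [h, D.left_param]
  right m u := D.right_param k u m
  map_grA := A0.map_param k
  map_grM := D.map_param k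

/-! ### Frames of a quotient of the free algebra -/

/-- Bases of the components of degree `1`, `s` and `s + 1` of `Γ = k⟨x_1, …, x_m⟩ / J` with the
multiplication table that characterizes the algebras with `Γ^{(s)} ≅ A^0` and `Γ^{(s,1)} ≅ D`
up to a twist. -/
structure Frame {k : Type u} [Field k] {m : ℕ} (J : TwoSidedIdeal (Free k m)) (s : ℕ)
    (lam : Fin 2 → kˣ) where
  e : Fin 2 → QuotAlg J
  X : Fin 2 → QuotAlg J
  Z : QuotAlg J
  gr_one : gr J 1 = Submodule.span k (Set.range e)
  gr_mid : gr J s = Submodule.span k (Set.range X)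
  gr_top : gr J (s + 1) = Submodule.span k {Z}
  e_mul_X : ∀ i j, e i * X j = if i = j then Z else 0
  X_mul_e : ∀ i j, X j * e i = if i = j then (((lam i)⁻¹ : kˣ) : k) • Z else 0
  Z_ne : Z ≠ 0

/-! ### Consequences of the multiplication table of a frame -/

namespace Frame

variable {k : Type u} [Field k] {m : ℕ} {J : TwoSidedIdeal (Free k m)} {s : ℕ}
  {lam : Fin 2 → kˣ}

theorem e_mem (F : Frame J s lam)
    (i : Fin 2) : F.e i ∈ gr J 1 := F.gr_one ▸ Submodule.subset_span ⟨i, rfl⟩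

theorem X_mem (F : Frame J s lam)
    (i : Fin 2) : F.X i ∈ gr J s := F.gr_mid ▸ Submodule.subset_span ⟨i, rfl⟩

theorem Z_mem (F : Frame J s lam)
    : F.Z ∈ gr J (s + 1) := F.gr_top ▸ Submodule.mem_span_singleton_self _

/-- For the index j ≠ i, Z is a multiple of X_j e_j, and e_i X_j = 0. Hence nothing survives beyond
degree s + 1. -/
theorem e_mul_Z (F : Frame J s lam) (i : Fin 2) : F.e i * F.Z = 0 := by
  obtain ⟨j, hj⟩ : ∃ j : Fin 2, i ≠ j := ⟨i + 1, by fin_cases i <;> decide⟩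
  have h : F.Z = (lam j : k) • (F.X j * F.e j) := by
    rw [F.X_mul_e, if_pos rfl, smul_smul, Units.mul_inv, one_smul]
  rw [h, mul_smul_comm, ← mul_assoc, F.e_mul_X, if_neg hj, zero_mul, smul_zero]

theorem gr_eq_bot (F : Frame J s lam) {n : ℕ} (hn : s + 2 ≤ n) : gr J n = ⊥ := by
  refine gr_eq_bot_of_le (n := s + 2) ?_ hn
  rw [show s + 2 = 1 + (s + 1) by ring, ← gr_mul, F.gr_one, F.gr_top, Submodule.span_mul_span,
    Submodule.span_eq_bot]
  rintro _ ⟨_, ⟨i, rfl⟩, _, rfl, rfl⟩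
  exact F.e_mul_Z i

theorem mul_eq_zero (F : Frame J s lam)
    {p q : ℕ} (h : s + 2 ≤ p + q) {a b : QuotAlg J} (ha : a ∈ gr J p)
    (hb : b ∈ gr J q) : a * b = 0 := by
  rw [← Submodule.mem_bot k, ← F.gr_eq_bot h, ← gr_mul]
  exact Submodule.mul_mem_mul ha hb

theorem e_mul_sum (F : Frame J s lam)
    (i : Fin 2) (c : Fin 2 → k) : F.e i * ∑ j, c j • F.X j = c i • F.Z := by
  rw [Finset.mul_sum, Finset.sum_eq_single i]
  · rw [mul_smul_comm, F.e_mul_X, if_pos rfl]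
  · intro j _ hj
    rw [mul_smul_comm, F.e_mul_X, if_neg hj.symm, smul_zero]
  · simp

theorem sum_mul_e (F : Frame J s lam) (i : Fin 2) (c : Fin 2 → k) :
    (∑ j, c j • F.X j) * F.e i = (c i * ((lam i)⁻¹ : kˣ)) • F.Z := by
  rw [Finset.sum_mul, Finset.sum_eq_single i]
  · rw [smul_mul_assoc, F.X_mul_e, if_pos rfl, smul_smul]
  · intro j _ hj
    rw [smul_mul_assoc, F.X_mul_e, if_neg hj.symm, smul_zero]
  · simp

theorem sum_mul_X (F : Frame J s lam)
    (j : Fin 2) (c : Fin 2 → k) : (∑ i, c i • F.e i) * F.X j = c j • F.Z := by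
  rw [Finset.sum_mul, Finset.sum_eq_single j]
  · rw [smul_mul_assoc, F.e_mul_X, if_pos rfl]
  · intro i _ hi
    rw [smul_mul_assoc, F.e_mul_X, if_neg hi, smul_zero]
  · simp

theorem sum_X_mem (F : Frame J s lam) (c : Fin 2 → k) : ∑ j, c j • F.X j ∈ gr J s :=
  sum_mem fun j _ => Submodule.smul_mem _ _ (F.X_mem j)

theorem sum_e_mem (F : Frame J s lam) (c : Fin 2 → k) : ∑ j, c j • F.e j ∈ gr J 1 :=
  sum_mem fun j _ => Submodule.smul_mem _ _ (F.e_mem j)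

/-- The map `(a, v) ↦ a + v 0 X_0 + v 1 X_1`. -/
def paramA (F : Frame J s lam) : (k × (Fin 2 → k)) →ₗ[k] QuotAlg J :=
  LinearMap.coprod (LinearMap.toSpanSingleton k (QuotAlg J) 1) (Fintype.linearCombination k F.X)

theorem paramA_apply (F : Frame J s lam)
    (u : k × (Fin 2 → k)) : F.paramA u = u.1 • 1 + ∑ j, u.2 j • F.X j := by
  simp [paramA, Fintype.linearCombination_apply]

/-- The map `(v, b) ↦ v 0 e_0 + v 1 e_1 + b Z`. -/
def paramM (F : Frame J s lam) : ((Fin 2 → k) × k) →ₗ[k] QuotAlg J :=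
  LinearMap.coprod (Fintype.linearCombination k F.e) (LinearMap.toSpanSingleton k (QuotAlg J) F.Z)

theorem paramM_apply (F : Frame J s lam)
    (u : (Fin 2 → k) × k) : F.paramM u = ∑ j, u.1 j • F.e j + u.2 • F.Z := by
  simp [paramM, Fintype.linearCombination_apply]

theorem paramA_mul (F : Frame J s lam) (hs : 2 ≤ s) (u v : k × (Fin 2 → k)) :
    F.paramA u * F.paramA v = F.paramA (u.1 * v.1, u.1 • v.2 + v.1 • u.2) := by
  have h : (∑ j, u.2 j • F.X j) * (∑ j, v.2 j • F.X j) = 0 :=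
    F.mul_eq_zero (by omega) (F.sum_X_mem _) (F.sum_X_mem _)
  rw [paramA_apply, paramA_apply, paramA_apply, add_mul, mul_add, mul_add, h]
  simp only [smul_mul_assoc, mul_smul_comm, one_mul, mul_one, Fin.sum_univ_two, Pi.add_apply,
    Pi.smul_apply, smul_eq_mul]
  module

theorem paramA_mul_paramM (F : Frame J s lam)
    (hs : 2 ≤ s) (u : k × (Fin 2 → k)) (v : (Fin 2 → k) × k) :
    F.paramA u * F.paramM v =
      F.paramM (u.1 • v.1, u.1 * v.2 + ∑ i, ((lam i)⁻¹ : kˣ) * u.2 i * v.1 i) := by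
  have h : (∑ j, u.2 j • F.X j) * F.Z = 0 :=
    F.mul_eq_zero (by omega) (F.sum_X_mem _) F.Z_mem
  rw [paramA_apply, paramM_apply, paramM_apply, add_mul, mul_add, mul_add, mul_smul_comm v.2 _ F.Z,
    mul_smul_comm v.2 _ F.Z, h, Finset.mul_sum Finset.univ _ (∑ j, u.2 j • F.X j)]
  simp only [mul_smul_comm, F.sum_mul_e]
  simp only [smul_mul_assoc, one_mul, Fin.sum_univ_two, Pi.smul_apply,
    smul_eq_mul]
  module

theorem paramM_mul_paramA (F : Frame J s lam)
    (hs : 2 ≤ s) (u : k × (Fin 2 → k)) (v : (Fin 2 → k) × k) :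
    F.paramM v * F.paramA u =
      F.paramM (u.1 • v.1, u.1 * v.2 + ∑ i, u.2 i * v.1 i) := by
  have h : F.Z * (∑ j, u.2 j • F.X j) = 0 :=
    F.mul_eq_zero (by omega) F.Z_mem (F.sum_X_mem _)
  rw [paramA_apply, paramM_apply, paramM_apply, mul_add, add_mul, add_mul, smul_mul_assoc v.2 F.Z,
    smul_mul_assoc v.2 F.Z, h, Finset.sum_mul Finset.univ _ (∑ j, u.2 j • F.X j)]
  simp only [smul_mul_assoc, F.e_mul_sum]
  simp only [mul_smul_comm, mul_one, Fin.sum_univ_two, Pi.smul_apply,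
    smul_eq_mul]
  module

/-- Multiplication by Z isolates the scalar part, since X_j Z = 0 for degree reasons; multiplication
by e_i then isolates the coordinate at X_i. -/
theorem paramA_injective (F : Frame J s lam) (hs : 2 ≤ s) : Function.Injective F.paramA := by
  rw [injective_iff_map_eq_zero]
  intro u hu
  rw [paramA_apply] at hu
  have h1 : u.1 = 0 := by
    have h := congrArg (· * F.Z) hu
    simp only [add_mul, F.mul_eq_zero (by omega : s + 2 ≤ s + (s + 1)) (F.sum_X_mem _) F.Z_mem,
      smul_mul_assoc, one_mul, zero_mul, add_zero] at h
    exact (smul_eq_zero.1 h).resolve_right F.Z_ne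
  rw [h1, zero_smul, zero_add] at hu
  refine Prod.ext h1 (funext fun i => ?_)
  have h := congrArg (F.e i * ·) hu
  simp only [F.e_mul_sum, mul_zero] at h
  exact (smul_eq_zero.1 h).resolve_right F.Z_ne

theorem paramM_injective (F : Frame J s lam) (hs : 2 ≤ s) : Function.Injective F.paramM := by
  rw [injective_iff_map_eq_zero]
  intro u hu
  rw [paramM_apply] at hu
  have h1 : u.1 = 0 := by
    funext i
    have h := congrArg (· * F.X i) hu
    simp only [add_mul, smul_mul_assoc,
      F.mul_eq_zero (by omega : s + 2 ≤ (s + 1) + s) F.Z_mem (F.X_mem i), F.sum_mul_X, zero_mul,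
      smul_zero, add_zero] at h
    exact (smul_eq_zero.1 h).resolve_right F.Z_ne
  refine Prod.ext h1 ?_
  simp only [h1, Pi.zero_apply, zero_smul, Finset.sum_const_zero, zero_add] at hu
  exact (smul_eq_zero.1 hu).resolve_right F.Z_ne

theorem map_paramA (F : Frame J s lam)
    (hs : 2 ≤ s) (n : ℕ) : (coordGrA k n).map F.paramA = gr J (s * n) := by
  match n with
  | 0 =>
    rw [mul_zero, gr_zero]
    apply le_antisymm
    · rintro _ ⟨u, ⟨-, hu⟩, rfl⟩
      have hu : u.2 = 0 := hu
      rw [F.paramA_apply, hu]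
      simpa using Submodule.smul_mem _ u.1 (Submodule.mem_span_singleton_self (1 : QuotAlg J))
    · rw [Submodule.span_singleton_le_iff_mem]
      exact ⟨(1, 0), ⟨trivial, rfl⟩, by simp [F.paramA_apply]⟩
  | 1 =>
    rw [mul_one]
    apply le_antisymm
    · rintro _ ⟨u, ⟨hu, -⟩, rfl⟩
      have hu : u.1 = 0 := hu
      rw [F.paramA_apply, hu, zero_smul, zero_add]
      exact F.sum_X_mem _
    · rw [F.gr_mid, Submodule.span_le]
      rintro _ ⟨i, rfl⟩
      exact ⟨(0, Pi.single i 1), ⟨rfl, trivial⟩, by simp [F.paramA_apply, Pi.single_apply]⟩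
  | n + 2 =>
    rw [F.gr_eq_bot (by nlinarith)]
    exact Submodule.map_bot _

theorem map_paramM (F : Frame J s lam)
    (hs : 2 ≤ s) (n : ℕ) : (coordGrM k n).map F.paramM = gr J (s * n + 1) := by
  match n with
  | 0 =>
    rw [mul_zero, zero_add]
    apply le_antisymm
    · rintro _ ⟨u, ⟨-, hu⟩, rfl⟩
      have hu : u.2 = 0 := hu
      rw [F.paramM_apply, hu, zero_smul, add_zero]
      exact F.sum_e_mem _
    · rw [F.gr_one, Submodule.span_le]
      rintro _ ⟨i, rfl⟩
      exact ⟨(Pi.single i 1, 0), ⟨trivial, rfl⟩, by simp [F.paramM_apply, Pi.single_apply]⟩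
  | 1 =>
    rw [mul_one]
    apply le_antisymm
    · rintro _ ⟨u, ⟨hu, -⟩, rfl⟩
      have hu : u.1 = 0 := hu
      rw [F.paramM_apply, hu]
      simpa using Submodule.smul_mem _ _ F.Z_mem
    · rw [F.gr_top, Submodule.span_singleton_le_iff_mem]
      exact ⟨(0, 1), ⟨rfl, trivial⟩, by simp [F.paramM_apply]⟩
  | n + 2 =>
    rw [F.gr_eq_bot (by nlinarith)]
    exact Submodule.map_bot _

theorem range_paramA (F : Frame J s lam)
    (hs : 2 ≤ s) : LinearMap.range F.paramA = veroneseSpace J s 0 := by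
  apply le_antisymm
  · rintro _ ⟨u, rfl⟩
    rw [F.paramA_apply]
    refine add_mem (gr_le_veroneseSpace J s 0 0 ?_) (gr_le_veroneseSpace J s 0 1 ?_)
    · simpa using Submodule.smul_mem _ u.1 (one_mem_gr J)
    · simpa using F.sum_X_mem u.2
  · refine iSup_le fun n => ?_
    rw [add_zero, ← F.map_paramA hs]
    exact LinearMap.map_le_range

theorem range_paramM (F : Frame J s lam)
    (hs : 2 ≤ s) : LinearMap.range F.paramM = veroneseSpace J s 1 := by
  apply le_antisymm
  · rintro _ ⟨u, rfl⟩
    rw [F.paramM_apply]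
    refine add_mem (gr_le_veroneseSpace J s 1 0 ?_) (gr_le_veroneseSpace J s 1 1 ?_)
    · simpa using F.sum_e_mem u.1
    · simpa using Submodule.smul_mem _ u.2 F.Z_mem
  · refine iSup_le fun n => ?_
    rw [← F.map_paramM hs]
    exact LinearMap.map_le_range

/-- The coordinates of the triple of `Γ` that are given by a frame. -/
def coord (F : Frame J s lam) (hs : 2 ≤ s) :
    Coord lam (tripleOf s J).grA (tripleOf s J).grM (tripleOf s J).bimod where
  pA := LinearEquiv.ofInjective F.paramA (F.paramA_injective hs) ≪≫ₗ
    LinearEquiv.ofEq _ (Subalgebra.toSubmodule (veroneseRing J s)) (F.range_paramA hs)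
  pM := LinearEquiv.ofInjective F.paramM (F.paramM_injective hs) ≪≫ₗ
    LinearEquiv.ofEq _ (veroneseSpace J s 1) (F.range_paramM hs)
  one := Subtype.ext (by
    change F.paramA (1, 0) = 1
    simp [F.paramA_apply])
  mul u v := Subtype.ext (F.paramA_mul hs u v)
  left u v := Subtype.ext (F.paramA_mul_paramM hs u v)
  right v u := Subtype.ext (F.paramM_mul_paramA hs u v)
  map_grA n := by
    apply le_antisymm
    · rintro _ ⟨u, hu, rfl⟩
      change F.paramA u ∈ gr J (s * n)
      rw [← F.map_paramA hs]
      exact Submodule.mem_map_of_mem hu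
    · intro (x : veroneseRing J s) hx
      change (x : QuotAlg J) ∈ gr J (s * n) at hx
      rw [← F.map_paramA hs] at hx
      obtain ⟨u, hu, hux⟩ := hx
      exact ⟨u, hu, Subtype.ext hux⟩
  map_grM n := by
    apply le_antisymm
    · rintro _ ⟨u, hu, rfl⟩
      change F.paramM u ∈ gr J (s * n + 1)
      rw [← F.map_paramM hs]
      exact Submodule.mem_map_of_mem hu
    · intro (x : veroneseSpace J s 1) hx
      change (x : QuotAlg J) ∈ gr J (s * n + 1) at hx
      rw [← F.map_paramM hs] at hx
      obtain ⟨u, hu, hux⟩ := hx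
      exact ⟨u, hu, Subtype.ext hux⟩

end Frame

/-- The frame given by coordinates on the triple of `Γ`. -/
def Coord.frame {k : Type u} [Field k] {m : ℕ} {J : TwoSidedIdeal (Free k m)} {s : ℕ}
    {lam : Fin 2 → kˣ}
    (C : Coord lam (tripleOf s J).grA (tripleOf s J).grM (tripleOf s J).bimod) :
    Frame J s lam := by
  let pA : (k × (Fin 2 → k)) →ₗ[k] QuotAlg J :=
    (veroneseRing J s).val.toLinearMap ∘ₗ C.pA.toLinearMap
  let pM : ((Fin 2 → k) × k) →ₗ[k] QuotAlg J :=
    (veroneseSpace J s 1).subtype ∘ₗ C.pM.toLinearMap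
  have hA : ∀ n, (coordGrA k n).map pA = gr J (s * n) := by
    intro n
    have h := C.map_grA n
    apply le_antisymm
    · rintro _ ⟨u, hu, rfl⟩
      have h1 : C.pA u ∈ (tripleOf s J).grA n := h ▸ Submodule.mem_map_of_mem hu
      exact h1
    · intro x hx
      let y : veroneseRing J s := ⟨x, gr_le_veroneseSpace J s 0 n hx⟩
      have h1 : y ∈ (tripleOf s J).grA n := hx
      rw [← h] at h1
      obtain ⟨u, hu, hux⟩ := h1
      exact ⟨u, hu, congrArg Subtype.val hux⟩
  have hM : ∀ n, (coordGrM k n).map pM = gr J (s * n + 1) := by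
    intro n
    have h := C.map_grM n
    apply le_antisymm
    · rintro _ ⟨u, hu, rfl⟩
      have h1 : C.pM u ∈ (tripleOf s J).grM n := h ▸ Submodule.mem_map_of_mem hu
      exact h1
    · intro x hx
      let y : veroneseSpace J s 1 := ⟨x, gr_le_veroneseSpace J s 1 n hx⟩
      have h1 : y ∈ (tripleOf s J).grM n := hx
      rw [← h] at h1
      obtain ⟨u, hu, hux⟩ := h1
      exact ⟨u, hu, congrArg Subtype.val hux⟩
  have hr : ∀ v u, pM v * pA u = pM (u.1 • v.1, u.1 * v.2 + ∑ i, u.2 i * v.1 i) :=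
    fun v u => congrArg Subtype.val (C.right v u)
  have hl : ∀ u v, pA u * pM v =
      pM (u.1 • v.1, u.1 * v.2 + ∑ i, ((lam i)⁻¹ : kˣ) * u.2 i * v.1 i) :=
    fun u v => congrArg Subtype.val (C.left u v)
  have hsm : ∀ c : k, pM (0, c) = c • pM (0, 1) := by
    intro c
    rw [← map_smul]
    simp
  -- The e_i and Z are the bases of the bimodule in degrees 0 and 1, and the X_j the basis of the
  -- algebra in degree 1. Thus e_i X_j is a value of the right action and X_j e_i one of the left
  -- action.
  refine ⟨fun i => pM (Pi.single i 1, 0), fun i => pA (0, Pi.single i 1), pM (0, 1),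
    ?_, ?_, ?_, ?_, ?_, ?_⟩
  · have h := hM 0
    rw [mul_zero, zero_add] at h
    rw [← h]
    apply le_antisymm
    · rintro _ ⟨v, ⟨-, hv⟩, rfl⟩
      have hv : v.2 = 0 := hv
      have : v = ∑ i, v.1 i • ((Pi.single i 1, 0) : (Fin 2 → k) × k) := by
        refine Prod.ext (funext fun i => ?_) ?_
        · fin_cases i <;> simp
        · simp [hv]
      rw [this, map_sum]
      refine sum_mem fun i _ => ?_
      rw [map_smul]
      exact Submodule.smul_mem _ _ (Submodule.subset_span ⟨i, rfl⟩)
    · rw [Submodule.span_le]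
      rintro _ ⟨i, rfl⟩
      exact ⟨(Pi.single i 1, 0), ⟨trivial, rfl⟩, rfl⟩
  · have h := hA 1
    rw [mul_one] at h
    rw [← h]
    apply le_antisymm
    · rintro _ ⟨v, ⟨hv, -⟩, rfl⟩
      have hv : v.1 = 0 := hv
      have : v = ∑ i, v.2 i • ((0, Pi.single i 1) : k × (Fin 2 → k)) := by
        refine Prod.ext ?_ (funext fun i => ?_)
        · simp [hv]
        · fin_cases i <;> simp
      rw [this, map_sum]
      refine sum_mem fun i _ => ?_
      rw [map_smul]
      exact Submodule.smul_mem _ _ (Submodule.subset_span ⟨i, rfl⟩)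
    · rw [Submodule.span_le]
      rintro _ ⟨i, rfl⟩
      exact ⟨(0, Pi.single i 1), ⟨rfl, trivial⟩, rfl⟩
  · have h := hM 1
    rw [mul_one] at h
    rw [← h]
    apply le_antisymm
    · rintro _ ⟨⟨v, b⟩, ⟨hv, -⟩, rfl⟩
      have hv : v = 0 := hv
      rw [hv, hsm b]
      exact Submodule.smul_mem _ _ (Submodule.mem_span_singleton_self _)
    · rw [Submodule.span_singleton_le_iff_mem]
      exact ⟨(0, 1), ⟨rfl, trivial⟩, rfl⟩
  · intro i j
    rw [hr]
    by_cases h : i = j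
    · subst h
      simp [Pi.single_apply]
    · simp [Pi.single_apply, h]
      exact map_zero pM
  · intro i j
    rw [hl]
    by_cases h : i = j
    · subst h
      rw [if_pos rfl, ← hsm]
      simp [Pi.single_apply]
    · simp [Pi.single_apply, h]
      exact map_zero pM
  · intro h
    have h1 : C.pM (0, 1) = 0 := Subtype.ext h
    rw [LinearEquiv.map_eq_zero_iff] at h1
    simpa using congrArg Prod.snd h1

/-! ### The dual algebra of the algebra of a twisted potential -/

theorem linForm_diagAut {k : Type u} [Field k] (l₁ l₂ : kˣ) (i : Fin 2) :
    linForm (diagAut l₁ l₂ (Pi.single i 1)) = ((![l₁, l₂] i : kˣ) : k) • FreeAlgebra.ι k i := by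
  fin_cases i <;> simp [linForm, diagAut, Fin.sum_univ_two, LinearEquiv.smulOfUnit] <;> rfl

theorem rotate_diagAut_mono {k : Type u} [Field k] (l₁ l₂ : kˣ) (l : List (Fin 2)) (i : Fin 2) :
    rotate (diagAut l₁ l₂) (mono (l ++ [i])) = ((![l₁, l₂] i : kˣ) : k) • mono (i :: l) := by
  rw [rotate_mono, linForm_diagAut, smul_mul_assoc, mono_cons]

/-- Rotation sends the word `l ++ [j]` to λ_j times `j :: l`, and no other word contributes to `j ::
l`; the coefficients of w and of its rotation agree. -/
theorem coeff_cons_of_isTwistedPotential {k : Type u} [Field k] {l₁ l₂ : kˣ} {s : ℕ}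
    {w : Free k 2} (hw : IsTwistedPotential (diagAut l₁ l₂) (s + 1) w) (j : Fin 2)
    (l : List (Fin 2)) :
    coeff (j :: l) w = ((![l₁, l₂] j : kˣ) : k) * coeff (l ++ [j]) w := by
  have h : (coeff (j :: l) ∘ₗ rotate (diagAut l₁ l₂)) w =
      (((![l₁, l₂] j : kˣ) : k) • coeff (l ++ [j])) w := by
    refine eq_of_mem_deg (fun l' hl' => ?_) hw.1
    obtain ⟨l'', i, rfl⟩ : ∃ l'' i, l' = l'' ++ [i] :=
      (List.eq_nil_or_concat' l').resolve_left (by rintro rfl; simp at hl')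
    rw [LinearMap.comp_apply, rotate_diagAut_mono, map_smul, coeff_mono, LinearMap.smul_apply,
      coeff_mono]
    by_cases h : i = j ∧ l'' = l
    · obtain ⟨rfl, rfl⟩ := h
      simp
    · rw [if_neg (by simpa using h), if_neg (by simpa [and_comm] using h), smul_zero, smul_zero]
  rw [LinearMap.comp_apply, hw.2] at h
  exact h

theorem mul_mem_deg {k : Type u} [Field k] {m p q : ℕ} {a b : Free k m} (ha : a ∈ deg k m p)
    (hb : b ∈ deg k m q) : a * b ∈ deg k m (p + q) := by
  rw [deg, pow_add]
  exact Submodule.mul_mem_mul ha hb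

theorem contract_mem_deg {k : Type u} [Field k] {m s : ℕ} (f : Fin m → k) {w : Free k m}
    (hw : w ∈ deg k m (s + 1)) : contract f w ∈ deg k m s := by
  rw [deg_eq_span] at hw
  refine Submodule.span_induction (p := fun w _ => contract f w ∈ deg k m s) ?_ ?_ ?_ ?_ hw
  · rintro _ ⟨_ | ⟨i, l⟩, hl, rfl⟩
    · simp at hl
    · rw [contract_mono]
      exact Submodule.smul_mem _ _ (mono_mem_deg_of_length (by simpa using hl))
  · simp
  · intro a b _ _ ha hb
    rw [map_add]
    exact add_mem ha hb
  · intro c a _ ha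
    rw [map_smul]
    exact Submodule.smul_mem _ _ ha

theorem coeff_contract {k : Type u} [Field k] {m s : ℕ} (f : Fin m → k) {w : Free k m}
    (hw : w ∈ deg k m (s + 1)) (l : List (Fin m)) :
    coeff l (contract f w) = ∑ j, f j * coeff (j :: l) w := by
  have h : (coeff l ∘ₗ contract f) w = (∑ j, f j • coeff (j :: l)) w := by
    refine eq_of_mem_deg (fun l' hl' => ?_) hw
    obtain _ | ⟨i, l'⟩ := l'
    · simp at hl'
    rw [LinearMap.comp_apply, contract_mono, map_smul, coeff_mono, LinearMap.sum_apply,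
      Finset.sum_eq_single i]
    · rw [LinearMap.smul_apply, coeff_mono]
      simp
    · intro j _ hj
      rw [LinearMap.smul_apply, coeff_mono, if_neg (by simp [hj.symm]), smul_zero]
    · simp
  simpa using h

theorem pairing_eq_ev {k : Type u} [Field k] {m s : ℕ} {f : Free k m} (hf : f ∈ deg k m s)
    (p : Free k m) : pairing s f p = ev (fun l => coeff l p) f := by
  have h : (∑ v : Fin s → Fin m, coeff (List.ofFn v) p • coeff (k := k) (List.ofFn v)) f =
      ev (fun l => coeff l p) f := by
    refine eq_of_mem_deg (fun l hl => ?_) hf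
    subst hl
    rw [ev_mono, LinearMap.sum_apply, Finset.sum_eq_single l.get]
    · simp [coeff_mono]
    · intro v _ hv
      rw [LinearMap.smul_apply, coeff_mono, if_neg, smul_zero]
      intro h
      apply hv
      apply List.ofFn_injective
      rw [← h, List.ofFn_get]
    · simp
  rw [← h, pairing, LinearMap.sum_apply]
  exact Finset.sum_congr rfl fun v _ => by rw [LinearMap.smul_apply, smul_eq_mul, mul_comm]

theorem ev_sum {k : Type u} [Field k] {m : ℕ} {ι : Type*} (t : Finset ι)
    (c : ι → k) (f : ι → List (Fin m) → k) (p : Free k m) :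
    ev (fun l => ∑ j ∈ t, c j * f j l) p = ∑ j ∈ t, c j * ev (f j) p := by
  have : ev (fun l => ∑ j ∈ t, c j * f j l) = ∑ j ∈ t, c j • ev (f j) :=
    linearMap_ext_mono fun l => by simp [ev_mono]
  rw [this]
  simp

/-- The relations of the dual algebra of the algebra of a potential `w`. -/
def dualRelations {k : Type u} [Field k] {m : ℕ} (s : ℕ) (w : Free k m) : Set (Free k m) :=
  {f | f ∈ deg k m s ∧ ∀ j, ev (fun l => coeff (j :: l) w) f = 0}

/-- Contracting w with a coordinate form j yields an element whose pairing with f is the functional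
indexed by j. Conversely, the contractions are all that matters in degree s, because they already
have that degree and any proper monomial multiple lies higher. -/
theorem dualIdeal_potentialIdeal {k : Type u} [Field k] {m s : ℕ} {w : Free k m}
    (hw : w ∈ deg k m (s + 1)) :
    dualIdeal s (potentialIdeal w) = TwoSidedIdeal.span (dualRelations s w) := by
  unfold dualIdeal dualRelations
  congr 1
  ext f
  refine and_congr_right fun hf => ⟨fun h j => ?_, fun h p hp _ => ?_⟩
  · have := h (contract (Pi.single j 1) w) (TwoSidedIdeal.subset_span ⟨_, rfl⟩)
      (contract_mem_deg _ hw)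
    rw [pairing_eq_ev hf] at this
    rw [← this]
    congr 2
    funext l
    rw [coeff_contract _ hw]
    simp [Pi.single_apply]
  -- The pairing with f, viewed as a functional on the whole free algebra that sees degree s only,
  -- so that proper multiples of the contractions drop out.
  · let L : Free k m →ₗ[k] k :=
      ∑ v : Fin s → Fin m, coeff (List.ofFn v) f • coeff (k := k) (List.ofFn v)
    have hL : ∀ p, L p = pairing s f p := fun p => by simp [L, pairing]
    rw [← hL]
    refine eq_zero_of_mem_span L ?_ hp
    rintro _ ⟨g, rfl⟩ P Q
    by_cases hPQ : P = [] ∧ Q = []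
    · obtain ⟨rfl, rfl⟩ := hPQ
      rw [mono_nil, one_mul, mul_one, hL, pairing_eq_ev hf]
      simp only [coeff_contract _ hw, ev_sum, h, mul_zero, Finset.sum_const_zero]
    · have hd := mul_mem_deg (mul_mem_deg (mono_mem_deg (k := k) P) (contract_mem_deg g hw))
        (mono_mem_deg Q)
      simp only [L, LinearMap.sum_apply, LinearMap.smul_apply]
      refine Finset.sum_eq_zero fun v _ => ?_
      rw [coeff_eq_zero_of_mem_deg hd, smul_zero]
      intro hlen
      apply hPQ
      rw [List.length_ofFn] at hlen
      exact ⟨List.length_eq_zero_iff.1 (by omega), List.length_eq_zero_iff.1 (by omega)⟩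

theorem isHomogeneousIdeal_potentialIdeal {k : Type u} [Field k] {m s : ℕ} {w : Free k m}
    (hw : w ∈ deg k m (s + 1)) : IsHomogeneousIdeal s (potentialIdeal w) :=
  ⟨_, by rintro _ ⟨f, rfl⟩; exact contract_mem_deg f hw, rfl⟩

theorem ev_mono_mul_mul_mono {k : Type u} [Field k] {m : ℕ} (c : List (Fin m) → k)
    (p q : List (Fin m)) (f : Free k m) :
    ev c (mono p * f * mono q) = ev (fun l => c (p ++ l ++ q)) f := by
  have : ev c ∘ₗ LinearMap.mulRight k (mono q) ∘ₗ LinearMap.mulLeft k (mono p) =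
      ev (fun l => c (p ++ l ++ q)) := by
    refine linearMap_ext_mono fun l => ?_
    rw [ev_mono]
    simp [← mono_append, ev_mono]
  exact LinearMap.congr_fun this f

theorem ev_eq_zero_of_length {k : Type u} [Field k] {m s : ℕ} {c : List (Fin m) → k}
    (hc : ∀ l, l.length = s → c l = 0) {f : Free k m} (hf : f ∈ deg k m s) : ev c f = 0 := by
  refine eq_of_mem_deg (g := 0) (fun l hl => ?_) hf
  rw [ev_mono, hc l hl]
  rfl

/-- The relations `e_i [m t] = [i m] e_t` between the products `U i j = e_i X_j` and
`W j i = X_j e_i`, where `[l] = ∑ c (j l) X_j` for a word `l` of length `s`. -/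
def WordRelations {k : Type u} [Field k] (c : List (Fin 2) → k) (s : ℕ) {E : Type u}
    [AddCommGroup E] [Module k E] (U W : Fin 2 → Fin 2 → E) : Prop :=
  ∀ (i t : Fin 2) (m : List (Fin 2)), m.length + 1 = s →
    ∑ j, c (j :: (m ++ [t])) • U i j = ∑ j, c (j :: i :: m) • W j t

/-- The relations between words of length `s + 1` leave only one product up to scalars. -/
def IsRigid {k : Type u} [Field k] (c : List (Fin 2) → k) (s : ℕ) : Prop :=
  ∀ (E : Type u) [AddCommGroup E] [Module k E] (U W : Fin 2 → Fin 2 → E),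
    WordRelations c s U W → (∀ i j, i ≠ j → U i j = 0) ∧ ∃ t, ∀ i, ∃ a : k, U i i = a • W t t

/-- The words `r j` are, up to scalars, dual to the functionals defining the relations, so their
classes span Γ_s. Rigidity bounds Γ_{s+1} from above, and the functional given by the coefficients
of w bounds it from below and fixes the constants. -/
theorem frame_of_isRigid {k : Type u} [Field k] {l₁ l₂ : kˣ} {s : ℕ}
    {w : Free k 2} (hw : IsTwistedPotential (diagAut l₁ l₂) (s + 1) w)
    (r : Fin 2 → List (Fin 2)) (hr : ∀ j, (r j).length = s)
    (hd : ∀ j, coeff (j :: r j) w ≠ 0) (ho : ∀ i j, i ≠ j → coeff (i :: r j) w = 0)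
    (hrig : IsRigid (fun l => coeff l w) s) :
    Nonempty (Frame (dualIdeal s (potentialIdeal w)) s ![l₁, l₂]) := by
  rw [dualIdeal_potentialIdeal hw.1]
  set J := TwoSidedIdeal.span (dualRelations s w) with hJ
  set lam : Fin 2 → kˣ := ![l₁, l₂] with hlam
  have hrot : ∀ j l, coeff (j :: l) w = (lam j : k) * coeff (l ++ [j]) w :=
    coeff_cons_of_isTwistedPotential hw
  have hrot' : ∀ j l, coeff (l ++ [j]) w = (((lam j)⁻¹ : kˣ) : k) * coeff (j :: l) w := by
    intro j l
    rw [hrot, ← mul_assoc, Units.inv_mul, one_mul]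
  let e : Fin 2 → QuotAlg J := fun i => proj J (FreeAlgebra.ι k i)
  let X : Fin 2 → QuotAlg J := fun j => (coeff (j :: r j) w)⁻¹ • proj J (mono (r j))
  have hX : ∀ f ∈ deg k 2 s, proj J f = ∑ j, ev (fun l => coeff (j :: l) w) f • X j := by
    intro f hf
    rw [← sub_eq_zero]
    have h1 : proj J f - ∑ j, ev (fun l => coeff (j :: l) w) f • X j =
        proj J (f - ∑ j, (ev (fun l => coeff (j :: l) w) f * (coeff (j :: r j) w)⁻¹) •
          mono (r j)) := by
      simp [X, smul_smul]
    rw [h1, proj_eq_zero_iff]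
    -- The difference has degree s and is killed by both functionals, so it is itself one of the
    -- relations.
    refine TwoSidedIdeal.subset_span ⟨sub_mem hf (sum_mem fun j _ => Submodule.smul_mem _ _
      (mono_mem_deg_of_length (hr j))), fun i => ?_⟩
    rw [map_sub, map_sum, Finset.sum_eq_single i]
    · rw [map_smul, ev_mono, smul_eq_mul, mul_assoc, inv_mul_cancel₀ (hd i), mul_one, sub_self]
    · intro j _ hj
      rw [map_smul, ev_mono, ho i j hj.symm, smul_zero]
    · simp
  have hXm : ∀ l : List (Fin 2), l.length = s →
      proj J (mono l) = ∑ j, coeff (j :: l) w • X j := by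
    intro l hl
    rw [hX _ (mono_mem_deg_of_length hl)]
    simp only [ev_mono]
  -- A relation times one letter on the left is killed by definition, times one letter on the right
  -- by twisted cyclicity of w; every other monomial multiple misses the degree s + 1 of w.
  obtain ⟨ω, hω⟩ := exists_functional J (ev fun l => coeff l w) (by
    intro x hx
    refine eq_zero_of_mem_span _ ?_ hx
    rintro f ⟨hf, hf0⟩ p q
    rw [ev_mono_mul_mul_mono]
    by_cases hpq : p.length + q.length = 1
    · rcases p with _ | ⟨j, _ | _⟩
      · obtain ⟨j, rfl⟩ := List.length_eq_one_iff.1 (by simpa using hpq)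
        have h2 : ev (fun l => coeff ([] ++ l ++ [j]) w) =
            (((lam j)⁻¹ : kˣ) : k) • ev (fun l => coeff (j :: l) w) :=
          linearMap_ext_mono fun l => by
            rw [LinearMap.smul_apply, ev_mono, ev_mono, List.nil_append, hrot', smul_eq_mul]
        rw [h2, LinearMap.smul_apply, hf0, smul_zero]
      · obtain rfl := List.length_eq_zero_iff.1 (by simpa using hpq)
        simpa using hf0 j
      · simp at hpq
        omega
    · refine ev_eq_zero_of_length (fun l hl => coeff_eq_zero_of_mem_deg hw.1 ?_) hf
      simp only [List.length_append]
      omega)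
  have he : ∀ i l, e i * proj J (mono l) = proj J (mono (i :: l)) := by
    intro i l
    rw [mono_cons, map_mul]
  have he' : ∀ i l, proj J (mono l) * e i = proj J (mono (l ++ [i])) := by
    intro i l
    rw [mono_append, map_mul, mono_singleton]
  have hωU : ∀ i j, ω (e i * X j) = if i = j then 1 else 0 := by
    intro i j
    rw [mul_smul_comm, he, map_smul, hω, ev_mono]
    split_ifs with h
    · subst h
      exact inv_mul_cancel₀ (hd i)
    · rw [ho i j h, smul_zero]
  have hωW : ∀ i j, ω (X j * e i) = if i = j then (((lam i)⁻¹ : kˣ) : k) else 0 := by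
    intro i j
    rw [smul_mul_assoc, he', map_smul, hω, ev_mono, hrot', smul_eq_mul, mul_left_comm]
    split_ifs with h
    · subst h
      rw [inv_mul_cancel₀ (hd i), mul_one]
    · rw [ho i j h, mul_zero, mul_zero]
  obtain ⟨hU, t, ht⟩ := hrig (QuotAlg J) (fun i j => e i * X j) (fun j i => X j * e i) (by
    intro i t m hm
    have h1 := hXm (m ++ [t]) (by simpa using hm)
    have h2 := hXm (i :: m) (by simpa using hm)
    have h3 : e i * proj J (mono (m ++ [t])) = proj J (mono (i :: m)) * e t := by
      rw [he, he', List.cons_append]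
    rw [h1, h2, Finset.mul_sum, Finset.sum_mul] at h3
    simpa only [mul_smul_comm, smul_mul_assoc] using h3)
  -- Applying `ω` identifies the unknown scalar as λ_t, independently of i; hence e_0 X_0 = e_1 X_1,
  -- the future Z.
  have hUZ : ∀ i, e i * X i = (lam t : k) • (X t * e t) := by
    intro i
    obtain ⟨a, ha⟩ := ht i
    have h1 := congrArg ω ha
    simp only [map_smul, hωU, hωW, if_true, smul_eq_mul] at h1
    have h2 : a = lam t := by
      have h3 := congrArg (· * (lam t : k)) h1
      simpa [mul_assoc] using h3.symm
    rw [← h2]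
    exact ha
  have heX : ∀ i j, e i * X j = if i = j then e 0 * X 0 else 0 := by
    intro i j
    split_ifs with h
    · subst h
      rw [hUZ, hUZ]
    · exact hU i j h
  have hmid : gr J s = Submodule.span k (Set.range X) := by
    apply le_antisymm
    · rintro _ ⟨f, hf, rfl⟩
      change proj J f ∈ _
      rw [hX f hf]
      exact sum_mem fun j _ => Submodule.smul_mem _ _ (Submodule.subset_span ⟨j, rfl⟩)
    · rw [Submodule.span_le]
      rintro _ ⟨j, rfl⟩
      exact Submodule.smul_mem _ _ (proj_mem_gr J (mono_mem_deg_of_length (hr j)))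
  have htop : gr J (s + 1) = Submodule.span k {e 0 * X 0} := by
    rw [add_comm, ← gr_mul, gr_one, hmid, Submodule.span_mul_span]
    apply le_antisymm
    · rw [Submodule.span_le]
      rintro _ ⟨_, ⟨i, rfl⟩, _, ⟨j, rfl⟩, rfl⟩
      change e i * X j ∈ _
      rw [heX i j]
      split_ifs
      · exact Submodule.mem_span_singleton_self _
      · exact zero_mem _
    · rw [Submodule.span_singleton_le_iff_mem]
      exact Submodule.subset_span ⟨_, ⟨0, rfl⟩, _, ⟨0, rfl⟩, rfl⟩
  refine ⟨⟨e, X, e 0 * X 0, gr_one J, hmid, htop, heX, fun i j => ?_, fun h => ?_⟩⟩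
  -- The product lies on the line spanned by Z, and `ω` reads off its multiple.
  · have h1 : X j * e i ∈ gr J (s + 1) := by
      rw [← gr_mul]
      refine Submodule.mul_mem_mul ?_ ?_
      · rw [hmid]
        exact Submodule.subset_span ⟨j, rfl⟩
      · rw [gr_one]
        exact Submodule.subset_span ⟨i, rfl⟩
    rw [htop] at h1
    obtain ⟨a, ha⟩ := Submodule.mem_span_singleton.1 h1
    have h2 := congrArg ω ha
    rw [map_smul, hωU, if_pos rfl, hωW, smul_eq_mul, mul_one] at h2
    rw [← ha, h2]
    split_ifs
    · rfl
    · rw [zero_smul]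
  · have h1 := congrArg ω h
    rw [hωU, if_pos rfl, map_zero] at h1
    exact one_ne_zero h1

/-! ### Necessary conditions for the existence of a frame -/

theorem exists_ne_fin_two (p : Fin 2) : ∃ q : Fin 2, p ≠ q := ⟨p + 1, by fin_cases p <;> decide⟩

/-- The value of a twisted cyclic function on words under a rotation of the word. -/
theorem apply_append_of_rotate {k : Type u} [Field k] {s : ℕ} {lam : Fin 2 → kˣ}
    {c : List (Fin 2) → k}
    (hc : ∀ j l, l.length = s → c (j :: l) = lam j * c (l ++ [j])) (p r : List (Fin 2))
    (h : (p ++ r).length = s + 1) :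
    c (p ++ r) = (((p.map lam).prod : kˣ) : k) * c (r ++ p) := by
  induction p generalizing r with
  | nil => simp
  | cons j p ih =>
    have h1 : (p ++ r).length = s := by simpa using h
    rw [List.cons_append, hc j _ h1, List.append_assoc, ih (r ++ [j]) (by simp at h1 ⊢; omega)]
    simp [mul_assoc]

theorem prod_map_eq_pow_count {G : Type*} [CommMonoid G] (lam : Fin 2 → G) {p q : Fin 2}
    (hpq : p ≠ q) (l : List (Fin 2)) :
    (l.map lam).prod = lam p ^ l.count p * lam q ^ l.count q := by
  induction l with
  | nil => simp
  | cons i l ih =>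
    have hi : i = p ∨ i = q := by omega
    rw [List.map_cons, List.prod_cons, ih]
    rcases hi with rfl | rfl
    · rw [List.count_cons_self, List.count_cons_of_ne hpq, pow_succ']
      simp only [mul_assoc]
    · rw [List.count_cons_self, List.count_cons_of_ne hpq.symm, pow_succ']
      simp only [mul_left_comm]

theorem count_add_count {p q : Fin 2} (hpq : p ≠ q) (l : List (Fin 2)) :
    l.count p + l.count q = l.length := by
  induction l with
  | nil => simp
  | cons i l ih =>
    have hi : i = p ∨ i = q := by omega
    rcases hi with rfl | rfl
    · rw [List.count_cons_self, List.count_cons_of_ne hpq, List.length_cons]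
      omega
    · rw [List.count_cons_self, List.count_cons_of_ne hpq.symm, List.length_cons]
      omega

/-- Rotating W through all its letters returns W and multiplies the value by the product of the
twists of its letters; a nonzero value forces this product to be 1. -/
theorem pow_mul_pow_eq_one_of_rotate {k : Type u} [Field k] {s : ℕ} {lam : Fin 2 → kˣ}
    {c : List (Fin 2) → k}
    (hc : ∀ j l, l.length = s → c (j :: l) = lam j * c (l ++ [j])) {W : List (Fin 2)}
    (hW : W.length = s + 1) (h : c W ≠ 0) {p q : Fin 2} (hpq : p ≠ q) :
    lam p ^ W.count p * lam q ^ (s + 1 - W.count p) = 1 := by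
  have h1 := apply_append_of_rotate hc W [] (by simpa using hW)
  rw [List.append_nil, List.nil_append] at h1
  have h2 : (((W.map lam).prod : kˣ) : k) = 1 := by
    refine mul_right_cancel₀ h ?_
    rw [← h1, one_mul]
  rw [prod_map_eq_pow_count lam hpq, Units.val_eq_one] at h2
  have h3 := count_add_count hpq W
  rwa [show s + 1 - W.count p = W.count q by omega]

/-! ### Words in the degree-one basis of a frame -/

namespace Frame

variable {k : Type u} [Field k] {m : ℕ} {J : TwoSidedIdeal (Free k m)} {s : ℕ}
  {lam : Fin 2 → kˣ}

/-- The product of the elements `e_i` along a word. -/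
def word (F : Frame J s lam) (l : List (Fin 2)) : QuotAlg J := (l.map F.e).prod

theorem gr_eq_span_word (F : Frame J s lam) (n : ℕ) :
    gr J n = Submodule.span k {a | ∃ l : List (Fin 2), l.length = n ∧ F.word l = a} := by
  rw [gr_eq_pow, F.gr_one, span_range_pow]
  rfl

theorem word_mem (F : Frame J s lam) (l : List (Fin 2)) : F.word l ∈ gr J l.length := by
  rw [F.gr_eq_span_word]
  exact Submodule.subset_span ⟨l, rfl, rfl⟩

theorem word_cons (F : Frame J s lam) (j : Fin 2) (l : List (Fin 2)) :
    F.word (j :: l) = F.e j * F.word l := by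
  simp [word]

theorem word_append (F : Frame J s lam) (l l' : List (Fin 2)) :
    F.word (l ++ l') = F.word l * F.word l' := by
  simp [word]

theorem word_singleton (F : Frame J s lam) (j : Fin 2) : F.word [j] = F.e j := by
  simp [word]

theorem exists_coeffs (F : Frame J s lam) : ∃ a : List (Fin 2) → Fin 2 → k,
    ∀ l, l.length = s → F.word l = ∑ j, a l j • F.X j := by
  have h : ∀ l : List (Fin 2), ∃ a : Fin 2 → k, l.length = s → F.word l = ∑ j, a j • F.X j := by
    intro l
    by_cases hl : l.length = s
    · have h1 := F.word_mem l
      rw [hl, F.gr_mid] at h1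
      obtain ⟨a, ha⟩ := (Submodule.mem_span_range_iff_exists_fun k).1 h1
      exact ⟨a, fun _ => ha.symm⟩
    · exact ⟨0, fun h => absurd h hl⟩
  choose a ha using h
  exact ⟨a, ha⟩

theorem smul_Z_injective (F : Frame J s lam) {a b : k} (h : a • F.Z = b • F.Z) : a = b :=
  smul_left_injective k F.Z_ne h

/-- Otherwise e_j would annihilate every word of length s, hence all of Γ_s, contradicting e_j X_j =
Z ≠ 0. -/
theorem exists_coeff_ne_zero (F : Frame J s lam) {a : List (Fin 2) → Fin 2 → k}
    (ha : ∀ l, l.length = s → F.word l = ∑ j, a l j • F.X j) (j : Fin 2) :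
    ∃ l, l.length = s ∧ a l j ≠ 0 := by
  by_contra! h
  have h1 : F.e j * F.X j = 0 := by
    have h2 := F.X_mem j
    rw [F.gr_eq_span_word] at h2
    refine Submodule.span_induction (p := fun x _ => F.e j * x = 0) ?_ (mul_zero _) ?_ ?_ h2
    · rintro _ ⟨l, hl, rfl⟩
      rw [ha l hl, F.e_mul_sum, h l hl, zero_smul]
    · intro x y _ _ hx hy
      rw [mul_add, hx, hy, add_zero]
    · intro c x _ hx
      rw [mul_smul_comm, hx, smul_zero]
  rw [F.e_mul_X, if_pos rfl] at h1
  exact F.Z_ne h1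

/-- The coefficient functions on words of length `s` do not have a power of one letter as their
only word, since otherwise the polynomial ring in that letter would be a quotient of `Γ`. -/
theorem exists_ne_replicate (F : Frame J s lam) {S : Set (Free k m)}
    (hJ : J = TwoSidedIdeal.span S) (hS : S ⊆ (deg k m s : Set (Free k m)))
    {a : List (Fin 2) → Fin 2 → k}
    (ha : ∀ l, l.length = s → F.word l = ∑ j, a l j • F.X j) (j p : Fin 2) :
    ∃ l, l.length = s ∧ l ≠ List.replicate s p ∧ a l j ≠ 0 := by
  by_contra! h
  have ha0 : a (List.replicate s p) j ≠ 0 := by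
    obtain ⟨l, hl, hl0⟩ := F.exists_coeff_ne_zero ha j
    by_cases hlp : l = List.replicate s p
    · rwa [← hlp]
    · exact absurd (h l hl hlp) hl0
  set a₀ := a (List.replicate s p) j with ha₀
  have hP : ∀ i : Fin m, ∃ P : Fin 2 → k, ∑ t, P t • F.e t = proj J (FreeAlgebra.ι k i) := by
    intro i
    rw [← Submodule.mem_span_range_iff_exists_fun, ← F.gr_one, HomTriples.gr_one]
    exact Submodule.subset_span ⟨i, rfl⟩
  choose P hP using hP
  -- Each generator goes to its coefficient at e_p times the variable; this is "set e_q = 0 and e_p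
  -- = T", lifted to the free algebra.
  let Ψ : Free k m →ₐ[k] Polynomial k :=
    FreeAlgebra.lift k fun i => Polynomial.C (P i p) * Polynomial.X
  have hΨ : ∀ v : List (Fin m), Ψ (mono v) =
      Polynomial.monomial v.length (v.map fun i => P i p).prod := by
    intro v
    induction v with
    | nil => simp [mono_nil]
    | cons i v ih =>
      rw [mono_cons, map_mul, ih]
      simp only [Ψ, FreeAlgebra.lift_ι_apply, Polynomial.C_mul_X_eq_monomial,
        Polynomial.monomial_mul_monomial, List.map_cons, List.prod_cons, List.length_cons]
      rw [add_comm]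
  -- The generators in `v` are rewritten in the e_t one letter at a time. By assumption only the
  -- pure power of p survives multiplication by e_j, with value a₀, so the product is governed by
  -- `Ψ`.
  have hstep : ∀ (v : List (Fin m)) (u : List (Fin 2)), u.length + v.length = s →
      F.e j * F.word u * proj J (mono v) =
        if u = List.replicate u.length p then ((v.map fun i => P i p).prod * a₀) • F.Z
        else 0 := by
    intro v
    induction v with
    | nil =>
      intro u hu
      have hu' : u.length = s := by simpa using hu
      rw [mono_nil, map_one, mul_one, ha u hu', F.e_mul_sum, hu']
      split_ifs with hup
      · simp [ha₀, ← hup]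
      · rw [h u hu' hup, zero_smul]
    | cons i v ih =>
      intro u hu
      have h1 : ∀ t, F.e j * F.word u * F.e t * proj J (mono v) =
          if u = List.replicate u.length p ∧ t = p then
            ((v.map fun i => P i p).prod * a₀) • F.Z else 0 := by
        intro t
        have h2 := ih (u ++ [t]) (by simp at hu ⊢; omega)
        rw [F.word_append, F.word_singleton, ← mul_assoc] at h2
        rw [h2]
        refine if_congr ?_ rfl rfl
        rw [List.length_append, List.length_singleton, List.replicate_succ']
        constructor
        · intro h3
          have h4 := List.append_inj h3 (by simp)
          exact ⟨h4.1, by simpa using h4.2⟩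
        · rintro ⟨h3, rfl⟩
          rw [← h3]
      rw [mono_cons, map_mul, ← hP, Finset.sum_mul, Finset.mul_sum, Finset.sum_eq_single p]
      · rw [smul_mul_assoc, mul_smul_comm, ← mul_assoc, h1]
        by_cases hup : u = List.replicate u.length p
        · rw [if_pos ⟨hup, rfl⟩, if_pos hup, smul_smul, List.map_cons, List.prod_cons, mul_assoc]
        · rw [if_neg fun h => hup h.1, if_neg hup, smul_zero]
      · intro t _ ht
        rw [smul_mul_assoc, mul_smul_comm, ← mul_assoc, h1, if_neg fun h => ht h.2, smul_zero]
      · simp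
  have hdeg : ∀ n, ∀ f ∈ deg k m n, Ψ f = Polynomial.monomial n ((Ψ f).coeff n) := by
    intro n f hf
    refine eq_of_mem_deg (f := Ψ.toLinearMap)
      (g := Polynomial.monomial n ∘ₗ Polynomial.lcoeff k n ∘ₗ Ψ.toLinearMap) ?_ hf
    intro l hl
    subst hl
    simp [hΨ]
  have hmid : ∀ f ∈ deg k m s, F.e j * proj J f = ((Ψ f).coeff s * a₀) • F.Z := by
    intro f hf
    refine eq_of_mem_deg (f := LinearMap.mulLeft k (F.e j) ∘ₗ (proj J).toLinearMap)
      (g := (LinearMap.toSpanSingleton k _ F.Z) ∘ₗ LinearMap.mulRight k a₀ ∘ₗ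
        Polynomial.lcoeff k s ∘ₗ Ψ.toLinearMap) ?_ hf
    intro l hl
    have h1 := hstep l [] (by simpa using hl)
    simp only [word, List.map_nil, List.prod_nil, mul_one, List.length_nil,
      List.replicate_zero, if_true] at h1
    simp [h1, hΨ, hl]
  have hone : ∀ f ∈ deg k m 1, proj J f * F.X p = (Ψ f).coeff 1 • F.Z := by
    intro f hf
    refine eq_of_mem_deg (f := LinearMap.mulRight k (F.X p) ∘ₗ (proj J).toLinearMap)
      (g := (LinearMap.toSpanSingleton k _ F.Z) ∘ₗ
        Polynomial.lcoeff k 1 ∘ₗ Ψ.toLinearMap) ?_ hf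
    intro l hl
    obtain ⟨i, rfl⟩ := List.length_eq_one_iff.1 hl
    change proj J (mono [i]) * F.X p = (Ψ (mono [i])).coeff 1 • F.Z
    rw [hΨ, mono_singleton, ← hP, F.sum_mul_X]
    simp
  -- Generation in degree s is essential here: a generator f vanishes in Γ, so `hmid` and a₀ ≠ 0
  -- annihilate the only possible coefficient of `Ψ f`.
  have hker : J ≤ TwoSidedIdeal.ker Ψ := by
    rw [hJ, TwoSidedIdeal.span_le]
    intro f hf
    rw [SetLike.mem_coe, TwoSidedIdeal.mem_ker]
    have h1 := hmid f (hS hf)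
    have h2 : proj J f = 0 := (proj_eq_zero_iff J f).2 (hJ ▸ TwoSidedIdeal.subset_span hf)
    rw [h2, mul_zero, eq_comm, smul_eq_zero, or_iff_left F.Z_ne, _root_.mul_eq_zero,
      or_iff_left ha0] at h1
    rw [hdeg s f (hS hf), h1, map_zero]
  obtain ⟨q, hpq⟩ := exists_ne_fin_two p
  obtain ⟨yp, hyp, hyp'⟩ := F.e_mem p
  obtain ⟨yq, hyq, hyq'⟩ := F.e_mem q
  obtain ⟨xq, hxq, hxq'⟩ := F.X_mem q
  replace hyp' : proj J yp = F.e p := hyp'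
  replace hyq' : proj J yq = F.e q := hyq'
  replace hxq' : proj J xq = F.X q := hxq'
  have hΨp : Ψ yp = Polynomial.X := by
    have h1 := hone yp hyp
    rw [hyp', F.e_mul_X, if_pos rfl] at h1
    have h2 : (1 : k) = (Ψ yp).coeff 1 := F.smul_Z_injective (by rwa [one_smul])
    rw [hdeg 1 yp hyp, ← h2, Polynomial.monomial_one_one_eq_X]
  have hΨq : Ψ yq = 0 := by
    have h1 := hone yq hyq
    rw [hyq', F.e_mul_X, if_neg hpq.symm, eq_comm, smul_eq_zero, or_iff_left F.Z_ne] at h1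
    rw [hdeg 1 yq hyq, h1, map_zero]
  -- The contradiction: e_p^{s+1} is a multiple of Z = e_q X_q, which `Ψ` kills, while its own image
  -- is the power of the variable.
  have htop : F.e p ^ (s + 1) ∈ gr J (s + 1) := by
    rw [gr_eq_pow]
    exact Submodule.pow_mem_pow _ (F.e_mem p) _
  rw [F.gr_top] at htop
  obtain ⟨b, hb⟩ := Submodule.mem_span_singleton.1 htop
  have hmem : yp ^ (s + 1) - b • (yq * xq) ∈ J := by
    rw [← proj_eq_zero_iff, map_sub, map_pow, map_smul, map_mul, hyp', hyq', hxq', F.e_mul_X,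
      if_pos rfl, hb, sub_self]
  have h1 := (TwoSidedIdeal.mem_ker _).1 (hker hmem)
  rw [map_sub, map_pow, map_smul, map_mul, hΨp, hΨq, zero_mul, smul_zero, sub_zero] at h1
  exact pow_ne_zero _ Polynomial.X_ne_zero h1

/-- Under these hypotheses the coefficient at X_p can be nonzero only on p^s and q^s. By
`exists_ne_replicate` neither may stand alone, so both occur: q^s gives λ_p λ_q^s = 1, and p^s gives
λ_p = 1. -/
theorem eq_one_and_pow_eq_one (F : Frame J s lam) (hs : 2 < s) {S : Set (Free k m)}
    (hJ : J = TwoSidedIdeal.span S) (hS : S ⊆ (deg k m s : Set (Free k m)))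
    {p q : Fin 2} (hpq : p ≠ q) (h : lam p ^ s * lam q ≠ 1)
    (h' : ∀ t, 2 ≤ t → t ≤ s - 1 → lam p ^ t * lam q ^ (s + 1 - t) ≠ 1) :
    lam p = 1 ∧ lam q ^ s = 1 := by
  obtain ⟨a, ha⟩ := F.exists_coeffs
  -- The value on the empty word is irrelevant; only words of length s + 1 are used.
  let c : List (Fin 2) → k := fun W => match W with
    | [] => 0
    | j :: l => a l j
  have hc : ∀ j l, l.length = s → c (j :: l) = lam j * c (l ++ [j]) := by
    intro j l hl
    obtain _ | ⟨i, r⟩ := l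
    · simp at hl
      omega
    have h1 : F.e i * F.word (r ++ [j]) = F.word (i :: r) * F.e j := by
      rw [F.word_append, F.word_singleton, F.word_cons, mul_assoc]
    rw [ha (r ++ [j]) (by simpa using hl), ha (i :: r) hl, F.e_mul_sum, F.sum_mul_e] at h1
    have h2 := F.smul_Z_injective h1
    change a (i :: r) j = lam j * a (r ++ [j]) i
    rw [h2, mul_left_comm, Units.mul_inv, mul_one]
  have hsupp : ∀ l, l.length = s → a l p ≠ 0 → l = List.replicate s p ∨
      (l = List.replicate s q ∧ lam p * lam q ^ s = 1) := by
    intro l hl hl0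
    have h1 := pow_mul_pow_eq_one_of_rotate hc (W := p :: l) (by simpa using hl) hl0 hpq
    rw [List.count_cons_self] at h1
    have hle : l.count p ≤ s := hl ▸ List.count_le_length
    have hcnt := count_add_count hpq l
    -- The word `p :: l` has one more p than l, so `h'` rules out counts from 1 to s - 2 in l; the
    -- count s - 1 is then excluded by `h`.
    have h2 : l.count p = 0 ∨ l.count p = s - 1 ∨ l.count p = s := by
      by_contra! h2
      exact h' (l.count p + 1) (by omega) (by omega) h1
    rcases h2 with h2 | h2 | h2
    · right
      rw [h2, zero_add, pow_one, Nat.add_sub_cancel] at h1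
      refine ⟨?_, h1⟩
      have : l.count q = l.length := by omega
      rw [← hl]
      exact List.eq_replicate_length.2 fun b hb => (List.count_eq_length.1 this b hb).symm
    · exfalso
      rw [h2, show s - 1 + 1 = s by omega, show s + 1 - s = 1 by omega, pow_one] at h1
      exact h h1
    · left
      have : l.count p = l.length := by omega
      rw [← hl]
      exact List.eq_replicate_length.2 fun b hb => (List.count_eq_length.1 this b hb).symm
  obtain ⟨l, hl, hlp, hl0⟩ := F.exists_ne_replicate hJ hS ha p p
  obtain ⟨l', hl', hlq', hl0'⟩ := F.exists_ne_replicate hJ hS ha p q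
  have h1 : lam p * lam q ^ s = 1 := ((hsupp l hl hl0).resolve_left hlp).2
  have h2 : l' = List.replicate s p := (hsupp l' hl' hl0').resolve_right fun h => hlq' h.1
  -- The word p^{s+1} is its own rotation.
  have h3 : lam p = 1 := by
    have h4 := hc p l' hl'
    have h5 : c (l' ++ [p]) = c (p :: l') := by
      rw [h2, ← List.replicate_succ', List.replicate_succ]
    rw [h5] at h4
    have h6 : c (p :: l') ≠ 0 := hl0'
    rw [← Units.val_eq_one]
    refine mul_right_cancel₀ h6 ?_
    rw [← h4, one_mul]
  rw [h3, one_mul] at h1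
  exact ⟨h3, h1⟩

end Frame

/-! ### Rigidity of the potentials -/

theorem mono_replicate {k : Type u} [Field k] {m : ℕ} (n : ℕ) (i : Fin m) :
    (mono (List.replicate n i) : Free k m) = FreeAlgebra.ι k i ^ n := by
  simp [mono]

theorem sum_eq_add_of_ne {M : Type*} [AddCommMonoid M] {p q : Fin 2} (hpq : p ≠ q)
    (f : Fin 2 → M) : ∑ j, f j = f p + f q := by
  have h : (p = 0 ∧ q = 1) ∨ (p = 1 ∧ q = 0) := by omega
  rw [Fin.sum_univ_two]
  rcases h with ⟨rfl, rfl⟩ | ⟨rfl, rfl⟩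
  · rfl
  · exact add_comm _ _

theorem forall_fin_two_of_ne {P : Fin 2 → Prop} {p q : Fin 2} (hpq : p ≠ q) (hp : P p)
    (hq : P q) (i : Fin 2) : P i := by
  have h : i = p ∨ i = q := by omega
  rcases h with rfl | rfl
  · exact hp
  · exact hq

theorem exists_eq_smul_of_smul_eq {k : Type u} [Field k] {E : Type*} [AddCommGroup E]
    [Module k E] {a b : k} {x y : E} (ha : a ≠ 0) (h : a • x = b • y) : ∃ c : k, x = c • y :=
  ⟨a⁻¹ * b, by rw [mul_smul, ← h, inv_smul_smul₀ ha]⟩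

theorem isRigid_of_ne {k : Type u} [Field k] {c : List (Fin 2) → k} {s : ℕ} {p q : Fin 2}
    (hpq : p ≠ q) (t : Fin 2)
    (h : ∀ (E : Type u) [AddCommGroup E] [Module k E] (U W : Fin 2 → Fin 2 → E),
      WordRelations c s U W → U p q = 0 ∧ U q p = 0 ∧ (∃ a : k, U p p = a • W t t) ∧
        ∃ a : k, U q q = a • W t t) : IsRigid c s := by
  intro E _ _ U W hUW
  obtain ⟨h1, h2, h3, h4⟩ := h E U W hUW
  refine ⟨?_, t, forall_fin_two_of_ne hpq h3 h4⟩
  refine forall_fin_two_of_ne hpq (forall_fin_two_of_ne hpq ?_ ?_)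
    (forall_fin_two_of_ne hpq ?_ ?_)
  · exact fun h => absurd rfl h
  · exact fun _ => h1
  · exact fun _ => h2
  · exact fun h => absurd rfl h

theorem ne_zero_of_rotate {k : Type u} [Field k] {s : ℕ} {lam : Fin 2 → kˣ}
    {c : List (Fin 2) → k}
    (hc : ∀ j l, l.length = s → c (j :: l) = lam j * c (l ++ [j])) (p r : List (Fin 2))
    (h : (p ++ r).length = s + 1) (h0 : c (r ++ p) ≠ 0) : c (p ++ r) ≠ 0 := by
  rw [apply_append_of_rotate hc p r h]
  exact mul_ne_zero (Units.ne_zero _) h0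

/-! ### Relations read off from single words -/

section Words

variable {k : Type u} [Field k] {c : List (Fin 2) → k} {n : ℕ} {p q : Fin 2}
  {E : Type u} [AddCommGroup E] [Module k E] {U W : Fin 2 → Fin 2 → E}

/-- The mixed product `e_p X_q` vanishes because of the word `p q p q^{n + 1}`. -/
theorem WordRelations.mixed_eq_zero (hUW : WordRelations c (n + 3) U W) (hpq : p ≠ q)
    (h1 : c (q :: q :: p :: List.replicate (n + 1) q) ≠ 0)
    (h2 : c (p :: q :: p :: List.replicate (n + 1) q) = 0)
    (h3 : c (p :: p :: q :: p :: List.replicate n q) = 0)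
    (h4 : c (q :: p :: q :: p :: List.replicate n q) = 0) : U p q = 0 := by
  have h := hUW p q (q :: p :: List.replicate n q) (by simp)
  rw [List.cons_append, List.cons_append, ← List.replicate_succ'] at h
  rw [sum_eq_add_of_ne hpq, sum_eq_add_of_ne hpq, h2, h3, h4, zero_smul, zero_smul, zero_smul,
    zero_add, zero_add] at h
  exact (smul_eq_zero.1 h).resolve_left h1

/-- The mixed product `e_q X_p` vanishes because of the word `q p^{n + 3}`. -/
theorem WordRelations.mixed_eq_zero_of_pow (hUW : WordRelations c (n + 3) U W) (hpq : p ≠ q)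
    (h1 : c (p :: List.replicate (n + 3) p) ≠ 0) (h2 : c (q :: List.replicate (n + 3) p) = 0)
    (h3 : c (p :: q :: List.replicate (n + 2) p) = 0)
    (h4 : c (q :: q :: List.replicate (n + 2) p) = 0) : U q p = 0 := by
  have h := hUW q p (List.replicate (n + 2) p) (by simp)
  rw [← List.replicate_succ'] at h
  rw [sum_eq_add_of_ne hpq, sum_eq_add_of_ne hpq, h2, h3, h4, zero_smul, zero_smul, zero_smul,
    add_zero, add_zero] at h
  exact (smul_eq_zero.1 h).resolve_left h1

/-- The mixed product `e_p X_q` vanishes because of the words `p p q q` and `p q p q`. -/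
theorem WordRelations.mixed_eq_zero_of_length_four {lam : Fin 2 → kˣ}
    (hc : ∀ j l, l.length = 3 → c (j :: l) = lam j * c (l ++ [j]))
    (hUW : WordRelations c 3 U W) (hpq : p ≠ q)
    (h1 : c [q, p, q, q] ≠ 0) (h2 : c [p, p, q, q] = 0) (h3 : c [q, p, p, q] = 0)
    (h4 : c [p, q, p, q] = 0) (h5 : c [q, p, q, p] = 0) (h : lam p * lam q ≠ 1) : U p q = 0 := by
  have h6 := hUW p q [p, q] rfl
  have h7 := hUW p q [q, p] rfl
  have h8 : c [q, q, p, q] = lam q * c [q, p, q, q] := hc q [q, p, q] rfl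
  have h9 : c [p, p, p, q] = lam p * c [p, p, q, p] := hc p [p, p, q] rfl
  simp only [List.cons_append, List.nil_append] at h6 h7
  rw [sum_eq_add_of_ne hpq, sum_eq_add_of_ne hpq, h2, h3, h9, zero_smul, zero_smul, zero_add,
    add_zero] at h6
  rw [sum_eq_add_of_ne hpq, sum_eq_add_of_ne hpq, h4, h5, h8, zero_smul, zero_smul, zero_add,
    add_zero] at h7
  -- Both relations have the shape "multiple of `U p q` = multiple of `W p q`", up to the factors
  -- λ_q on the left of one and λ_p on the right of the other. Eliminating `W p q` leaves the factor
  -- 1 - λ_p λ_q.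
  have h10 : ((1 - (lam p * lam q : kˣ)) * c [q, p, q, q]) • U p q = 0 := by
    rw [Units.val_mul, sub_mul, sub_smul, one_mul, h6, mul_assoc, mul_smul (lam p : k),
      mul_smul (lam p : k), h7, sub_self]
  refine (smul_eq_zero.1 h10).resolve_left (mul_ne_zero ?_ h1)
  rw [sub_ne_zero]
  exact fun h' => h (Units.val_eq_one.1 h'.symm)

/-- The products `e_p X_p` and `e_q X_q` are multiples of `X_q e_q` because of the words
`p q^{n + 3}` and `q p q^{n + 2}`. -/
theorem WordRelations.exists_eq_smul (hUW : WordRelations c (n + 3) U W) (hpq : p ≠ q)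
    (h1 : c (p :: List.replicate (n + 3) q) ≠ 0)
    (h2 : c (q :: p :: List.replicate (n + 2) q) ≠ 0)
    (h3 : c (q :: List.replicate (n + 3) q) = 0)
    (h4 : c (p :: p :: List.replicate (n + 2) q) = 0)
    (h5 : c (p :: q :: p :: List.replicate (n + 1) q) = 0) :
    (∃ a : k, U p p = a • W q q) ∧ ∃ a : k, U q q = a • W q q := by
  constructor
  · have h := hUW p q (List.replicate (n + 2) q) (by simp)
    rw [← List.replicate_succ'] at h
    rw [sum_eq_add_of_ne hpq, sum_eq_add_of_ne hpq, h3, h4, zero_smul, zero_smul, add_zero,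
      zero_add] at h
    exact exists_eq_smul_of_smul_eq h1 h
  · have h := hUW q q (p :: List.replicate (n + 1) q) (by simp)
    rw [List.cons_append, ← List.replicate_succ'] at h
    rw [sum_eq_add_of_ne hpq, sum_eq_add_of_ne hpq, h4, h5, zero_smul, zero_smul, zero_add,
      zero_add] at h
    exact exists_eq_smul_of_smul_eq h2 h

end Words

theorem isTwistedPotential_add {k : Type u} [Field k] {n N : ℕ}
    {σ : (Fin n → k) ≃ₗ[k] (Fin n → k)} {v w : Free k n} (hv : IsTwistedPotential σ N v)
    (hw : IsTwistedPotential σ N w) : IsTwistedPotential σ N (v + w) :=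
  ⟨add_mem hv.1 hw.1, by rw [map_add, hv.2, hw.2]⟩

/-! ### Cyclic sums -/

section Cyclic

variable {k : Type u} [Field k] {s : ℕ} {l₁ l₂ : kˣ} {p q : Fin 2}

theorem cyclicSum_eq (s : ℕ) (a : kˣ) (p q : Fin 2) :
    cyclicSum s a (FreeAlgebra.ι k q) (FreeAlgebra.ι k p) =
      ∑ i ∈ Finset.range (s + 1), (a : k) ^ i •
        mono (List.replicate i q ++ p :: List.replicate (s - i) q) := by
  refine Finset.sum_congr rfl fun i _ => ?_
  rw [mono_append, mono_cons, mono_replicate, mono_replicate, mul_assoc]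

/-- Rotation carries each summand to the next one, except the last, which ends in p and returns to
the first; the hypothesis is what makes the scalar match there. -/
theorem isTwistedPotential_cyclicSum (h : ![l₁, l₂] p * ![l₁, l₂] q ^ s = 1) :
    IsTwistedPotential (diagAut l₁ l₂) (s + 1)
      (cyclicSum s (![l₁, l₂] q) (FreeAlgebra.ι k q) (FreeAlgebra.ι k p)) := by
  rw [cyclicSum_eq]
  constructor
  · refine sum_mem fun i hi => Submodule.smul_mem _ _ (mono_mem_deg_of_length ?_)
    have := Finset.mem_range.1 hi
    simp
    omega
  · have hlast : ∀ i < s, rotate (diagAut l₁ l₂)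
        (mono (List.replicate i q ++ p :: List.replicate (s - i) q)) =
        ((![l₁, l₂] q : kˣ) : k) • mono (List.replicate (i + 1) q ++
          p :: List.replicate (s - (i + 1)) q) := by
      intro i hi
      rw [show s - i = s - (i + 1) + 1 by omega, List.replicate_succ' (n := s - (i + 1)),
        ← List.cons_append, ← List.append_assoc, rotate_diagAut_mono, List.replicate_succ,
        List.cons_append]
    have hend : rotate (diagAut l₁ l₂) (mono (List.replicate s q ++ p :: List.replicate (s - s) q))
        = ((![l₁, l₂] p : kˣ) : k) • mono (List.replicate 0 q ++
          p :: List.replicate (s - 0) q) := by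
      rw [Nat.sub_self, List.replicate_zero, rotate_diagAut_mono]
      rfl
    rw [map_sum, Finset.sum_range_succ, Finset.sum_range_succ', map_smul, hend, smul_smul]
    congr 1
    · refine Finset.sum_congr rfl fun i hi => ?_
      rw [map_smul, hlast i (Finset.mem_range.1 hi), smul_smul, pow_succ]
    · rw [mul_comm, ← Units.val_pow_eq_pow_val, ← Units.val_mul, h, Units.val_one, pow_zero]

theorem coeff_cyclicSum_eq_zero (a : kˣ) (hpq : p ≠ q) {W : List (Fin 2)} (hW : W.count p ≠ 1) :
    coeff W (cyclicSum s a (FreeAlgebra.ι k q) (FreeAlgebra.ι k p)) = 0 := by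
  rw [cyclicSum_eq, map_sum]
  refine Finset.sum_eq_zero fun i _ => ?_
  rw [map_smul, coeff_mono, if_neg, smul_zero]
  rintro rfl
  apply hW
  simp [List.count_replicate, hpq.symm]

theorem coeff_cyclicSum (a : kˣ) (hpq : p ≠ q) :
    coeff (p :: List.replicate s q)
      (cyclicSum s a (FreeAlgebra.ι k q) (FreeAlgebra.ι k p)) = 1 := by
  rw [cyclicSum_eq, map_sum, Finset.sum_range_succ', Finset.sum_eq_zero]
  · simp [coeff_mono]
  · intro i _
    rw [map_smul, coeff_mono, if_neg, smul_zero]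
    rw [List.replicate_succ, List.cons_append]
    intro h
    exact hpq (List.cons.inj h).1.symm

theorem isTwistedPotential_pow (h : ![l₁, l₂] p = 1) :
    IsTwistedPotential (diagAut l₁ l₂) (s + 1) (FreeAlgebra.ι k p ^ (s + 1)) := by
  rw [← mono_replicate]
  refine ⟨mono_mem_deg_of_length (by simp), ?_⟩
  rw [List.replicate_succ', rotate_diagAut_mono, h, Units.val_one, one_smul,
    ← List.replicate_succ, List.replicate_succ']

/-- Only words with exactly 1 or exactly s + 1 letters p have nonzero coefficients. The term p^{s+1}
is what kills e_q X_p; the cyclic sum gives the other three relations needed for rigidity. -/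
theorem frame_of_powers (hs : 2 < s) (hpq : p ≠ q) (h1 : ![l₁, l₂] p = 1)
    (h2 : ![l₁, l₂] q ^ s = 1) :
    IsTwistedPotential (diagAut l₁ l₂) (s + 1) (FreeAlgebra.ι k p ^ (s + 1) +
        cyclicSum s (![l₁, l₂] q) (FreeAlgebra.ι k q) (FreeAlgebra.ι k p)) ∧
      Nonempty (Frame (dualIdeal s (potentialIdeal (FreeAlgebra.ι k p ^ (s + 1) +
        cyclicSum s (![l₁, l₂] q) (FreeAlgebra.ι k q) (FreeAlgebra.ι k p)))) s ![l₁, l₂]) := by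
  set w := FreeAlgebra.ι k p ^ (s + 1) +
    cyclicSum s (![l₁, l₂] q) (FreeAlgebra.ι k q) (FreeAlgebra.ι k p) with hw_def
  have hw : IsTwistedPotential (diagAut l₁ l₂) (s + 1) w :=
    isTwistedPotential_add (isTwistedPotential_pow h1)
      (isTwistedPotential_cyclicSum (by rw [h1, h2, one_mul]))
  refine ⟨hw, ?_⟩
  have hrot := fun j l (_ : l.length = s) => coeff_cons_of_isTwistedPotential hw j l
  have hzero : ∀ W : List (Fin 2), W.count p ≠ 1 → W.count p ≠ s + 1 → coeff W w = 0 := by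
    intro W hW1 hW2
    rw [hw_def, map_add, coeff_cyclicSum_eq_zero _ hpq hW1, ← mono_replicate, coeff_mono, if_neg,
      add_zero]
    rintro rfl
    simp at hW2
  have hpow : coeff (p :: List.replicate s p) w ≠ 0 := by
    rw [hw_def, map_add, coeff_cyclicSum_eq_zero _ hpq (by simp; omega), ← mono_replicate,
      coeff_mono, List.replicate_succ]
    simp
  have hcyc : coeff (p :: List.replicate s q) w ≠ 0 := by
    rw [hw_def, map_add, coeff_cyclicSum _ hpq, ← mono_replicate, coeff_mono, if_neg]
    · simp
    · intro h
      have := congrArg (List.count p) h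
      simp [List.count_replicate, hpq.symm] at this
      omega
  have hcyc' : ∀ a b, a + b = s → coeff (List.replicate a q ++ p :: List.replicate b q) w ≠ 0 := by
    intro a b hab
    refine ne_zero_of_rotate hrot _ _ (by simp; omega) ?_
    rw [List.cons_append, List.replicate_append_replicate, add_comm, hab]
    exact hcyc
  obtain ⟨n, rfl⟩ : ∃ n, s = n + 3 := ⟨s - 3, by omega⟩
  refine frame_of_isRigid hw
    (fun j => if j = p then List.replicate (n + 3) q else p :: List.replicate (n + 2) q) ?_
    (forall_fin_two_of_ne hpq ?_ ?_)
    (forall_fin_two_of_ne hpq (forall_fin_two_of_ne hpq ?_ ?_) (forall_fin_two_of_ne hpq ?_ ?_))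
    (isRigid_of_ne hpq q ?_)
  · intro j
    split_ifs <;> simp
  · simpa using hcyc
  · simpa [hpq.symm] using hcyc' 1 (n + 2) (by omega)
  · exact fun h => absurd rfl h
  · intro _
    refine hzero _ ?_ ?_ <;> simp [hpq.symm, List.count_replicate]
  · intro _
    refine hzero _ ?_ ?_ <;> simp [hpq.symm, List.count_replicate]
  · exact fun h => absurd rfl h
  · intro E _ _ U W hUW
    refine ⟨hUW.mixed_eq_zero hpq ?_ ?_ ?_ ?_, hUW.mixed_eq_zero_of_pow hpq hpow ?_ ?_ ?_,
      hUW.exists_eq_smul hpq ?_ ?_ ?_ ?_ ?_⟩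
    · simpa using hcyc' 2 (n + 1) (by omega)
    · refine hzero _ ?_ ?_ <;> simp [hpq.symm, List.count_replicate]
    · refine hzero _ ?_ ?_ <;> simp [hpq.symm, List.count_replicate]
    · refine hzero _ ?_ ?_ <;> simp [hpq.symm, List.count_replicate]
    · refine hzero _ ?_ ?_ <;> simp [hpq.symm]
    · refine hzero _ ?_ ?_ <;> simp [hpq.symm]
    · refine hzero _ ?_ ?_ <;> simp [hpq.symm]
    · exact hcyc
    · simpa using hcyc' 1 (n + 2) (by omega)
    · refine hzero _ ?_ ?_ <;> simp [hpq.symm, List.count_replicate]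
    · refine hzero _ ?_ ?_ <;> simp [hpq.symm, List.count_replicate]
    · refine hzero _ ?_ ?_ <;> simp [hpq.symm, List.count_replicate]

/-- A word has zero coefficient as soon as neither letter occurs exactly once. The symmetry between
p and q makes one argument serve both mixed products. -/
theorem frame_of_two_cyclicSums (hs : 2 < s) (hpq : p ≠ q)
    (h1 : ![l₁, l₂] p * ![l₁, l₂] q ^ s = 1) (h2 : ![l₁, l₂] q * ![l₁, l₂] p ^ s = 1)
    (h3 : s = 3 → ![l₁, l₂] p * ![l₁, l₂] q ≠ 1) :
    IsTwistedPotential (diagAut l₁ l₂) (s + 1)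
        (cyclicSum s (![l₁, l₂] q) (FreeAlgebra.ι k q) (FreeAlgebra.ι k p) +
          cyclicSum s (![l₁, l₂] p) (FreeAlgebra.ι k p) (FreeAlgebra.ι k q)) ∧
      Nonempty (Frame (dualIdeal s (potentialIdeal
        (cyclicSum s (![l₁, l₂] q) (FreeAlgebra.ι k q) (FreeAlgebra.ι k p) +
          cyclicSum s (![l₁, l₂] p) (FreeAlgebra.ι k p) (FreeAlgebra.ι k q)))) s ![l₁, l₂]) := by
  set w := cyclicSum s (![l₁, l₂] q) (FreeAlgebra.ι k q) (FreeAlgebra.ι k p) +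
    cyclicSum s (![l₁, l₂] p) (FreeAlgebra.ι k p) (FreeAlgebra.ι k q) with hw_def
  have hw : IsTwistedPotential (diagAut l₁ l₂) (s + 1) w :=
    isTwistedPotential_add (isTwistedPotential_cyclicSum h1) (isTwistedPotential_cyclicSum h2)
  refine ⟨hw, ?_⟩
  have hrot := fun j l (_ : l.length = s) => coeff_cons_of_isTwistedPotential hw j l
  have hzero : ∀ W : List (Fin 2), W.count p ≠ 1 → W.count q ≠ 1 → coeff W w = 0 := by
    intro W hW1 hW2
    rw [hw_def, map_add, coeff_cyclicSum_eq_zero _ hpq hW1,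
      coeff_cyclicSum_eq_zero _ hpq.symm hW2, add_zero]
  have hcycp : coeff (p :: List.replicate s q) w ≠ 0 := by
    rw [hw_def, map_add, coeff_cyclicSum _ hpq, coeff_cyclicSum_eq_zero _ hpq.symm, add_zero]
    · exact one_ne_zero
    · simp [hpq]
      omega
  have hcycq : coeff (q :: List.replicate s p) w ≠ 0 := by
    rw [hw_def, map_add, coeff_cyclicSum _ hpq.symm, coeff_cyclicSum_eq_zero _ hpq, zero_add]
    · exact one_ne_zero
    · simp [hpq.symm]
      omega
  have hcycp' : ∀ a b, a + b = s →
      coeff (List.replicate a q ++ p :: List.replicate b q) w ≠ 0 := by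
    intro a b hab
    refine ne_zero_of_rotate hrot _ _ (by simp; omega) ?_
    rw [List.cons_append, List.replicate_append_replicate, add_comm, hab]
    exact hcycp
  have hcycq' : ∀ a b, a + b = s →
      coeff (List.replicate a p ++ q :: List.replicate b p) w ≠ 0 := by
    intro a b hab
    refine ne_zero_of_rotate hrot _ _ (by simp; omega) ?_
    rw [List.cons_append, List.replicate_append_replicate, add_comm, hab]
    exact hcycq
  obtain ⟨n, rfl⟩ : ∃ n, s = n + 3 := ⟨s - 3, by omega⟩
  refine frame_of_isRigid hw
    (fun j => if j = p then List.replicate (n + 3) q else p :: List.replicate (n + 2) q) ?_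
    (forall_fin_two_of_ne hpq ?_ ?_)
    (forall_fin_two_of_ne hpq (forall_fin_two_of_ne hpq ?_ ?_) (forall_fin_two_of_ne hpq ?_ ?_))
    (isRigid_of_ne hpq q ?_)
  · intro j
    split_ifs <;> simp
  · simpa using hcycp
  · simpa [hpq.symm] using hcycp' 1 (n + 2) (by omega)
  · exact fun h => absurd rfl h
  · intro _
    refine hzero _ ?_ ?_ <;> simp [hpq, hpq.symm, List.count_replicate]
  · intro _
    refine hzero _ ?_ ?_ <;> simp [hpq.symm, List.count_replicate]
  · exact fun h => absurd rfl h
  · intro E _ _ U W hUW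
    refine ⟨?_, ?_, hUW.exists_eq_smul hpq hcycp ?_ ?_ ?_ ?_⟩
    -- For s = 3 the word `p p q p` contains q only once and has a nonzero coefficient, so one
    -- relation no longer suffices; a second one and λ_p λ_q ≠ 1 are needed.
    · rcases n with _ | n
      · refine WordRelations.mixed_eq_zero_of_length_four hrot hUW hpq
          (hcycp' 1 2 rfl) ?_ ?_ ?_ ?_ (h3 rfl)
        all_goals refine hzero _ ?_ ?_ <;> simp [hpq, hpq.symm]
      · refine hUW.mixed_eq_zero hpq (hcycp' 2 (n + 1 + 1) (by omega)) ?_ ?_ ?_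
        all_goals refine hzero _ ?_ ?_ <;> simp [hpq, hpq.symm, List.count_replicate]
    · rcases n with _ | n
      · refine WordRelations.mixed_eq_zero_of_length_four hrot hUW hpq.symm
          (hcycq' 1 2 rfl) ?_ ?_ ?_ ?_ (mul_comm (![l₁, l₂] p) _ ▸ h3 rfl)
        all_goals refine hzero _ ?_ ?_ <;> simp [hpq, hpq.symm]
      · refine hUW.mixed_eq_zero hpq.symm (hcycq' 2 (n + 1 + 1) (by omega)) ?_ ?_ ?_
        all_goals refine hzero _ ?_ ?_ <;> simp [hpq, hpq.symm, List.count_replicate]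
    · simpa using hcycp' 1 (n + 2) (by omega)
    all_goals refine hzero _ ?_ ?_ <;> simp [hpq, hpq.symm, List.count_replicate]

end Cyclic

/-! ### The mixed potential -/

section Mixed

variable {k : Type u} [Field k] {l₁ l₂ : kˣ}

theorem potentialMixed_eq (s j : ℕ) (l₁ l₂ : kˣ) :
    potentialMixed s j l₁ l₂ =
      ∑ i ∈ Finset.range j, (l₁ : k) ^ i • mono (List.replicate i 0 ++
        (List.replicate (s + 1 - j) 1 ++ List.replicate (j - i) 0)) +
      (l₁ : k) ^ j • ∑ i ∈ Finset.range (s + 1 - j), (l₂ : k) ^ i • mono (List.replicate i 1 ++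
        (List.replicate j 0 ++ List.replicate (s + 1 - j - i) 1)) := by
  simp only [potentialMixed, mono_append, mono_replicate, y₁, y₂, mul_assoc]

theorem sum_range_shift {M : Type*} [AddCommGroup M] (f : ℕ → M) (n : ℕ) :
    ∑ i ∈ Finset.range n, f (i + 1) = ∑ i ∈ Finset.range n, f i + f n - f 0 := by
  rw [← Finset.sum_range_succ, Finset.sum_range_succ', add_sub_cancel_right]

/-- Rotation of a word with two or three blocks moves one letter from the last block. -/
theorem rotate_blocks (p q : Fin 2) {a N i : ℕ} (hi : i < N) :
    rotate (diagAut l₁ l₂) (mono (List.replicate i p ++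
      (List.replicate a q ++ List.replicate (N - i) p))) =
      ((![l₁, l₂] p : kˣ) : k) • mono (List.replicate (i + 1) p ++
        (List.replicate a q ++ List.replicate (N - (i + 1)) p)) := by
  rw [show N - i = N - (i + 1) + 1 by omega, List.replicate_succ' (n := N - (i + 1)),
    ← List.append_assoc, ← List.append_assoc, rotate_diagAut_mono, List.replicate_succ]
  simp

/-- Rotation shifts the index in both sums, so only boundary terms matter. The new last term of the
first sum is the lost first term of the second, and the new last term of the second is the lost
first term of the first by the hypothesis. -/
theorem isTwistedPotential_potentialMixed {s j : ℕ} (hj : j ≤ s)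
    (h : l₁ ^ j * l₂ ^ (s + 1 - j) = 1) :
    IsTwistedPotential (diagAut l₁ l₂) (s + 1) (potentialMixed (k := k) s j l₁ l₂) := by
  rw [potentialMixed_eq]
  constructor
  · refine add_mem (sum_mem fun i hi => Submodule.smul_mem _ _ (mono_mem_deg_of_length ?_))
      (Submodule.smul_mem _ _ (sum_mem fun i hi =>
        Submodule.smul_mem _ _ (mono_mem_deg_of_length ?_)))
    · have := Finset.mem_range.1 hi
      simp
      omega
    · have := Finset.mem_range.1 hi
      simp
      omega
  · have h1 := sum_range_shift (fun i => (l₁ : k) ^ i • (mono (List.replicate i 0 ++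
      (List.replicate (s + 1 - j) 1 ++ List.replicate (j - i) 0)) : Free k 2)) j
    have h2 := sum_range_shift (fun i => (l₂ : k) ^ i • (mono (List.replicate i 1 ++
      (List.replicate j 0 ++ List.replicate (s + 1 - j - i) 1)) : Free k 2)) (s + 1 - j)
    have h3 : (l₁ : k) ^ j * (l₂ : k) ^ (s + 1 - j) = 1 := by
      rw [← Units.val_pow_eq_pow_val, ← Units.val_pow_eq_pow_val, ← Units.val_mul, h,
        Units.val_one]
    have h4 : ∀ i ∈ Finset.range j, rotate (diagAut l₁ l₂) ((l₁ : k) ^ i •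
        mono (List.replicate i 0 ++
          (List.replicate (s + 1 - j) 1 ++ List.replicate (j - i) 0))) =
        (l₁ : k) ^ (i + 1) • mono (List.replicate (i + 1) 0 ++
          (List.replicate (s + 1 - j) 1 ++ List.replicate (j - (i + 1)) 0)) := by
      intro i hi
      rw [map_smul, rotate_blocks _ _ (Finset.mem_range.1 hi), smul_smul, pow_succ]
      rfl
    have h5 : ∀ i ∈ Finset.range (s + 1 - j), rotate (diagAut l₁ l₂) ((l₂ : k) ^ i •
        mono (List.replicate i 1 ++
          (List.replicate j 0 ++ List.replicate (s + 1 - j - i) 1))) =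
        (l₂ : k) ^ (i + 1) • mono (List.replicate (i + 1) 1 ++
          (List.replicate j 0 ++ List.replicate (s + 1 - j - (i + 1)) 1)) := by
      intro i hi
      rw [map_smul, rotate_blocks _ _ (Finset.mem_range.1 hi), smul_smul, pow_succ]
      rfl
    rw [map_add, map_smul, map_sum, map_sum, Finset.sum_congr rfl h4, Finset.sum_congr rfl h5,
      h1, h2]
    simp only [Nat.sub_self, List.replicate_zero, List.append_nil, List.nil_append, Nat.sub_zero,
      pow_zero, one_smul, smul_add, smul_sub, smul_smul, h3]
    abel

/-- The words of the mixed potential. -/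
theorem coeff_potentialMixed_eq_zero {s j : ℕ} {V : List (Fin 2)}
    (h1 : ∀ i < j, List.replicate i 0 ++
      (List.replicate (s + 1 - j) 1 ++ List.replicate (j - i) 0) ≠ V)
    (h2 : ∀ i < s + 1 - j, List.replicate i 1 ++
      (List.replicate j 0 ++ List.replicate (s + 1 - j - i) 1) ≠ V) :
    coeff V (potentialMixed (k := k) s j l₁ l₂) = 0 := by
  rw [potentialMixed_eq, map_add, map_smul, map_sum, map_sum, Finset.sum_eq_zero,
    Finset.sum_eq_zero, smul_zero, add_zero]
  · intro i hi
    rw [map_smul, coeff_mono, if_neg (h2 i (Finset.mem_range.1 hi)), smul_zero]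
  · intro i hi
    rw [map_smul, coeff_mono, if_neg (h1 i (Finset.mem_range.1 hi)), smul_zero]

theorem coeff_potentialMixed_of_count {s j : ℕ} {V : List (Fin 2)} (hV : V.count 0 ≠ j) :
    coeff V (potentialMixed (k := k) s j l₁ l₂) = 0 := by
  refine coeff_potentialMixed_eq_zero (fun i hi => ?_) (fun i hi => ?_)
  · rintro rfl
    apply hV
    simp [List.count_replicate]
    omega
  · rintro rfl
    apply hV
    simp [List.count_replicate]

/-- The words of the potential are rotations of two blocks of lengths a + 2 and b + 2. Both lengths
are at least 2, so no letter is isolated strictly inside a word. -/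
theorem coeff_potentialMixed_one_zero_one (a b : ℕ) (l : List (Fin 2)) :
    coeff (1 :: 0 :: 1 :: l) (potentialMixed (k := k) (a + b + 3) (a + 2) l₁ l₂) = 0 := by
  have hb : a + b + 3 + 1 - (a + 2) = b + 2 := by omega
  refine coeff_potentialMixed_eq_zero (fun i hi => ?_) (fun i hi => ?_) <;> rw [hb]
  · rcases i with _ | _ | i <;> simp [List.replicate_succ]
  · rcases i with _ | _ | i <;> simp [List.replicate_succ]

theorem coeff_potentialMixed_zero_one_zero (a b : ℕ) (l : List (Fin 2)) :
    coeff (0 :: 1 :: 0 :: l) (potentialMixed (k := k) (a + b + 3) (a + 2) l₁ l₂) = 0 := by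
  have hb : a + b + 3 + 1 - (a + 2) = b + 2 := by omega
  refine coeff_potentialMixed_eq_zero (fun i hi => ?_) (fun i hi => ?_) <;> rw [hb]
  · rcases i with _ | _ | i <;> simp [List.replicate_succ]
  · rcases i with _ | _ | i <;> simp [List.replicate_succ]

theorem coeff_potentialMixed_base (a b : ℕ) :
    coeff (List.replicate (b + 2) 1 ++ List.replicate (a + 2) 0)
      (potentialMixed (k := k) (a + b + 3) (a + 2) l₁ l₂) = 1 := by
  have hb : a + b + 3 + 1 - (a + 2) = b + 2 := by omega
  rw [potentialMixed_eq, hb, map_add, map_smul, map_sum, map_sum, Finset.sum_range_succ',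
    Finset.sum_eq_zero, Finset.sum_eq_zero]
  · simp [coeff_mono]
  · intro i hi
    have hi := Finset.mem_range.1 hi
    rw [map_smul, coeff_mono, if_neg, smul_zero]
    intro h
    -- The last letters differ: this term ends in 1, the target word in 0.
    rw [show b + 2 - i = b + 1 - i + 1 by omega, List.replicate_succ' (n := b + 1 - i),
      List.replicate_succ' (n := a + 1)] at h
    simp only [← List.append_assoc] at h
    simpa using List.append_inj_right' h rfl
  · intro i _
    rw [map_smul, coeff_mono, if_neg, smul_zero]
    simp [List.replicate_succ]

/-- With blocks of lengths a + 2 and b + 2, the words 0 1^{b+1} 0^{a+2} and 1 0^{a+1} 1^{b+2} kill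
the two mixed products. The words 0 1^{b+2} 0^{a+1} and 1^{b+2} 0^{a+2} make both e_i X_i multiples
of X_0 e_0. All unwanted coefficients vanish by counting letters or because of an isolated letter.
-/
theorem frame_of_potentialMixed {s j : ℕ} (hj : 2 ≤ j) (hjs : j ≤ s - 1)
    (h : l₁ ^ j * l₂ ^ (s + 1 - j) = 1) :
    Nonempty (Frame (dualIdeal s (potentialIdeal (potentialMixed (k := k) s j l₁ l₂))) s
      ![l₁, l₂]) := by
  have hw := isTwistedPotential_potentialMixed (k := k) (by omega) h
  have hrot := fun i l (_ : l.length = s) => coeff_cons_of_isTwistedPotential hw i l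
  obtain ⟨a, rfl⟩ : ∃ a, j = a + 2 := ⟨j - 2, by omega⟩
  obtain ⟨b, rfl⟩ : ∃ b, s = a + b + 3 := ⟨s - a - 3, by omega⟩
  set w := potentialMixed (k := k) (a + b + 3) (a + 2) l₁ l₂ with hw_def
  have hzero : ∀ V : List (Fin 2), V.count 0 ≠ a + 2 → coeff V w = 0 :=
    fun V => coeff_potentialMixed_of_count
  have hbase : coeff (List.replicate (b + 2) 1 ++ List.replicate (a + 2) 0) w ≠ 0 := by
    rw [coeff_potentialMixed_base]
    exact one_ne_zero
  have hbase0 : coeff (0 :: (List.replicate (b + 2) 1 ++ List.replicate (a + 1) 0)) w ≠ 0 := by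
    refine ne_zero_of_rotate (c := fun l => coeff l w) hrot [0]
      (List.replicate (b + 2) 1 ++ List.replicate (a + 1) 0) (by simp; omega) ?_
    rwa [List.append_assoc, ← List.replicate_succ']
  have hbase1 : coeff (1 :: (List.replicate (b + 1) 1 ++ List.replicate (a + 2) 0)) w ≠ 0 :=
    hbase
  have hbase2 : coeff (0 :: (List.replicate (a + 1) 0 ++ List.replicate (b + 2) 1)) w ≠ 0 := by
    exact ne_zero_of_rotate (c := fun l => coeff l w) hrot (List.replicate (a + 2) 0)
      (List.replicate (b + 2) 1) (by simp; omega) hbase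
  -- Each chosen word is a rotation of 1^{b+2} 0^{a+2} with its first letter removed; putting back
  -- the wrong letter spoils the letter count.
  refine frame_of_isRigid hw
    ![List.replicate (b + 2) 1 ++ List.replicate (a + 1) 0,
      List.replicate (b + 1) 1 ++ List.replicate (a + 2) 0] ?_ ?_ ?_
    (isRigid_of_ne zero_ne_one 0 ?_)
  · rw [Fin.forall_fin_two]
    constructor <;> simp <;> omega
  · rw [Fin.forall_fin_two]
    exact ⟨hbase0, hbase1⟩
  · simp only [Fin.forall_fin_two]
    refine ⟨⟨fun h => absurd rfl h, fun _ => hzero _ ?_⟩,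
      ⟨fun _ => hzero _ ?_, fun h => absurd rfl h⟩⟩ <;> simp [List.count_replicate]
  · intro E _ _ U W hUW
    have hsplit : ∀ n : ℕ, ∀ v : List (Fin 2), v ++ List.replicate n 0 ++ [0] =
        v ++ List.replicate (n + 1) 0 := by
      intro n v
      rw [List.append_assoc, ← List.replicate_succ']
    refine ⟨?_, ?_, ?_, ?_⟩
    · have h := hUW 0 0 (List.replicate (b + 1) 1 ++ List.replicate (a + 1) 0) (by simp; omega)
      rw [hsplit, Fin.sum_univ_two, Fin.sum_univ_two] at h
      have z1 : coeff (0 :: (List.replicate (b + 1) 1 ++ List.replicate (a + 1 + 1) 0)) w = 0 :=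
        hzero _ (by simp [List.count_replicate])
      have z2 : coeff (0 :: 0 :: (List.replicate (b + 1) 1 ++ List.replicate (a + 1) 0)) w = 0 :=
        hzero _ (by simp [List.count_replicate])
      have z3 : coeff (1 :: 0 :: (List.replicate (b + 1) 1 ++ List.replicate (a + 1) 0)) w = 0 :=
        coeff_potentialMixed_one_zero_one a b _
      simp only [z1, z2, z3, zero_smul, zero_add] at h
      exact (smul_eq_zero.1 h).resolve_left hbase1
    · have h := hUW 1 1 (List.replicate (a + 1) 0 ++ List.replicate (b + 1) 1) (by simp; omega)
      rw [List.append_assoc, ← List.replicate_succ', Fin.sum_univ_two, Fin.sum_univ_two] at h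
      have z1 : coeff (1 :: (List.replicate (a + 1) 0 ++ List.replicate (b + 1 + 1) 1)) w = 0 :=
        hzero _ (by simp [List.count_replicate])
      have z2 : coeff (1 :: 1 :: (List.replicate (a + 1) 0 ++ List.replicate (b + 1) 1)) w = 0 :=
        hzero _ (by simp [List.count_replicate])
      have z3 : coeff (0 :: 1 :: (List.replicate (a + 1) 0 ++ List.replicate (b + 1) 1)) w = 0 :=
        coeff_potentialMixed_zero_one_zero a b _
      simp only [z1, z2, z3, zero_smul, add_zero] at h
      exact (smul_eq_zero.1 h).resolve_left hbase2
    · have h := hUW 0 0 (List.replicate (b + 2) 1 ++ List.replicate a 0) (by simp; omega)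
      rw [hsplit, Fin.sum_univ_two, Fin.sum_univ_two] at h
      have z1 : coeff (1 :: (List.replicate (b + 2) 1 ++ List.replicate (a + 1) 0)) w = 0 :=
        hzero _ (by simp [List.count_replicate])
      have z2 : coeff (1 :: 0 :: (List.replicate (b + 2) 1 ++ List.replicate a 0)) w = 0 :=
        hzero _ (by simp [List.count_replicate])
      simp only [z1, z2, zero_smul, add_zero] at h
      exact exists_eq_smul_of_smul_eq hbase0 h
    · have h := hUW 1 0 (List.replicate (b + 1) 1 ++ List.replicate (a + 1) 0) (by simp; omega)
      rw [hsplit, Fin.sum_univ_two, Fin.sum_univ_two] at h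
      have z1 : coeff (0 :: (List.replicate (b + 1) 1 ++ List.replicate (a + 1 + 1) 0)) w = 0 :=
        hzero _ (by simp [List.count_replicate])
      have z2 : coeff (1 :: 1 :: (List.replicate (b + 1) 1 ++ List.replicate (a + 1) 0)) w = 0 :=
        hzero _ (by simp [List.count_replicate])
      simp only [z1, z2, zero_smul, zero_add, add_zero] at h
      exact exists_eq_smul_of_smul_eq hbase1 h

end Mixed

/-! ### The main theorem -/

theorem realizes_of_frame {k : Type u} [Field k] {s : ℕ} (hs : 2 < s) {l₁ l₂ : kˣ}
    {ν : A0 k ≃ₐ[k] A0 k} (hν₁ : ν (A0.x k) = (l₁ : k) • A0.x k)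
    (hν₂ : ν (A0.y k) = (l₂ : k) • A0.y k) {w : Free k 2}
    (h : IsTwistedPotential (diagAut l₁ l₂) (s + 1) w ∧
      Nonempty (Frame (dualIdeal s (potentialIdeal w)) s ![l₁, l₂])) :
    IsTwistedPotential (diagAut l₁ l₂) (s + 1) w ∧ Realizes s ν (potentialIdeal w) := by
  obtain ⟨hw, ⟨F⟩⟩ := h
  exact ⟨hw, isHomogeneousIdeal_potentialIdeal hw.1, exists_iso_of_coord _ (F.coord hs.le) ν
    (coordD ![l₁, l₂] ν (Fin.forall_fin_two.2 ⟨hν₁, hν₂⟩))⟩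

theorem frame_of_realizes {k : Type u} [Field k] {s m : ℕ} {l₁ l₂ : kˣ}
    {ν : A0 k ≃ₐ[k] A0 k} (hν₁ : ν (A0.x k) = (l₁ : k) • A0.x k)
    (hν₂ : ν (A0.y k) = (l₂ : k) • A0.y k) {I : TwoSidedIdeal (Free k m)}
    (h : Realizes s ν I) : Nonempty (Frame (dualIdeal s I) s ![l₁, l₂]) := by
  obtain ⟨-, φ, hφ, ⟨e⟩⟩ := h
  have C : Coord ![l₁, l₂] (tripleD ν φ hφ).grA (tripleD ν φ hφ).grM (tripleD ν φ hφ).bimod :=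
    coordD ![l₁, l₂] ν (Fin.forall_fin_two.2 ⟨hν₁, hν₂⟩)
  exact ⟨(e.coord C).frame⟩

/-- `Frame.eq_one_and_pow_eq_one` applies directly unless λ_1^s λ_2 = 1; in that case the failure of
(2) lets it apply with the two letters interchanged. -/
theorem conditions_of_frame {k : Type u} [Field k] {s m : ℕ} (hs : 2 < s) {l₁ l₂ : kˣ}
    {I : TwoSidedIdeal (Free k m)} (F : Frame (dualIdeal s I) s ![l₁, l₂]) :
    (∃ j : ℕ, 2 ≤ j ∧ j ≤ s - 1 ∧ l₁ ^ j * l₂ ^ (s + 1 - j) = 1) ∨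
      (l₁ * l₂ ^ s = 1 ∧ l₁ ^ s * l₂ = 1) ∨
      ((l₁ = 1 ∧ l₂ ^ s = 1) ∨ (l₁ ^ s = 1 ∧ l₂ = 1)) := by
  by_contra! h
  obtain ⟨h1, h2, h3, h4⟩ := h
  by_cases h5 : l₁ ^ s * l₂ = 1
  · have h6 : l₂ ^ s * l₁ ≠ 1 := fun h => h2 (by rwa [mul_comm]) h5
    obtain ⟨h7, h8⟩ := F.eq_one_and_pow_eq_one hs rfl (fun f hf => hf.1) (p := 1) (q := 0)
      one_ne_zero h6 (fun t ht ht' => by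
        have := h1 (s + 1 - t) (by omega) (by omega)
        rw [show s + 1 - (s + 1 - t) = t by omega, mul_comm] at this
        exact this)
    exact h4 h8 h7
  · obtain ⟨h7, h8⟩ := F.eq_one_and_pow_eq_one hs rfl (fun f hf => hf.1) (p := 0) (q := 1)
      zero_ne_one h5 h1
    exact h3 h7 h8

end HomTriples

end

open HomTriples

theorem mainTheorem12 {k : Type u} [Field k] [IsAlgClosed k] (s : ℕ) (hs : 2 < s)
    (l₁ l₂ : kˣ) (ν : A0 k ≃ₐ[k] A0 k)
    (hν₁ : ν (A0.x k) = (l₁ : k) • A0.x k) (hν₂ : ν (A0.y k) = (l₂ : k) • A0.y k) :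
    ((∃ (m : ℕ) (I : TwoSidedIdeal (Free k m)), Realizes s ν I) ↔
      ((∃ j : ℕ, 2 ≤ j ∧ j ≤ s - 1 ∧ l₁ ^ j * l₂ ^ (s + 1 - j) = 1) ∨
        (l₁ * l₂ ^ s = 1 ∧ l₁ ^ s * l₂ = 1) ∨
        ((l₁ = 1 ∧ l₂ ^ s = 1) ∨ (l₁ ^ s = 1 ∧ l₂ = 1)))) ∧
    (∀ j : ℕ, 2 ≤ j → j ≤ s - 1 → l₁ ^ j * l₂ ^ (s + 1 - j) = 1 →
      IsTwistedPotential (diagAut l₁ l₂) (s + 1) (potentialMixed s j l₁ l₂) ∧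
      Realizes s ν (potentialIdeal (potentialMixed s j l₁ l₂))) ∧
    (l₁ * l₂ ^ s = 1 → l₁ ^ s * l₂ = 1 →
      (∀ j : ℕ, 2 ≤ j → j ≤ s - 1 → l₁ ^ j * l₂ ^ (s + 1 - j) ≠ 1) →
      IsTwistedPotential (diagAut l₁ l₂) (s + 1)
        (cyclicSum s l₁ (y₁ k) (y₂ k) + cyclicSum s l₂ (y₂ k) (y₁ k)) ∧
      Realizes s ν
        (potentialIdeal (cyclicSum s l₁ (y₁ k) (y₂ k) + cyclicSum s l₂ (y₂ k) (y₁ k)))) ∧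
    (l₁ = 1 → l₂ ^ s = 1 →
      IsTwistedPotential (diagAut l₁ l₂) (s + 1)
        (y₁ k ^ (s + 1) + cyclicSum s l₂ (y₂ k) (y₁ k)) ∧
      Realizes s ν (potentialIdeal (y₁ k ^ (s + 1) + cyclicSum s l₂ (y₂ k) (y₁ k)))) ∧
    (l₁ ^ s = 1 → l₂ = 1 →
      IsTwistedPotential (diagAut l₁ l₂) (s + 1)
        (y₂ k ^ (s + 1) + cyclicSum s l₁ (y₁ k) (y₂ k)) ∧
      Realizes s ν (potentialIdeal (y₂ k ^ (s + 1) + cyclicSum s l₁ (y₁ k) (y₂ k)))) := by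
  have hmixed : ∀ j : ℕ, 2 ≤ j → j ≤ s - 1 → l₁ ^ j * l₂ ^ (s + 1 - j) = 1 →
      IsTwistedPotential (diagAut l₁ l₂) (s + 1) (potentialMixed s j l₁ l₂) ∧
      Realizes s ν (potentialIdeal (potentialMixed s j l₁ l₂)) := fun j hj hjs h =>
    realizes_of_frame hs hν₁ hν₂
      ⟨isTwistedPotential_potentialMixed (by omega) h, frame_of_potentialMixed hj hjs h⟩
  have hcyclic : l₁ * l₂ ^ s = 1 → l₁ ^ s * l₂ = 1 →
      (∀ j : ℕ, 2 ≤ j → j ≤ s - 1 → l₁ ^ j * l₂ ^ (s + 1 - j) ≠ 1) →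
      IsTwistedPotential (diagAut l₁ l₂) (s + 1)
        (cyclicSum s l₁ (y₁ k) (y₂ k) + cyclicSum s l₂ (y₂ k) (y₁ k)) ∧
      Realizes s ν
        (potentialIdeal (cyclicSum s l₁ (y₁ k) (y₂ k) + cyclicSum s l₂ (y₂ k) (y₁ k))) := by
    intro h1 h2 h3
    refine realizes_of_frame hs hν₁ hν₂ (frame_of_two_cyclicSums (p := 1) (q := 0) hs one_ne_zero
      ((mul_comm l₂ (l₁ ^ s)).trans h2) h1 ?_)
    -- For s = 3, λ_1 λ_2 = 1 would give λ_1² λ_2² = 1, the excluded mixed condition with exponent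
    -- 2.
    rintro rfl h
    refine h3 2 le_rfl le_rfl ?_
    change l₂ * l₁ = 1 at h
    rw [show 3 + 1 - 2 = 2 from rfl, ← mul_pow, mul_comm, h, one_pow]
  have hpow₁ : l₁ = 1 → l₂ ^ s = 1 →
      IsTwistedPotential (diagAut l₁ l₂) (s + 1)
        (y₁ k ^ (s + 1) + cyclicSum s l₂ (y₂ k) (y₁ k)) ∧
      Realizes s ν (potentialIdeal (y₁ k ^ (s + 1) + cyclicSum s l₂ (y₂ k) (y₁ k))) :=
    fun h1 h2 => realizes_of_frame hs hν₁ hν₂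
      (frame_of_powers (p := 0) (q := 1) hs zero_ne_one h1 h2)
  have hpow₂ : l₁ ^ s = 1 → l₂ = 1 →
      IsTwistedPotential (diagAut l₁ l₂) (s + 1)
        (y₂ k ^ (s + 1) + cyclicSum s l₁ (y₁ k) (y₂ k)) ∧
      Realizes s ν (potentialIdeal (y₂ k ^ (s + 1) + cyclicSum s l₁ (y₁ k) (y₂ k))) :=
    fun h1 h2 => realizes_of_frame hs hν₁ hν₂
      (frame_of_powers (p := 1) (q := 0) hs one_ne_zero h2 h1)
  refine ⟨⟨?_, ?_⟩, hmixed, hcyclic, hpow₁, hpow₂⟩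
  · rintro ⟨m, I, hI⟩
    obtain ⟨F⟩ := frame_of_realizes hν₁ hν₂ hI
    exact conditions_of_frame hs F
  · intro h
    -- The mixed case is settled before the others because the potential with two cyclic sums is
    -- only available when it fails.
    by_cases h1 : ∃ j : ℕ, 2 ≤ j ∧ j ≤ s - 1 ∧ l₁ ^ j * l₂ ^ (s + 1 - j) = 1
    · obtain ⟨j, hj, hjs, hj1⟩ := h1
      exact ⟨2, _, (hmixed j hj hjs hj1).2⟩
    · rcases h.resolve_left h1 with ⟨h2, h3⟩ | ⟨h2, h3⟩ | ⟨h2, h3⟩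
      · exact ⟨2, _, (hcyclic h2 h3 fun j hj hjs hj1 => h1 ⟨j, hj, hjs, hj1⟩).2⟩
      · exact ⟨2, _, (hpow₁ h2 h3).2⟩
      · exact ⟨2, _, (hpow₂ h2 h3).2⟩
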